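/- All graphs are finite and simple. A branch-decomposition of a finite set $X$ is a tree $T$ all of whose vertices have degree $1$ or $3$, together with a bijection from the leaves of $T$ to $X$; every edge of $T$ thus induces a partition $(A,X\setminus A)$ of $X$. For a graph $G$ and $A\subseteq V(G)$ let $\operatorname{mm}_G(A)$ be the size of a maximum matching in the bipartite graph formed by the edges of $G$ between $A$ and $V(G)\setminus A$. The maximum matching width $\operatorname{mmw}(G)$ is the minimum, over all branch-decompositions of $V(G)$, of the maximum of $\operatorname{mm}_G(A)$ over the partitions $(A,V(G)\setminus A)$ induced by the edges of the tree (and $\operatorname{mmw}(G)=0$ if $|V(G)|\le 1$). For an edge $ab$ of a graph, the $1$-subdivision, $2$-subdivision and $11$-subdivision of $ab$ replace $ab$ by a path $acb$, by a path $acdb$, and by two paths $acb$ and $adb$, respectively, where $c,d$ are new vertices. Let $W_5$ and $W_6$ be the wheels with centre $0$ and rim cycles $1234$ and $12345$, let $K_4$ have vertices $0,1,2,3$, let $K_{3,3}$ have parts $\{0,1,2\}$ and $\{3,4,5\}$, and let the prism consist of the triangles $012$ and $345$ and the edges $03,14,25$. Let $\mathcal O=\mathcal O_3\cup\mathcal O_4\cup\mathcal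 O_5\cup\mathcal O_6$, where: * $\mathcal O_3$ consists of the five edge-minimal $3$-connected graphs on the seven vertices $0,\dots,6$: the wheel, $K_{3,4}$, and the three graphs with edge sets $\{02,03,05,06,14,15,16,24,26,34,35\}$, $\{03,04,05,06,14,15,16,23,25,26,34\}$ and $\{03,04,05,06,12,15,16,24,26,34,35\}$. * $\mathcal O_4$ consists of the ten graphs obtained from $K_4$ by: $1$-subdividing all edges but $23$; $1$-subdividing $01,02,13$ and either $2$-subdividing or $11$-subdividing $03$; $1$-subdividing $01,02$ and $2$- or $11$-subdividing each of $13,23$ (three graphs up to isomorphism); $2$- or $11$-subdividing each of $01,02,12$ (four graphs up to isomorphism). * $\mathcal O_5$ consists of the following eighteen graphs: $W_5$ with the edges of one of the sets $\{01,12,14\}$, $\{01,02,03\}$, $\{01,02,12\}$, $\{12,23,34,14\}$, $\{01,12,23,34\}$, $\{01,02,23,34\}$, $\{01,02,23,14\}$, $\{01,03,12,23\}$, $\{01,03,12,34\}$ $1$-subdivided; $W_5$ with $12$ either $2$- or $11$-subdivided and the edges of $\{01,23\}$ or of $\{14,23\}$ $1$-subdivided; $W_5$ with $01$ either $2$- or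 $11$-subdivided and the edges of $\{02,14\}$ or of $\{03,12\}$ $1$-subdivided; and $W_5$ plus the edge $13$ with $01,03,13$ $1$-subdivided. * $\mathcal O_6$ consists of the following twelve graphs, in each of which two edges are $1$-subdivided: $K_{3,3}$ with $03,04$; $K_{3,3}$ plus the edge $01$, with $01,03$; $K_{3,3}$ plus the edges $01,12$, with $01,12$; the prism with $01,02$ or with $01,03$; the prism plus the edge $04$, with $04,01$, with $04,02$ or with $04,03$; and $W_6$ with $01,02$, with $01,03$, with $01,12$ or with $12,23$. These $45$ graphs are pairwise non-isomorphic, and a graph $G$ satisfies $\operatorname{mmw}(G)\le 2$ if and only if $G$ has no minor isomorphic to a graph in $\mathcal O$. -/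

import Mathlib

/-- `mm G A` is the size of a maximum matching in the bipartite graph `G[A, V \ A]`
(all edges of `G` with one end in `A` and the other end outside `A`). -/
noncomputable def mm {V : Type*} (G : SimpleGraph V) (A : Set V) : ℕ :=
  sSup {m | ∃ M : (G.between A Aᶜ).Subgraph, M.IsMatching ∧ M.edgeSet.ncard = m}

/-- A branch-decomposition of a set `X`: a finite tree in which every vertex has degree
`1` or `3`, with a bijection from its leaves to `X`. -/
structure BranchDecomposition (X : Type*) where
  order : ℕ
  tree : SimpleGraph (Fin order)
  isTree : tree.IsTree
  subcubic : ∀ t, (tree.neighborSet t).ncard = 1 ∨ (tree.neighborSet t).ncard = 3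
  leafEquiv : {t // (tree.neighborSet t).ncard = 1} ≃ X

namespace BranchDecomposition

variable {X : Type*}

/-- The elements of `X` whose leaves lie on the side of `a` once the tree edge `ab` is removed;
the edge `ab` induces the partition `(side a b, side b a)`. -/
def side (D : BranchDecomposition X) (a b : Fin D.order) : Set X :=
  {x | (D.tree.deleteEdges {s(a, b)}).Reachable a (D.leafEquiv.symm x : Fin D.order)}

/-- The `f`-width of a branch-decomposition: the maximum `f`-value of an edge of the tree. -/
noncomputable def width (D : BranchDecomposition X) (f : Set X → ℕ) : ℕ :=
  sSup {m | ∃ a b, D.tree.Adj a b ∧ f (D.side a b) = m}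

end BranchDecomposition

/-- The maximum matching width of a graph: the minimum `mm`-width of a branch-decomposition of the
vertex set. A graph with at most one vertex has no branch-decomposition, and its width is `0`
(the infimum of the empty set of natural numbers). -/
noncomputable def mmw {V : Type*} (G : SimpleGraph V) : ℕ :=
  sInf {w | ∃ D : BranchDecomposition V, D.width (mm G) = w}

/-- `G` has a minor isomorphic to `H`: there are pairwise disjoint connected (in particular
nonempty) branch sets in `G`, one for each vertex of `H`, with an edge of `G` between the branch
sets of any two adjacent vertices of `H`. -/
def IsMinor {W V : Type*} (H : SimpleGraph W) (G : SimpleGraph V) : Prop :=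
  ∃ B : W → Set V,
    (∀ w, (G.induce (B w)).Connected) ∧
    (∀ w w', w ≠ w' → Disjoint (B w) (B w')) ∧
    ∀ w w', H.Adj w w' → ∃ x ∈ B w, ∃ y ∈ B w', G.Adj x y

/-- A concrete graph on the vertices `0, …, order - 1`, given by a list of edges. -/
structure EdgeList where
  order : ℕ
  edges : List (ℕ × ℕ)

namespace EdgeList

/-- The simple graph described by an edge list. -/
def graph (g : EdgeList) : SimpleGraph (Fin g.order) :=
  SimpleGraph.fromRel fun i j => ((i : ℕ), (j : ℕ)) ∈ g.edges

/-- Add the edges in `l`. -/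
def addEdges (g : EdgeList) (l : List (ℕ × ℕ)) : EdgeList :=
  ⟨g.order, g.edges ++ l⟩

/-- The edges of `g` other than `e = ab`. -/
def edgesWithout (g : EdgeList) (e : ℕ × ℕ) : List (ℕ × ℕ) :=
  g.edges.filter fun e' => e' ≠ e ∧ e' ≠ e.swap

/-- Replace the edge `e = ab` by a path `a c b` through a new vertex `c`. -/
def subdiv1 (g : EdgeList) (e : ℕ × ℕ) : EdgeList :=
  ⟨g.order + 1, g.edgesWithout e ++ [(e.1, g.order), (g.order, e.2)]⟩

/-- Replace the edge `e = ab` by a path `a c d b` through new vertices `c`, `d`. -/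
def subdiv2 (g : EdgeList) (e : ℕ × ℕ) : EdgeList :=
  ⟨g.order + 2, g.edgesWithout e ++
    [(e.1, g.order), (g.order, g.order + 1), (g.order + 1, e.2)]⟩

/-- Replace the edge `e = ab` by two paths `a c b` and `a d b` through new vertices `c`, `d`. -/
def subdiv11 (g : EdgeList) (e : ℕ × ℕ) : EdgeList :=
  ⟨g.order + 2, g.edgesWithout e ++
    [(e.1, g.order), (g.order, e.2), (e.1, g.order + 1), (g.order + 1, e.2)]⟩

/-- Good-subdivide edges of `g`: those in `l₁` are 1-subdivided, those in `l₂` are 2-subdivided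
and those in `l₁₁` are 11-subdivided. -/
def goodSubdiv (g : EdgeList) (l₁ l₂ l₁₁ : List (ℕ × ℕ)) : EdgeList :=
  l₁₁.foldl subdiv11 (l₂.foldl subdiv2 (l₁.foldl subdiv1 g))

/-- The complete graph on four vertices. -/
def k4 : EdgeList := ⟨4, [(0, 1), (0, 2), (0, 3), (1, 2), (1, 3), (2, 3)]⟩

/-- The wheel on five vertices, with centre `0`. -/
def w5 : EdgeList :=
  ⟨5, [(0, 1), (0, 2), (0, 3), (0, 4), (1, 2), (2, 3), (3, 4), (4, 1)]⟩

/-- The complete bipartite graph with parts `{0, 1, 2}` and `{3, 4, 5}`. -/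
def k33 : EdgeList :=
  ⟨6, [(0, 3), (0, 4), (0, 5), (1, 3), (1, 4), (1, 5), (2, 3), (2, 4), (2, 5)]⟩

/-- The prism: two triangles `012` and `345` joined by the edges `03`, `14`, `25`. -/
def prism : EdgeList :=
  ⟨6, [(0, 1), (0, 2), (1, 2), (3, 4), (3, 5), (4, 5), (0, 3), (1, 4), (2, 5)]⟩

/-- The wheel on six vertices, with centre `0`. -/
def w6 : EdgeList :=
  ⟨6, [(0, 1), (0, 2), (0, 3), (0, 4), (0, 5), (1, 2), (2, 3), (3, 4), (4, 5), (5, 1)]⟩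

/-- The five edge-minimal 3-connected graphs on seven vertices; the last two are the wheel with
centre `0` and the complete bipartite graph with parts `{0, 1, 2}` and `{3, 4, 5, 6}`. -/
def obs3 : List EdgeList :=
  [⟨7, [(0, 2), (0, 3), (0, 5), (0, 6), (1, 4), (1, 5), (1, 6), (2, 4), (2, 6), (3, 4), (3, 5)]⟩,
   ⟨7, [(0, 3), (0, 4), (0, 5), (0, 6), (1, 4), (1, 5), (1, 6), (2, 3), (2, 5), (2, 6), (3, 4)]⟩,
   ⟨7, [(0, 3), (0, 4), (0, 5), (0, 6), (1, 2), (1, 5), (1, 6), (2, 4), (2, 6), (3, 4), (3, 5)]⟩,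
   ⟨7, [(0, 1), (0, 2), (0, 3), (0, 4), (0, 5), (0, 6),
        (1, 2), (2, 3), (3, 4), (4, 5), (5, 6), (6, 1)]⟩,
   ⟨7, [(0, 3), (0, 4), (0, 5), (0, 6), (1, 3), (1, 4), (1, 5), (1, 6),
        (2, 3), (2, 4), (2, 5), (2, 6)]⟩]

/-- The ten graphs obtained from `K₄`. -/
def obs4 : List EdgeList :=
  -- no 2-subdivision
  [k4.goodSubdiv [(0, 1), (0, 2), (0, 3), (1, 2), (1, 3)] [] [],
   -- one 2-subdivision or 11-subdivision
   k4.goodSubdiv [(0, 1), (0, 2), (1, 3)] [(0, 3)] [],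
   k4.goodSubdiv [(0, 1), (0, 2), (1, 3)] [] [(0, 3)],
   -- two of them
   k4.goodSubdiv [(0, 1), (0, 2)] [(1, 3), (2, 3)] [],
   k4.goodSubdiv [(0, 1), (0, 2)] [(1, 3)] [(2, 3)],
   k4.goodSubdiv [(0, 1), (0, 2)] [] [(1, 3), (2, 3)],
   -- three of them
   k4.goodSubdiv [] [(0, 1), (0, 2), (1, 2)] [],
   k4.goodSubdiv [] [(0, 1), (0, 2)] [(1, 2)],
   k4.goodSubdiv [] [(0, 1)] [(0, 2), (1, 2)],
   k4.goodSubdiv [] [] [(0, 1), (0, 2), (1, 2)]]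

/-- The eighteen graphs obtained from 3-connected graphs on five vertices. -/
def obs5 : List EdgeList :=
  -- the wheel, three 1-subdivisions at a claw or a triangle
  [w5.goodSubdiv [(0, 1), (1, 2), (4, 1)] [] [],
   w5.goodSubdiv [(0, 1), (0, 2), (0, 3)] [] [],
   w5.goodSubdiv [(0, 1), (0, 2), (1, 2)] [] [],
   -- the wheel, four 1-subdivisions, not containing a claw or a triangle;
   -- the first of them is the 3 × 3-grid
   w5.goodSubdiv [(1, 2), (2, 3), (3, 4), (4, 1)] [] [],
   w5.goodSubdiv [(0, 1), (1, 2), (2, 3), (3, 4)] [] [],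
   w5.goodSubdiv [(0, 1), (0, 2), (2, 3), (3, 4)] [] [],
   w5.goodSubdiv [(0, 1), (0, 2), (2, 3), (4, 1)] [] [],
   w5.goodSubdiv [(0, 1), (0, 3), (1, 2), (2, 3)] [] [],
   w5.goodSubdiv [(0, 1), (0, 3), (1, 2), (3, 4)] [] [],
   -- the wheel, a 2-subdivision or 11-subdivision of a rim edge and two 1-subdivisions
   w5.goodSubdiv [(0, 1), (2, 3)] [(1, 2)] [],
   w5.goodSubdiv [(0, 1), (2, 3)] [] [(1, 2)],
   w5.goodSubdiv [(4, 1), (2, 3)] [(1, 2)] [],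
   w5.goodSubdiv [(4, 1), (2, 3)] [] [(1, 2)],
   -- the wheel, a 2-subdivision or 11-subdivision of a spoke and two 1-subdivisions
   w5.goodSubdiv [(0, 2), (4, 1)] [(0, 1)] [],
   w5.goodSubdiv [(0, 2), (4, 1)] [] [(0, 1)],
   w5.goodSubdiv [(0, 3), (1, 2)] [(0, 1)] [],
   w5.goodSubdiv [(0, 3), (1, 2)] [] [(0, 1)],
   -- the wheel plus an edge, with the triangle of vertices of degree four 1-subdivided
   (w5.addEdges [(1, 3)]).goodSubdiv [(0, 1), (0, 3), (1, 3)] [] []]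

/-- The twelve graphs obtained from 3-connected graphs on six vertices by 1-subdividing two
adjacent edges. -/
def obs6 : List EdgeList :=
  -- `K₃,₃` and `K₃,₃` plus one or two edges
  [k33.goodSubdiv [(0, 3), (0, 4)] [] [],
   (k33.addEdges [(0, 1)]).goodSubdiv [(0, 1), (0, 3)] [] [],
   (k33.addEdges [(0, 1), (1, 2)]).goodSubdiv [(0, 1), (1, 2)] [] [],
   -- the prism
   prism.goodSubdiv [(0, 1), (0, 2)] [] [],
   prism.goodSubdiv [(0, 1), (0, 3)] [] [],
   -- the prism plus an edge
   (prism.addEdges [(0, 4)]).goodSubdiv [(0, 4), (0, 1)] [] [],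
   (prism.addEdges [(0, 4)]).goodSubdiv [(0, 4), (0, 2)] [] [],
   (prism.addEdges [(0, 4)]).goodSubdiv [(0, 4), (0, 3)] [] [],
   -- the wheel
   w6.goodSubdiv [(0, 1), (0, 2)] [] [],
   w6.goodSubdiv [(0, 1), (0, 3)] [] [],
   w6.goodSubdiv [(0, 1), (1, 2)] [] [],
   w6.goodSubdiv [(1, 2), (2, 3)] [] []]

/-- The list of all the graphs. -/
def obstructions : List EdgeList := obs3 ++ obs4 ++ obs5 ++ obs6

end EdgeList

/-! Both directions replace matchings by certificates: three disjoint crossing edges give `3 ≤ mm`,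
and two vertices that meet all crossing edges give `mm ≤ 2`. The hard half of König's theorem is not
needed.

Obstructions have width above two. Weight the vertices of an obstruction so that each weighs less
than a third of the total. Every branch-decomposition has an edge both of whose sides weigh at least
a third (`BranchDecomposition.exists_balanced`), and a finite check shows that every such partition
is crossed by three disjoint edges. This passes to every graph with the obstruction as a minor: put
each weight on a representative of the branch set; disjoint crossing edges of the minor yield
disjoint crossing edges of the graph (`EdgeList.two_lt_mmw_of_lowerTest`).

Conversely, let `G` have no obstruction as a minor. Cut vertices are harmless, so `G` may be taken
2-connected. Replacing parts attached at two vertices by edges leads to a 3-connected torso. Since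
3-connected graphs have contractible edges (`KConnected.exists_contractible`), a 3-connected graph
is obtained from `K₄` by splitting vertices. Hence a torso on at least seven vertices has a member
of `obs3` as a minor, and one on four, five or six vertices is spanned by `K₄`, by `W₅`, or by
`K₃,₃`, the prism or `W₆`. A part attached at a pair realizes a 1-subdivided edge, and a part with
at least two vertices even a 2- or 11-subdivided one. A finite search over the possible sets of
attached pairs finds either a listed subdivision or three pairs that account for all vertices of the
torso and all parts, where the vertex of a one-vertex part may itself serve as a member of a pair
(`IsTorso.isTripartite`).

In the latter case `G` consists of three pieces `K i ∪ {a i, b i}`, where `K i` has no neighbours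
outside `{a i, b i}`. The pieces meet at a cubic node of a decomposition whose cuts are covered by
these pairs (`feasible_compl`). The recursion into the parts is an induction on one side of a
separation of order two; its torso comes from the maximal smaller separated sets
(`KConnected.feasible_of_ncard_nb_le`). -/

open Set

/-! ### Connected sets and matchings across a cut -/

section Basic

variable {V : Type*} {G : SimpleGraph V}

/-- A vertex set is connected if it is nonempty and no nonempty proper part of it is closed
under taking neighbours. -/
def ConnSet (G : SimpleGraph V) (S : Set V) : Prop :=
  S.Nonempty ∧ ∀ T ⊆ S, T.Nonempty → (∀ u ∈ T, ∀ v ∈ S, G.Adj u v → v ∈ T) → T = S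

theorem ConnSet.induce_connected {S : Set V} (h : ConnSet G S) : (G.induce S).Connected := by
  obtain ⟨⟨s, hs⟩, h⟩ := h
  rw [SimpleGraph.connected_iff_exists_forall_reachable]
  refine ⟨⟨s, hs⟩, ?_⟩
  have := h {v | ∃ hv : v ∈ S, (G.induce S).Reachable ⟨s, hs⟩ ⟨v, hv⟩} (fun v hv => hv.1)
    ⟨s, hs, SimpleGraph.Reachable.rfl⟩ ?_
  · rintro ⟨v, hv⟩
    have hv' := hv
    rw [← this] at hv'
    exact hv'.2
  · rintro u ⟨hu, hr⟩ v hv huv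
    exact ⟨hv, hr.trans (SimpleGraph.Adj.reachable (by simpa using huv))⟩

theorem connSet_of_induce_connected {S : Set V} (h : (G.induce S).Connected) : ConnSet G S := by
  obtain ⟨⟨s, hs⟩⟩ := h.nonempty
  refine ⟨⟨s, hs⟩, fun T hT ⟨t, ht⟩ hc => hT.antisymm fun v hv => ?_⟩
  have key : ∀ x y : S, (G.induce S).Walk x y → (x : V) ∈ T → (y : V) ∈ T := by
    intro x y w
    induction w with
    | nil => exact id
    | cons hadj _ ih => exact fun hx => ih (hc _ hx _ (Subtype.coe_prop _) (by simpa using hadj))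
  obtain ⟨w⟩ := h.preconnected ⟨t, hT ht⟩ ⟨v, hv⟩
  exact key _ _ w ht

theorem connSet_singleton (v : V) : ConnSet G {v} :=
  ⟨⟨v, rfl⟩, fun _ hT hne _ => (subset_singleton_iff_eq.1 hT).resolve_left hne.ne_empty⟩

theorem ConnSet.union_of_adj {S T : Set V} (hS : ConnSet G S) (hT : ConnSet G T)
    {s t : V} (hs : s ∈ S) (ht : t ∈ T) (hst : G.Adj s t) : ConnSet G (S ∪ T) := by
  refine ⟨hS.1.inl, fun U hU ⟨u, hu⟩ hc => hU.antisymm ?_⟩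
  have hSU : (U ∩ S).Nonempty → S ⊆ U := fun hne => by
    rw [← hS.2 (U ∩ S) inter_subset_right hne
      fun a ha b hb hab => ⟨hc a ha.1 b (Or.inl hb) hab, hb⟩]
    exact inter_subset_left
  have hTU : (U ∩ T).Nonempty → T ⊆ U := fun hne => by
    rw [← hT.2 (U ∩ T) inter_subset_right hne
      fun a ha b hb hab => ⟨hc a ha.1 b (Or.inr hb) hab, hb⟩]
    exact inter_subset_left
  rcases hU hu with h | h
  · have h1 := hSU ⟨u, hu, h⟩
    exact union_subset h1 (hTU ⟨t, hc s (h1 hs) t (Or.inr ht) hst, ht⟩)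
  · have h1 := hTU ⟨u, hu, h⟩
    exact union_subset (hSU ⟨s, hc t (h1 ht) s (Or.inl hs) hst.symm, hs⟩) h1

/-- Three disjoint edges between `A` and its complement. -/
def Matching3 (G : SimpleGraph V) (A : Set V) : Prop :=
  ∃ x y : Fin 3 → V, Function.Injective x ∧ Function.Injective y ∧
    ∀ i, x i ∈ A ∧ y i ∉ A ∧ G.Adj (x i) (y i)

theorem mm_set_bddAbove [Finite V] (G : SimpleGraph V) (A : Set V) :
    BddAbove {m | ∃ M : (G.between A Aᶜ).Subgraph, M.IsMatching ∧ M.edgeSet.ncard = m} := by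
  refine ⟨(univ : Set (Sym2 V)).ncard, ?_⟩
  rintro m ⟨M, -, rfl⟩
  exact ncard_le_ncard (subset_univ _)

/-- Together with `Cov2.mm_le` this is weak duality between matchings and covers, the only link
between the combinatorial certificates and `mm`. -/
theorem Matching3.three_le_mm [Finite V] {A : Set V} (h : Matching3 G A) : 3 ≤ mm G A := by
  obtain ⟨x, y, hx, hy, hxy⟩ := h
  have hne : ∀ i j, x i ≠ y j := fun i j h => (hxy j).2.1 (h ▸ (hxy i).1)
  let M : (G.between A Aᶜ).Subgraph :=
    { verts := range x ∪ range y
      Adj := fun u v => ∃ i, (u = x i ∧ v = y i) ∨ (u = y i ∧ v = x i)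
      adj_sub := by
        rintro u v ⟨i, ⟨rfl, rfl⟩ | ⟨rfl, rfl⟩⟩
        · exact ⟨(hxy i).2.2, Or.inl ⟨(hxy i).1, (hxy i).2.1⟩⟩
        · exact ⟨(hxy i).2.2.symm, Or.inr ⟨(hxy i).2.1, (hxy i).1⟩⟩
      edge_vert := by
        rintro u v ⟨i, ⟨rfl, rfl⟩ | ⟨rfl, rfl⟩⟩
        · exact Or.inl ⟨i, rfl⟩
        · exact Or.inr ⟨i, rfl⟩
      symm := ⟨fun u v ⟨i, h⟩ => ⟨i, by tauto⟩⟩ }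
  have hM : M.IsMatching := by
    rintro v (⟨i, rfl⟩ | ⟨i, rfl⟩)
    · refine ⟨y i, ⟨i, Or.inl ⟨rfl, rfl⟩⟩, ?_⟩
      rintro w ⟨j, ⟨h, rfl⟩ | ⟨h, -⟩⟩
      · rw [hx h]
      · exact (hne _ _ h).elim
    · refine ⟨x i, ⟨i, Or.inr ⟨rfl, rfl⟩⟩, ?_⟩
      rintro w ⟨j, ⟨h, -⟩ | ⟨h, rfl⟩⟩
      · exact (hne _ _ h.symm).elim
      · rw [hy h]
  refine le_trans ?_ (le_csSup (mm_set_bddAbove G A) ⟨M, hM, rfl⟩)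
  have hinj : Function.Injective fun i => s(x i, y i) := fun i j h => by
    rcases Sym2.eq_iff.1 h with h | h
    · exact hx h.1
    · exact (hne _ _ h.1).elim
  have hsub : range (fun i => s(x i, y i)) ⊆ M.edgeSet := by
    rintro _ ⟨i, rfl⟩
    exact ⟨i, Or.inl ⟨rfl, rfl⟩⟩
  calc 3 = (range fun i => s(x i, y i)).ncard := by
        rw [← image_univ, ncard_image_of_injective _ hinj, ncard_univ]; simp
    _ ≤ _ := ncard_le_ncard hsub

/-- All edges between `A` and its complement meet a set of two vertices. -/
def Cov2 (G : SimpleGraph V) (A : Set V) : Prop :=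
  ∃ a b, ∀ x ∈ A, ∀ y ∉ A, G.Adj x y → x = a ∨ x = b ∨ y = a ∨ y = b

theorem Cov2.compl {A : Set V} (h : Cov2 G A) : Cov2 G Aᶜ := by
  obtain ⟨a, b, h⟩ := h
  exact ⟨a, b, fun x hx y hy hxy => by have := h y (not_not.1 hy) x hx hxy.symm; tauto⟩

/-- A vertex lies on at most one edge of a matching, so each of the two covering vertices accounts
for at most one edge. -/
theorem Cov2.mm_le {A : Set V} (h : Cov2 G A) : mm G A ≤ 2 := by
  obtain ⟨a, b, h⟩ := h
  refine csSup_le' ?_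
  rintro m ⟨M, hM, rfl⟩
  have hsub : ∀ c, ({e ∈ M.edgeSet | c ∈ e}).Subsingleton := by
    rintro c e ⟨he, hce⟩ f ⟨hf, hcf⟩
    obtain ⟨u, rfl⟩ := Sym2.mem_iff_exists.1 hce
    obtain ⟨v, rfl⟩ := Sym2.mem_iff_exists.1 hcf
    exact congrArg (fun z => s(c, z)) (hM.eq_of_adj_left (u := c) he hf)
  have hcov : M.edgeSet ⊆ {e ∈ M.edgeSet | a ∈ e} ∪ {e ∈ M.edgeSet | b ∈ e} := by
    intro e he
    induction e with | h u v => ?_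
    have hadj := M.adj_sub he
    have : u = a ∨ u = b ∨ v = a ∨ v = b := by
      rcases hadj.2 with ⟨hu, hv⟩ | ⟨hu, hv⟩
      · exact h u hu v hv hadj.1
      · have := h v hv u hu hadj.1.symm; tauto
    simp only [mem_union, mem_ofPred_eq, Sym2.mem_iff]
    have he' : s(u, v) ∈ M.edgeSet := he
    simp only [he', true_and]
    tauto
  calc M.edgeSet.ncard ≤ _ := ncard_le_ncard hcov ((hsub a).finite.union (hsub b).finite)
    _ ≤ _ := ncard_union_le _ _
    _ ≤ 1 + 1 := by
        have : ∀ c, ({e ∈ M.edgeSet | c ∈ e}).ncard ≤ 1 := fun c =>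
          (ncard_le_one (hsub c).finite).2 fun x hx y hy => hsub c hx hy
        exact add_le_add (this a) (this b)

end Basic

/-! ### Branch-decompositions from parent functions -/

section ParentTree

variable {N : Type*}

/-- The graph on `Option N` in which every `x : N` is joined to its parent. -/
def parentGraph (par : N → Option N) (dp : N → ℕ)
    (hdp : ∀ x y, par x = some y → dp y < dp x) : SimpleGraph (Option N) where
  Adj a b := (∃ x, a = some x ∧ b = par x) ∨ (∃ x, b = some x ∧ a = par x)
  symm := ⟨fun _ _ h => h.symm⟩
  loopless := ⟨by
    rintro a (⟨x, h, h'⟩ | ⟨x, h, h'⟩) <;>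
    exact lt_irrefl _ (hdp x x (h'.symm.trans h))⟩

/-- `y` is a descendant of `x`. -/
abbrev Desc (par : N → Option N) : N → N → Prop :=
  Relation.ReflTransGen fun y y' => par y = some y'

variable {par : N → Option N} {dp : N → ℕ} {hdp : ∀ x y, par x = some y → dp y < dp x}

theorem Desc.dp_le (hdp : ∀ x y, par x = some y → dp y < dp x) {x y : N} (h : Desc par y x) :
    dp x ≤ dp y := by
  induction h with
  | refl => exact le_rfl
  | tail _ h ih => exact (hdp _ _ h).le.trans ih

theorem parentGraph_edge_inj {x y : N} (h : s(some x, par x) = s(some y, par y))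
    (hdp : ∀ x y, par x = some y → dp y < dp x) : x = y := by
  rcases Sym2.eq_iff.1 h with h | h
  · exact Option.some_injective _ h.1
  · exact absurd (hdp _ _ h.2) (hdp _ _ h.1.symm).not_gt

/-- A walk can leave the set of descendants of `x` only along the edge from `x` to its parent, which
is deleted. Hence sides of tree edges are clusters. -/
theorem parentGraph_reachable_iff (x : N) (t : Option N) :
    ((parentGraph par dp hdp).deleteEdges {s(some x, par x)}).Reachable (some x) t ↔
      ∃ y, Desc par y x ∧ t = some y := by
  constructor
  · rintro ⟨w⟩
    suffices h : ∀ a b, ((parentGraph par dp hdp).deleteEdges {s(some x, par x)}).Walk a b →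
        (∃ y, Desc par y x ∧ a = some y) → ∃ y, Desc par y x ∧ b = some y from
      h _ _ w ⟨x, .refl, rfl⟩
    intro a b w
    induction w with
    | nil => exact id
    | cons hadj _ ih =>
      rename_i u v _
      rintro ⟨y, hy, rfl⟩
      apply ih
      rw [SimpleGraph.deleteEdges_adj] at hadj
      obtain ⟨⟨z, hz, hz'⟩ | ⟨z, hz, hz'⟩, hne⟩ := hadj
      · obtain rfl := Option.some_injective _ hz
        rcases Relation.ReflTransGen.cases_head hy with rfl | ⟨y', h1, h2⟩
        · exact (hne (by rw [hz']; rfl)).elim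
        · exact ⟨y', h2, hz'.trans h1⟩
      · exact ⟨z, Relation.ReflTransGen.head hz'.symm hy, hz⟩
  · rintro ⟨y, hy, rfl⟩
    induction hy using Relation.ReflTransGen.head_induction_on with
    | refl => exact .rfl
    | head h hx ih =>
      rename_i a c
      refine ih.trans (SimpleGraph.Adj.reachable ?_)
      rw [SimpleGraph.deleteEdges_adj]
      refine ⟨Or.inr ⟨a, rfl, h.symm⟩, fun he => ?_⟩
      rw [mem_singleton_iff, Sym2.eq_swap, ← h] at he
      obtain rfl := parentGraph_edge_inj he hdp
      exact absurd (hdp _ _ h) (not_lt.2 (Desc.dp_le hdp hx))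

/-- Climbing to parents lowers the depth, so everything reaches `none`. Every edge is a bridge
because a parent, having smaller depth, is not a descendant of its child. -/
theorem parentGraph_isTree : (parentGraph par dp hdp).IsTree := by
  refine ⟨SimpleGraph.connected_iff_exists_forall_reachable _ |>.2 ⟨none, ?_⟩, ?_⟩
  · have : ∀ n x, dp x = n → (parentGraph par dp hdp).Reachable none (some x) := by
      intro n
      induction n using Nat.strong_induction_on with
      | _ n ih =>
        rintro x rfl
        have hadj : (parentGraph par dp hdp).Adj (par x) (some x) := Or.inr ⟨x, rfl, rfl⟩
        cases hp : par x with
        | none => rw [hp] at hadj; exact hadj.reachable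
        | some y => rw [hp] at hadj; exact (ih _ (hdp _ _ hp) y rfl).trans hadj.reachable
    rintro (_ | x)
    · exact .rfl
    · exact this _ x rfl
  · rw [SimpleGraph.isAcyclic_iff_forall_adj_isBridge]
    have key : ∀ x, (parentGraph par dp hdp).IsBridge s(some x, par x) := by
      intro x
      rw [SimpleGraph.isBridge_iff, parentGraph_reachable_iff]
      rintro ⟨y, hy, he⟩
      exact absurd (hdp _ _ he) (not_lt.2 (Desc.dp_le hdp hy))
    rintro v w (⟨x, rfl, rfl⟩ | ⟨x, rfl, rfl⟩)
    · exact key x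
    · rw [Sym2.eq_swap]; exact key x

end ParentTree

/-- A rooted binary tree with leaves labelled by the elements of `A`, all of whose clusters
satisfy `P`. -/
structure ClusterTree {X : Type*} (P : Set X → Prop) (A : Set X) where
  N : Type
  fin : Finite N
  par : N → Option N
  dp : N → ℕ
  top : N
  -- Only the values on `A` matter; `lab` is total for convenience.
  lab : X → N
  dp_lt : ∀ x y, par x = some y → dp y < dp x
  par_eq_none : ∀ x, par x = none ↔ x = top
  children : ∀ x, ((∃ v ∈ A, lab v = x) ∧ ∀ y, par y ≠ some x) ∨
    ((∀ v ∈ A, lab v ≠ x) ∧ ∃ y z, y ≠ z ∧ ∀ w, par w = some x ↔ w = y ∨ w = z)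
  lab_inj : InjOn lab A
  cluster : ∀ x, P {v ∈ A | Desc par (lab v) x}

namespace ClusterTree

variable {X : Type*} {P : Set X → Prop} {A B : Set X}

theorem desc_top (T : ClusterTree P A) (x : T.N) : Desc T.par x T.top := by
  have : ∀ n x, T.dp x = n → Desc T.par x T.top := by
    intro n
    induction n using Nat.strong_induction_on with
    | _ n ih =>
      rintro x rfl
      cases hp : T.par x with
      | none => rw [(T.par_eq_none x).1 hp]
      | some y => exact .head hp (ih _ (T.dp_lt _ _ hp) y rfl)
  exact this _ x rfl

/-- The tree with a single leaf. -/
def leaf (v : X) (h : P {v}) : ClusterTree P {v} where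
  N := Unit
  fin := inferInstance
  par _ := none
  dp _ := 0
  top := ()
  lab _ := ()
  dp_lt := by simp
  par_eq_none := by simp
  children x := Or.inl ⟨⟨v, rfl, rfl⟩, by simp⟩
  lab_inj := injOn_singleton _ _
  cluster x := by
    convert h using 1
    ext w
    simp only [mem_ofPred_eq, and_iff_left_iff_imp]
    exact fun _ => .refl

/-- The parent function of the join of two rooted trees. -/
def joinPar {N M : Type} (p : N → Option N) (q : M → Option M) :
    Option (N ⊕ M) → Option (Option (N ⊕ M))
  | none => none
  | some (.inl x) => some ((p x).map .inl)
  | some (.inr x) => some ((q x).map .inr)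

theorem joinPar_eq_inl {N M : Type} {p : N → Option N} {q : M → Option M} {w : Option (N ⊕ M)}
    {x : N} : joinPar p q w = some (some (.inl x)) ↔ ∃ y, w = some (.inl y) ∧ p y = some x := by
  rcases w with _ | w | w <;> simp [joinPar]

theorem joinPar_eq_inr {N M : Type} {p : N → Option N} {q : M → Option M} {w : Option (N ⊕ M)}
    {x : M} : joinPar p q w = some (some (.inr x)) ↔ ∃ y, w = some (.inr y) ∧ q y = some x := by
  rcases w with _ | w | w <;> simp [joinPar]

theorem desc_joinPar_inl {N M : Type} {p : N → Option N} {q : M → Option M} {w : Option (N ⊕ M)}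
    {x : N} : Desc (joinPar p q) w (some (.inl x)) ↔ ∃ y, w = some (.inl y) ∧ Desc p y x := by
  constructor
  · intro h
    induction h using Relation.ReflTransGen.head_induction_on with
    | refl => exact ⟨x, rfl, .refl⟩
    | head h _ ih =>
      obtain ⟨y, rfl, hy⟩ := ih
      obtain ⟨z, rfl, hz⟩ := joinPar_eq_inl.1 h
      exact ⟨z, rfl, .head hz hy⟩
  · rintro ⟨y, rfl, h⟩
    induction h using Relation.ReflTransGen.head_induction_on with
    | refl => exact .refl
    | head h _ ih => exact .head (joinPar_eq_inl.2 ⟨_, rfl, h⟩) ih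

theorem desc_joinPar_inr {N M : Type} {p : N → Option N} {q : M → Option M} {w : Option (N ⊕ M)}
    {x : M} : Desc (joinPar p q) w (some (.inr x)) ↔ ∃ y, w = some (.inr y) ∧ Desc q y x := by
  constructor
  · intro h
    induction h using Relation.ReflTransGen.head_induction_on with
    | refl => exact ⟨x, rfl, .refl⟩
    | head h _ ih =>
      obtain ⟨y, rfl, hy⟩ := ih
      obtain ⟨z, rfl, hz⟩ := joinPar_eq_inr.1 h
      exact ⟨z, rfl, .head hz hy⟩
  · rintro ⟨y, rfl, h⟩
    induction h using Relation.ReflTransGen.head_induction_on with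
    | refl => exact .refl
    | head h _ ih => exact .head (joinPar_eq_inr.2 ⟨_, rfl, h⟩) ih

/-- The depth function of the join of two rooted trees. -/
def joinDp {N M : Type} (d : N → ℕ) (e : M → ℕ) : Option (N ⊕ M) → ℕ
  | none => 0
  | some (.inl x) => d x + 1
  | some (.inr x) => e x + 1

theorem joinDp_lt {N M : Type} {p : N → Option N} {q : M → Option M} {d : N → ℕ} {e : M → ℕ}
    (hd : ∀ x y, p x = some y → d y < d x) (he : ∀ x y, q x = some y → e y < e x)
    (x y : Option (N ⊕ M)) (h : joinPar p q x = some y) : joinDp d e y < joinDp d e x := by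
  rcases y with _ | y | y
  · rcases x with _ | x | x <;> simp_all [joinDp, joinPar]
  · obtain ⟨z, rfl, hz⟩ := joinPar_eq_inl.1 h
    simpa [joinDp] using hd _ _ hz
  · obtain ⟨z, rfl, hz⟩ := joinPar_eq_inr.1 h
    simpa [joinDp] using he _ _ hz

open Classical in
/-- Join two rooted trees below a new root. -/
noncomputable def join (S : ClusterTree P A) (T : ClusterTree P B) (hAB : Disjoint A B)
    (h : P (A ∪ B)) : ClusterTree P (A ∪ B) where
  N := Option (S.N ⊕ T.N)
  fin := by have := S.fin; have := T.fin; infer_instance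
  par := joinPar S.par T.par
  dp := joinDp S.dp T.dp
  top := none
  lab v := if v ∈ A then some (.inl (S.lab v)) else some (.inr (T.lab v))
  dp_lt := joinDp_lt S.dp_lt T.dp_lt
  par_eq_none := by rintro (_ | x | x) <;> simp [joinPar]
  children := by
    have hB : ∀ v ∈ B, v ∉ A := fun v hv hA => hAB.le_bot ⟨hA, hv⟩
    rintro (_ | x | x)
    · refine Or.inr ⟨fun v _ => by split_ifs <;> simp, some (.inl S.top), some (.inr T.top),
        by simp, ?_⟩
      rintro (_ | x | x)
      · simp [joinPar]
      · simp [joinPar, S.par_eq_none]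
      · simp [joinPar, T.par_eq_none]
    · rcases S.children x with ⟨⟨v, hv, rfl⟩, h2⟩ | ⟨h1, y, z, hyz, h2⟩
      · refine Or.inl ⟨⟨v, Or.inl hv, by simp [hv]⟩, fun y hy => ?_⟩
        obtain ⟨w, -, hw⟩ := joinPar_eq_inl.1 hy
        exact h2 w hw
      · refine Or.inr ⟨fun v _ hx => ?_, some (.inl y), some (.inl z), by simpa using hyz, ?_⟩
        · split_ifs at hx with hA
          · exact h1 v hA (by simpa using hx)
          · simp at hx
        · intro w
          rw [joinPar_eq_inl]
          constructor
          · rintro ⟨u, rfl, hu⟩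
            simpa using (h2 u).1 hu
          · rintro (rfl | rfl)
            · exact ⟨_, rfl, (h2 _).2 (Or.inl rfl)⟩
            · exact ⟨_, rfl, (h2 _).2 (Or.inr rfl)⟩
    · rcases T.children x with ⟨⟨v, hv, rfl⟩, h2⟩ | ⟨h1, y, z, hyz, h2⟩
      · refine Or.inl ⟨⟨v, Or.inr hv, by simp [hB v hv]⟩, fun y hy => ?_⟩
        obtain ⟨w, -, hw⟩ := joinPar_eq_inr.1 hy
        exact h2 w hw
      · refine Or.inr ⟨fun v hv hx => ?_, some (.inr y), some (.inr z), by simpa using hyz, ?_⟩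
        · split_ifs at hx with hA
          · simp at hx
          · exact h1 v (hv.resolve_left hA) (by simpa using hx)
        · intro w
          rw [joinPar_eq_inr]
          constructor
          · rintro ⟨u, rfl, hu⟩
            simpa using (h2 u).1 hu
          · rintro (rfl | rfl)
            · exact ⟨_, rfl, (h2 _).2 (Or.inl rfl)⟩
            · exact ⟨_, rfl, (h2 _).2 (Or.inr rfl)⟩
  lab_inj := by
    intro u hu v hv huv
    by_cases h1 : u ∈ A <;> by_cases h2 : v ∈ A <;> simp only [h1, h2, if_true, if_false] at huv
    · exact S.lab_inj h1 h2 (by simpa using huv)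
    · simp at huv
    · simp at huv
    · exact T.lab_inj (hu.resolve_left h1) (hv.resolve_left h2) (by simpa using huv)
  cluster := by
    have hB : ∀ v ∈ B, v ∉ A := fun v hv hA => hAB.le_bot ⟨hA, hv⟩
    rintro (_ | x | x)
    · convert h using 1
      ext v
      simp only [mem_ofPred_eq, and_iff_left_iff_imp]
      intro _
      split_ifs
      · exact Relation.ReflTransGen.tail (b := some (.inl S.top))
          (desc_joinPar_inl.2 ⟨_, rfl, S.desc_top _⟩) (by
            simp [joinPar, (S.par_eq_none S.top).2 rfl])
      · exact Relation.ReflTransGen.tail (b := some (.inr T.top))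
          (desc_joinPar_inr.2 ⟨_, rfl, T.desc_top _⟩) (by
            simp [joinPar, (T.par_eq_none T.top).2 rfl])
    · convert S.cluster x using 1
      ext v
      simp only [mem_ofPred_eq, desc_joinPar_inl]
      by_cases hA : v ∈ A <;> simp [hA]
    · convert T.cluster x using 1
      ext v
      simp only [mem_ofPred_eq, desc_joinPar_inr]
      by_cases hA : v ∈ A
      · simp only [hA, if_true]
        simpa using fun h => (hB v h hA).elim
      · simp [hA]

end ClusterTree

/-! ### Branch-decompositions from rooted cluster trees. -/

section FromTree

variable {X : Type*}

theorem reachable_deleteEdges_or {N : Type*} {T : SimpleGraph N} (hT : T.Preconnected)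
    (a b t : N) : (T.deleteEdges {s(a, b)}).Reachable a t ∨
      (T.deleteEdges {s(a, b)}).Reachable b t := by
  have h := (SimpleGraph.reachable_iff_reflTransGen a t).1 (hT a t)
  induction h with
  | refl => exact Or.inl .rfl
  | @tail u v _ huv ih =>
    by_cases he : s(u, v) = s(a, b)
    · rcases Sym2.eq_iff.1 he with ⟨-, rfl⟩ | ⟨-, rfl⟩
      · exact Or.inr .rfl
      · exact Or.inl .rfl
    · have hadj : (T.deleteEdges {s(a, b)}).Adj u v := by
        rw [SimpleGraph.deleteEdges_adj]; exact ⟨huv, he⟩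
      exact ih.imp (·.trans hadj.reachable) (·.trans hadj.reachable)

/-- A branch-decomposition given by a tree on an arbitrary finite type. -/
theorem exists_branchDecomposition_of_tree {N : Type*} [Finite N] (T : SimpleGraph N)
    (hT : T.IsTree)
    (hdeg : ∀ t, (T.neighborSet t).ncard = 1 ∨ (T.neighborSet t).ncard = 3)
    (lf : X → N) (hinj : Function.Injective lf)
    (hlf : ∀ t, (T.neighborSet t).ncard = 1 ↔ t ∈ range lf) (P : Set X → Prop)
    (hP : ∀ a b, T.Adj a b → P {x | (T.deleteEdges {s(a, b)}).Reachable a (lf x)}) :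
    ∃ D : BranchDecomposition X, ∀ a b, D.tree.Adj a b → P (D.side a b) := by
  obtain ⟨n, ⟨e⟩⟩ := Finite.exists_equiv_fin N
  let T' : SimpleGraph (Fin n) := T.comap e.symm
  let φ : T' ≃g T := SimpleGraph.Iso.comap e.symm T
  have hnb : ∀ t, (T'.neighborSet t).ncard = (T.neighborSet (e.symm t)).ncard := by
    intro t
    have : T'.neighborSet t = e.symm ⁻¹' T.neighborSet (e.symm t) := rfl
    rw [this, ncard_preimage_of_injective_subset_range e.symm.injective]
    rw [e.symm.surjective.range_eq]
    exact subset_univ _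
  have hmem : ∀ x, (T'.neighborSet (e (lf x))).ncard = 1 := fun x => by
    rw [hnb, e.symm_apply_apply]; exact (hlf _).2 ⟨x, rfl⟩
  let E : X ≃ {t // (T'.neighborSet t).ncard = 1} := Equiv.ofBijective
    (fun x => ⟨e (lf x), hmem x⟩) ⟨fun x y h => hinj (e.injective (congrArg Subtype.val h)), by
      rintro ⟨t, ht⟩
      rw [hnb, hlf] at ht
      obtain ⟨x, hx⟩ := ht
      exact ⟨x, Subtype.ext (by simp [hx])⟩⟩
  refine ⟨⟨n, T', φ.isTree_iff.2 hT, fun t => by rw [hnb]; exact hdeg _, E.symm⟩, ?_⟩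
  intro a b hab
  convert hP (e.symm a) (e.symm b) hab using 1
  ext x
  change (T'.deleteEdges {s(a, b)}).Reachable a (e (lf x)) ↔ _
  let ψ : T'.deleteEdges {s(a, b)} ≃g T.deleteEdges {s(e.symm a, e.symm b)} :=
    { toEquiv := e.symm
      map_rel_iff' := by
        intro u v
        simp only [SimpleGraph.deleteEdges_adj, mem_singleton_iff]
        refine and_congr Iff.rfl (not_congr ?_)
        simp }
  rw [← ψ.reachable_iff]
  change (T.deleteEdges {s(e.symm a, e.symm b)}).Reachable (e.symm a) (e.symm (e (lf x))) ↔ _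
  rw [e.symm_apply_apply]
  rfl

/-- The missing element `v` becomes the extra leaf `none` above the root, which gives an inner root
degree three. Seen from below, a tree edge has a cluster as its side; seen from above it has the
complement, which is where `hPc` enters. -/
theorem ClusterTree.exists_branchDecomposition {P : Set X → Prop} (hPc : ∀ A, P A → P Aᶜ) {v : X}
    (T : ClusterTree P {v}ᶜ) :
    ∃ D : BranchDecomposition X, ∀ a b, D.tree.Adj a b → P (D.side a b) := by
  classical
  have := T.fin
  let Γ := parentGraph T.par T.dp T.dp_lt
  have hnone : Γ.neighborSet none = {some T.top} := by
    ext t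
    constructor
    · rintro (⟨x, h, -⟩ | ⟨x, rfl, h⟩)
      · simp at h
      · rw [(T.par_eq_none x).1 h.symm]; rfl
    · rintro rfl
      exact Or.inr ⟨_, rfl, ((T.par_eq_none _).2 rfl).symm⟩
  have hsome : ∀ x, Γ.neighborSet (some x) = insert (T.par x) (some '' {y | T.par y = some x}) := by
    intro x
    ext t
    constructor
    · rintro (⟨y, h, rfl⟩ | ⟨y, rfl, h⟩)
      · rw [Option.some_injective _ h]; exact Or.inl rfl
      · exact Or.inr ⟨y, h.symm, rfl⟩
    · rintro (rfl | ⟨y, h, rfl⟩)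
      · exact Or.inl ⟨x, rfl, rfl⟩
      · exact Or.inr ⟨y, rfl, h.symm⟩
  have hleaf : ∀ x, (∀ y, T.par y ≠ some x) → (Γ.neighborSet (some x)).ncard = 1 := by
    intro x h
    have : {y | T.par y = some x} = ∅ := by ext y; simpa using h y
    rw [hsome, this]; simp
  have hnode : ∀ x y z, y ≠ z → (∀ w, T.par w = some x ↔ w = y ∨ w = z) →
      (Γ.neighborSet (some x)).ncard = 3 := by
    intro x y z hyz h
    have : {w | T.par w = some x} = {y, z} := by ext w; simp [h]
    rw [hsome, this, image_pair]
    have hy := T.dp_lt _ _ ((h y).2 (Or.inl rfl))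
    have hz := T.dp_lt _ _ ((h z).2 (Or.inr rfl))
    rw [ncard_eq_three]
    refine ⟨_, _, _, ?_, ?_, ?_, rfl⟩
    · intro h'; exact absurd (T.dp_lt _ _ h') hy.not_gt
    · intro h'; exact absurd (T.dp_lt _ _ h') hz.not_gt
    · simpa using hyz
  let lf : X → Option T.N := fun u => if u = v then none else some (T.lab u)
  refine exists_branchDecomposition_of_tree Γ parentGraph_isTree ?_ lf ?_ ?_ P ?_
  · rintro (_ | x)
    · rw [hnone]; simp
    · rcases T.children x with ⟨-, h⟩ | ⟨-, y, z, hyz, h⟩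
      · exact Or.inl (hleaf x h)
      · exact Or.inr (hnode x y z hyz h)
  · intro a b hab
    by_cases ha : a = v <;> by_cases hb : b = v <;> simp only [lf, ha, hb, if_true, if_false] at hab
    · rw [ha, hb]
    · simp at hab
    · simp at hab
    · exact T.lab_inj ha hb (by simpa using hab)
  · rintro (_ | x)
    · rw [hnone]
      simp only [ncard_singleton, true_iff]
      exact ⟨v, by simp [lf]⟩
    · rcases T.children x with ⟨⟨u, hu, rfl⟩, h⟩ | ⟨h', y, z, hyz, h⟩
      · rw [hleaf _ h]
        simp only [true_iff]
        have hu' : u ≠ v := hu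
        exact ⟨u, by simp [lf, hu']⟩
      · rw [hnode x y z hyz h]
        simp only [mem_range, OfNat.ofNat_ne_one, false_iff, not_exists]
        intro u hu
        by_cases huv : u = v
        · simp [lf, huv] at hu
        · exact h' u huv (by simpa [lf, huv] using hu)
  · have hside : ∀ x, {u | (Γ.deleteEdges {s(some x, T.par x)}).Reachable (some x) (lf u)} =
        {u ∈ ({v}ᶜ : Set X) | Desc T.par (T.lab u) x} := by
      intro x
      ext u
      simp only [Γ, mem_ofPred_eq, parentGraph_reachable_iff]
      by_cases huv : u = v
      · simp [lf, huv]
      · simp [lf, huv]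
    rintro a b (⟨x, rfl, rfl⟩ | ⟨x, rfl, rfl⟩)
    · rw [hside]; exact T.cluster x
    · have hb : {u | (Γ.deleteEdges {s(T.par x, some x)}).Reachable (T.par x) (lf u)} =
          {u | (Γ.deleteEdges {s(some x, T.par x)}).Reachable (some x) (lf u)}ᶜ := by
        ext u
        rw [Sym2.eq_swap]
        have hbr : ¬ (Γ.deleteEdges {s(some x, T.par x)}).Reachable (some x) (T.par x) :=
          SimpleGraph.isBridge_iff.1 (SimpleGraph.isAcyclic_iff_forall_adj_isBridge.1
            parentGraph_isTree.isAcyclic (Or.inl ⟨x, rfl, rfl⟩))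
        simp only [mem_ofPred_eq, mem_compl_iff]
        exact ⟨fun h h' => hbr (h'.trans h.symm), fun h =>
          (reachable_deleteEdges_or parentGraph_isTree.connected.preconnected _ _ _).resolve_left h⟩
      rw [hb, hside]
      exact hPc _ (T.cluster x)

end FromTree

/-! ### Feasible clusters and moving the root. -/

section Feas

variable {X : Type*} {P : Set X → Prop}

/-- Sets that occur as a cluster of a rooted binary tree all of whose clusters satisfy `P`. -/
inductive Feas (P : Set X → Prop) : Set X → Prop
  | single (v : X) : P {v} → Feas P {v}
  | join {A B : Set X} : Feas P A → Feas P B → Disjoint A B → P (A ∪ B) → Feas P (A ∪ B)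

theorem Feas.nonempty {A : Set X} (h : Feas P A) : A.Nonempty := by
  induction h with
  | single v => exact ⟨v, rfl⟩
  | join _ _ _ _ ih _ => exact ih.inl

theorem Feas.prop {A : Set X} (h : Feas P A) : P A := by
  cases h <;> assumption

theorem Feas.exists_clusterTree {A : Set X} (h : Feas P A) : Nonempty (ClusterTree P A) := by
  induction h with
  | single v h => exact ⟨.leaf v h⟩
  | join _ _ hd h ih ih' => exact ⟨.join ih.some ih'.some hd h⟩

/-- Moving the root of a tree to the leaf `v`. -/
theorem Feas.reroot (hPc : ∀ A, P A → P Aᶜ) {A : Set X} (hA : Feas P A) :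
    Feas P Aᶜ → ∀ v ∈ A, Feas P {v}ᶜ := by
  induction hA with
  | single v _ => rintro h _ rfl; exact h
  | @join A B hA hB hd hP ihA ihB =>
    intro h v hv
    -- The root slides from the edge above `A ∪ B` to the edge above one child: what lies beyond
    -- that edge is the sibling joined with the old outside.
    have hA' : Aᶜ = B ∪ (A ∪ B)ᶜ := by
      ext x
      have : x ∈ B → x ∉ A := fun h1 h2 => hd.le_bot ⟨h2, h1⟩
      simp only [mem_compl_iff, mem_union]; tauto
    have hB' : Bᶜ = A ∪ (A ∪ B)ᶜ := by
      ext x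
      have : x ∈ B → x ∉ A := fun h1 h2 => hd.le_bot ⟨h2, h1⟩
      simp only [mem_compl_iff, mem_union]; tauto
    rcases hv with hv | hv
    · refine ihA ?_ v hv
      have hp := hPc _ hA.prop
      rw [hA'] at hp ⊢
      exact .join hB h (disjoint_compl_right.mono_left subset_union_right) hp
    · refine ihB ?_ v hv
      have hp := hPc _ hB.prop
      rw [hB'] at hp ⊢
      exact .join hA h (disjoint_compl_right.mono_left subset_union_left) hp

theorem Feas.exists_branchDecomposition (hPc : ∀ A, P A → P Aᶜ) {A : Set X} (hA : Feas P A)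
    (hA' : Feas P Aᶜ) : ∃ D : BranchDecomposition X, ∀ a b, D.tree.Adj a b → P (D.side a b) := by
  obtain ⟨v, hv⟩ := hA.nonempty
  obtain ⟨T⟩ := (hA.reroot hPc hA' v hv).exists_clusterTree
  exact T.exists_branchDecomposition hPc

theorem feas_of_forall [Finite X] (h : ∀ A, P A) {A : Set X} (hA : A.Nonempty) : Feas P A := by
  induction A, A.toFinite using Set.Finite.induction_on with
  | empty => exact absurd hA not_nonempty_empty
  | @insert a s ha _ ih =>
    rcases s.eq_empty_or_nonempty with rfl | hs
    · simpa using Feas.single a (h _)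
    · rw [insert_eq]
      exact .join (.single a (h _)) (ih hs) (disjoint_singleton_left.2 ha) (h _)

/-- This makes the infimum that defines `mmw` an attained minimum. -/
theorem exists_branchDecomposition [Finite X] [Nontrivial X] :
    Nonempty (BranchDecomposition X) := by
  obtain ⟨x, y, hxy⟩ := exists_pair_ne X
  obtain ⟨D, -⟩ := Feas.exists_branchDecomposition (P := fun _ : Set X => True) (by simp)
    (Feas.single x trivial) (feas_of_forall (by simp) ⟨y, by simpa using hxy.symm⟩)
  exact ⟨D⟩

end Feas

/-! ### Sides of tree edges and balanced edges. -/

section TreeSides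

variable {N : Type*} {T : SimpleGraph N}

/-- The vertices on the side of `a` once the edge `ab` is removed. -/
def treeSide (T : SimpleGraph N) (a b : N) : Set N := {t | (T.deleteEdges {s(a, b)}).Reachable a t}

theorem not_mem_treeSide (hT : T.IsTree) {a b : N} (hab : T.Adj a b) : b ∉ treeSide T a b :=
  SimpleGraph.isBridge_iff.1 (SimpleGraph.isAcyclic_iff_forall_adj_isBridge.1 hT.isAcyclic hab)

theorem compl_treeSide (hT : T.IsTree) {a b : N} (hab : T.Adj a b) :
    (treeSide T a b)ᶜ = treeSide T b a := by
  ext t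
  have hs : s(b, a) = s(a, b) := Sym2.eq_swap
  simp only [treeSide, mem_compl_iff, mem_ofPred_eq, hs]
  exact ⟨fun h => (reachable_deleteEdges_or hT.connected.preconnected a b t).resolve_left h,
    fun h h' => not_mem_treeSide hT hab (h'.trans h.symm)⟩

/-- Passing on through `b` towards another neighbour strictly enlarges the side that is left behind.
This drives the extremal argument in `BranchDecomposition.exists_balanced`. -/
theorem treeSide_ssubset (hT : T.IsTree) {a b c : N} (hab : T.Adj a b) (hac : a ≠ c) :
    treeSide T a b ⊂ treeSide T b c := by
  refine (ssubset_iff_of_subset fun t ht => ?_).2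
    ⟨b, SimpleGraph.Reachable.rfl, not_mem_treeSide hT hab⟩
  have h := (SimpleGraph.reachable_iff_reflTransGen a t).1 ht
  have hr : ∀ {u}, Relation.ReflTransGen (T.deleteEdges {s(a, b)}).Adj a u → u ≠ b := by
    rintro u hu rfl
    exact not_mem_treeSide hT hab ((SimpleGraph.reachable_iff_reflTransGen _ _).2 hu)
  induction h with
  | refl =>
    refine SimpleGraph.Adj.reachable ?_
    rw [SimpleGraph.deleteEdges_adj]
    refine ⟨hab.symm, fun h => ?_⟩
    rcases Sym2.eq_iff.1 h with h | h
    · exact hac h.2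
    · exact hab.ne h.2
  | @tail u v hu huv ih =>
    refine (ih ((SimpleGraph.reachable_iff_reflTransGen _ _).2 hu)).trans
      (SimpleGraph.Adj.reachable ?_)
    rw [SimpleGraph.deleteEdges_adj]
    refine ⟨(SimpleGraph.deleteEdges_adj.1 huv).1, fun h => ?_⟩
    rcases Sym2.eq_iff.1 h with h | h
    · exact hr hu h.1
    · exact hr (hu.tail huv) h.2

theorem exists_mem_treeSide (hT : T.IsTree) {b t : N} (h : t ≠ b) :
    ∃ d, T.Adj b d ∧ t ∈ treeSide T d b := by
  obtain ⟨p, hp⟩ := (hT.connected.preconnected b t).exists_isPath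
  cases p with
  | nil => exact (h rfl).elim
  | @cons _ d _ hbd q =>
    rw [SimpleGraph.Walk.cons_isPath_iff] at hp
    refine ⟨d, hbd, ⟨q.toDeleteEdges _ fun e he hs => hp.2 ?_⟩⟩
    rw [mem_singleton_iff.1 hs] at he
    exact q.snd_mem_support_of_mem_edges he

end TreeSides

/-- Every branch-decomposition has an edge both of whose sides are not light. -/
theorem BranchDecomposition.exists_balanced {X : Type*} [Nonempty X] (D : BranchDecomposition X)
    (μ : Set X → ℕ) (hmono : ∀ A B, A ⊆ B → μ A ≤ μ B) (hadd : ∀ A B, μ (A ∪ B) ≤ μ A + μ B)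
    (hsing : ∀ x, 3 * μ {x} < μ univ) :
    ∃ a b, D.tree.Adj a b ∧ μ univ ≤ 3 * μ (D.side a b) ∧ μ univ ≤ 3 * μ (D.side a b)ᶜ := by
  -- Otherwise every edge has a light side. Among the edges directed away from a light side, take
  -- one, `ab`, whose side contains the most tree vertices, and look at the far end `b`.
  by_contra! hcon
  have hside : ∀ a b, D.side a b =
      {x | (D.leafEquiv.symm x : Fin D.order) ∈ treeSide D.tree a b} := fun _ _ => rfl
  have hcompl : ∀ a b, D.tree.Adj a b → (D.side a b)ᶜ = D.side b a := fun a b hab => by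
    rw [hside, hside, ← compl_treeSide D.isTree hab]; rfl
  let light : Fin D.order × Fin D.order → Prop := fun e =>
    D.tree.Adj e.1 e.2 ∧ 3 * μ (D.side e.1 e.2) < μ univ
  have hlight : ∀ a b, D.tree.Adj a b → light (a, b) ∨ light (b, a) := by
    intro a b hab
    by_cases h : 3 * μ (D.side a b) < μ univ
    · exact Or.inl ⟨hab, h⟩
    · refine Or.inr ⟨hab.symm, ?_⟩
      have := hcon a b hab (not_lt.1 h)
      rwa [hcompl a b hab] at this
  have hex : ∃ e, light e := by
    obtain ⟨x⟩ := ‹Nonempty X›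
    have h1 := (D.leafEquiv.symm x).2
    obtain ⟨b, hb⟩ := ncard_eq_one.1 h1
    have hadj : D.tree.Adj (D.leafEquiv.symm x : Fin D.order) b := by
      have : b ∈ D.tree.neighborSet (D.leafEquiv.symm x : Fin D.order) := by rw [hb]; rfl
      exact this
    rcases hlight _ _ hadj with h | h
    exacts [⟨_, h⟩, ⟨_, h⟩]
  obtain ⟨⟨a, b⟩, ⟨hab, hμ⟩, hmax⟩ := ({e | light e} : Set _).toFinite.exists_maximalFor
    (fun e => (treeSide D.tree e.1 e.2).ncard) {e | light e} hex
  -- If the light side of `bc` were the one containing `b`, it would properly contain the chosen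
  -- side; so all branches hanging at `b` are light.
  have hnb : ∀ c, D.tree.Adj b c → 3 * μ (D.side c b) < μ univ := by
    intro c hbc
    by_cases hac : a = c
    · rwa [← hac]
    rcases hlight b c hbc with h | h
    · have h2 := ncard_lt_ncard (treeSide_ssubset D.isTree hab hac) (toFinite _)
      exact absurd (hmax h h2.le) (not_le.2 h2)
    · exact h.2
  have hcov : ∀ x : X, (D.leafEquiv.symm x : Fin D.order) ≠ b →
      ∃ c, D.tree.Adj b c ∧ x ∈ D.side c b := fun x hx => exists_mem_treeSide D.isTree hx
  -- If `b` is a leaf, then `X` is a light set plus one light element; if `b` is cubic, then `X` is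
  -- the union of three light sets. Both contradict subadditivity.
  rcases D.subcubic b with h1 | h3
  · obtain ⟨c, hc⟩ := ncard_eq_one.1 h1
    have huniv : (univ : Set X) ⊆ D.side a b ∪ {D.leafEquiv ⟨b, h1⟩} := by
      intro x _
      by_cases hx : (D.leafEquiv.symm x : Fin D.order) = b
      · refine Or.inr ?_
        have : D.leafEquiv.symm x = ⟨b, h1⟩ := Subtype.ext hx
        rw [← this]; simp
      · obtain ⟨d, hd, hxd⟩ := hcov x hx
        have e1 : d ∈ D.tree.neighborSet b := hd
        have e2 : a ∈ D.tree.neighborSet b := hab.symm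
        rw [hc] at e1 e2
        rw [mem_singleton_iff.1 e2, ← mem_singleton_iff.1 e1]
        exact Or.inl hxd
    have := (hmono _ _ huniv).trans (hadd _ _)
    have := hsing (D.leafEquiv ⟨b, h1⟩)
    simp only at hμ
    omega
  · obtain ⟨c, d, e, -, -, -, hcde⟩ := ncard_eq_three.1 h3
    have hin : ∀ t, t ∈ ({c, d, e} : Set _) → 3 * μ (D.side t b) < μ univ := fun t ht =>
      hnb t (by rw [← hcde] at ht; exact ht)
    have huniv : (univ : Set X) ⊆ D.side c b ∪ (D.side d b ∪ D.side e b) := by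
      intro x _
      have hx : (D.leafEquiv.symm x : Fin D.order) ≠ b := fun hx => by
        have := (D.leafEquiv.symm x).2
        rw [hx, h3] at this
        omega
      obtain ⟨t, ht, hxt⟩ := hcov x hx
      have ht' : t ∈ D.tree.neighborSet b := ht
      rw [hcde] at ht'
      rcases ht' with rfl | rfl | rfl
      exacts [Or.inl hxt, Or.inr (Or.inl hxt), Or.inr (Or.inr hxt)]
    have h1 := (hmono _ _ huniv).trans (hadd _ _)
    have h2 := hadd (D.side d b) (D.side e b)
    have h3 := hin c (by simp)
    have h4 := hin d (by simp)
    have h5 := hin e (by simp)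
    omega

theorem BranchDecomposition.le_width {X : Type*} (D : BranchDecomposition X) (f : Set X → ℕ)
    {a b : Fin D.order} (h : D.tree.Adj a b) : f (D.side a b) ≤ D.width f :=
  le_csSup ((finite_range fun p : Fin D.order × Fin D.order => f (D.side p.1 p.2)).subset (by
    rintro _ ⟨a, b, -, rfl⟩; exact ⟨(a, b), rfl⟩)).bddAbove ⟨a, b, h, rfl⟩

theorem exists_width_eq_mmw {V : Type*} [Finite V] [Nontrivial V] (G : SimpleGraph V) :
    ∃ D : BranchDecomposition V, D.width (mm G) = mmw G :=
  Nat.sInf_mem (s := {w | ∃ D : BranchDecomposition V, D.width (mm G) = w})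
    (exists_branchDecomposition.elim fun D => ⟨_, D, rfl⟩)

/-- If no set and its complement are both light and avoided by three disjoint crossing edges,
the maximum matching width exceeds two. -/
theorem two_lt_mmw {V : Type*} [Finite V] [Nontrivial V] (G : SimpleGraph V)
    (μ : Set V → ℕ) (hmono : ∀ A B, A ⊆ B → μ A ≤ μ B) (hadd : ∀ A B, μ (A ∪ B) ≤ μ A + μ B)
    (hsing : ∀ x, 3 * μ {x} < μ univ)
    (h : ∀ A, μ univ ≤ 3 * μ A → μ univ ≤ 3 * μ Aᶜ → Matching3 G A) : 2 < mmw G := by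
  obtain ⟨D, hD⟩ := exists_width_eq_mmw G
  obtain ⟨a, b, hab, h1, h2⟩ := D.exists_balanced μ hmono hadd hsing
  rw [← hD]
  exact (h _ h1 h2).three_le_mm.trans (D.le_width _ hab)

/-- Crossing edges of a minor give crossing edges of the graph. -/
theorem Matching3.of_minor {W V : Type*} {H : SimpleGraph W} {G : SimpleGraph V} {B : W → Set V}
    (hc : ∀ w, (G.induce (B w)).Connected) (hd : ∀ w w', w ≠ w' → Disjoint (B w) (B w'))
    (ha : ∀ w w', H.Adj w w' → ∃ x ∈ B w, ∃ y ∈ B w', G.Adj x y) {r : W → V}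
    (hr : ∀ w, r w ∈ B w) {A : Set V} (h : Matching3 H (r ⁻¹' A)) : Matching3 G A := by
  obtain ⟨x, y, hx, hy, hxy⟩ := h
  -- The branch sets of the two ends of a crossing minor edge form a connected union with one
  -- representative in `A` and one outside, so some edge of `G` inside this union crosses. Unions
  -- for different `i` are disjoint.
  have key : ∀ i, ∃ u ∈ B (x i) ∪ B (y i), ∃ v ∈ B (x i) ∪ B (y i),
      u ∈ A ∧ v ∉ A ∧ G.Adj u v := by
    intro i
    obtain ⟨h1, h2, h3⟩ := hxy i
    obtain ⟨p, hp, q, hq, hpq⟩ := ha _ _ h3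
    have hC := (connSet_of_induce_connected (hc (x i))).union_of_adj
      (connSet_of_induce_connected (hc (y i))) hp hq hpq
    by_contra! hcon
    have := hC.2 (A ∩ (B (x i) ∪ B (y i))) inter_subset_right ⟨r (x i), h1, Or.inl (hr _)⟩
      fun u hu v hv huv => ⟨by_contra fun hvA => hcon u hu.2 v hv hu.1 hvA huv, hv⟩
    have hy : r (y i) ∈ B (x i) ∪ B (y i) := Or.inr (hr _)
    rw [← this] at hy
    exact h2 hy.1
  choose u hu v hv huA hvA huv using key
  have hne : ∀ i j, i ≠ j → Disjoint (B (x i) ∪ B (y i)) (B (x j) ∪ B (y j)) := by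
    intro i j hij
    have hxy' : ∀ i j, x i ≠ y j := fun i j h => (hxy j).2.1 (h ▸ (hxy i).1)
    simp only [disjoint_union_left, disjoint_union_right]
    exact ⟨⟨hd _ _ (hx.ne hij), hd _ _ (hxy' _ _).symm⟩, hd _ _ (hxy' _ _), hd _ _ (hy.ne hij)⟩
  refine ⟨u, v, fun i j hij => ?_, fun i j hij => ?_, fun i => ⟨huA i, hvA i, huv i⟩⟩
  · by_contra h
    exact (hne i j h).le_bot ⟨hu i, hij ▸ hu j⟩
  · by_contra h
    exact (hne i j h).le_bot ⟨hv i, hij ▸ hv j⟩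

/-! ### Evaluation -/

/-- Pass the value of `n` to `k`; by unfolding the successor the argument gets evaluated first. -/
def force {β : Type} (n : ℕ) (k : ℕ → β) : β :=
  match n + 1 with
  | 0 => k 0
  | m + 1 => k m

/-- The forcing functions change only the order of evaluation; this lemma and its companions remove
them from the soundness proofs. -/
theorem force_eq {β : Type} (n : ℕ) (k : ℕ → β) : force n k = k n := rfl

/-- Pass the evaluated list to `k`. -/
def forceList {β : Type} : List ℕ → (List ℕ → β) → β
  | [], k => k []
  | e :: es, k => force e fun a => forceList es fun l => k (a :: l)

theorem forceList_eq {β : Type} (l : List ℕ) (k : List ℕ → β) : forceList l k = k l := by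
  induction l generalizing k with
  | nil => rfl
  | cons a l ih => rw [forceList, force_eq, ih]

/-- Pass the evaluated list of pairs to `k`. -/
def forcePairs {β : Type} : List (ℕ × ℕ) → (List (ℕ × ℕ) → β) → β
  | [], k => k []
  | (a, b) :: es, k => force a fun a => force b fun b => forcePairs es fun l => k ((a, b) :: l)

theorem forcePairs_eq {β : Type} (l : List (ℕ × ℕ)) (k : List (ℕ × ℕ) → β) :
    forcePairs l k = k l := by
  induction l generalizing k with
  | nil => rfl
  | cons a l ih => rw [forcePairs, force_eq, force_eq, ih]

/-- Add the evaluated members of a list to `acc` and pass the result to `k`. -/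
def forceOnto {β : Type} (acc : List ℕ) : List ℕ → (List ℕ → β) → β
  | [], k => k acc
  | e :: es, k => force e fun a => forceOnto acc es fun l => k (a :: l)

theorem forceOnto_eq {β : Type} (acc l : List ℕ) (k : List ℕ → β) :
    forceOnto acc l k = k (l ++ acc) := by
  induction l generalizing k with
  | nil => rfl
  | cons a l ih => rw [forceOnto, force_eq, ih, List.cons_append]

/-- Evaluate the members of a list of lists. -/
def forceLists {β : Type} : List (List ℕ) → (List (List ℕ) → β) → β
  | [], k => k []
  | e :: es, k => forceList e fun a => forceLists es fun l => k (a :: l)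

theorem forceLists_eq {β : Type} (l : List (List ℕ)) (k : List (List ℕ) → β) :
    forceLists l k = k l := by
  induction l generalizing k with
  | nil => rfl
  | cons a l ih => rw [forceLists, forceList_eq, ih]

/-! ### A certificate for large maximum matching width -/

namespace EdgeList

theorem graph_adj_of_mem {g : EdgeList} {e : ℕ × ℕ} (he : e ∈ g.edges) (hne : e.1 ≠ e.2)
    (h1 : e.1 < g.order) (h2 : e.2 < g.order) : g.graph.Adj ⟨e.1, h1⟩ ⟨e.2, h2⟩ := by
  refine (SimpleGraph.fromRel_adj _ _ _).2 ⟨fun h => hne (congrArg Fin.val h), Or.inl he⟩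

/-- Some edges at the vertex `i`, as bit masks. -/
def rowMasks (es : List (ℕ × ℕ)) (i : ℕ) : List ℕ :=
  es.filterMap fun e =>
    if (Nat.beq e.1 i && Nat.blt e.2 i) || (Nat.beq e.2 i && Nat.blt e.1 i) then
      some (Nat.lor (2 ^ e.1) (2 ^ e.2)) else none

/-- Two bit masks are disjoint. -/
def disj (m p : ℕ) : Bool := Nat.beq (Nat.land m p) 0

/-- The unions of disjoint masks, one from each list. -/
def joinDisjoint (l l' : List ℕ) : List ℕ :=
  l.flatMap fun m => (l'.filter (disj m)).map (Nat.lor m)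

/-- Every way to put vertices of weights `ws` inside or outside leaves a light side or three
disjoint crossing edges. The masks `I` and `O` contain the earlier vertices inside and outside,
their weights are `a` and `b`, and the lists `L₁` and `L₂` contain masks of crossing edges and of
pairs of disjoint crossing edges. The next vertex is the one with mask `q`. -/
def lowerCheck (tot : ℕ) : List ℕ → List (List ℕ) → ℕ → ℕ → ℕ → ℕ → ℕ → List ℕ → List ℕ → Bool
  | [], _, _, _, _, a, b, _, _ => Nat.blt (3 * a) tot || Nat.blt (3 * b) tot
  | _ :: _, [], _, _, _, _, _, _, _ => false
  | w :: ws, ms :: mss, q, I, O, a, b, L₁, L₂ => force (2 * q) fun q' =>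
      (forceList (ms.filter fun m => !disj m O) fun new =>
        new.any (fun m => L₂.any (disj m)) ||
          forceOnto L₂ (joinDisjoint new L₁) fun L₂' => forceOnto L₁ new fun L₁' =>
            force (Nat.lor I q) fun I' => force (a + w) fun a' =>
              lowerCheck tot ws mss q' I' O a' b L₁' L₂') &&
      forceList (ms.filter fun m => !disj m I) fun new =>
        new.any (fun m => L₂.any (disj m)) ||
          forceOnto L₂ (joinDisjoint new L₁) fun L₂' => forceOnto L₁ new fun L₁' =>
            force (Nat.lor O q) fun O' => force (b + w) fun b' =>
              lowerCheck tot ws mss q' I O' a b' L₁' L₂'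

theorem not_testBit_of_disj {m p j : ℕ} (h : disj m p = true) (hm : m.testBit j = true) :
    p.testBit j ≠ true := fun hp => by
  have h' : (Nat.land m p).testBit j = (m.testBit j && p.testBit j) := Nat.testBit_and _ _ _
  rw [Nat.eq_of_beq_eq_true h, hm, hp] at h'
  simp at h'

theorem exists_testBit_of_not_disj {m p : ℕ} (h : disj m p ≠ true) :
    ∃ j, m.testBit j = true ∧ p.testBit j = true := by
  rw [disj, Ne, Nat.beq_eq] at h
  obtain ⟨j, hj⟩ := Nat.exists_testBit_of_ne_zero h
  have h' : (Nat.land m p).testBit j = (m.testBit j && p.testBit j) := Nat.testBit_and _ _ _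
  rw [h', Bool.and_eq_true] at hj
  exact ⟨j, hj⟩

theorem testBit_lor {m p j : ℕ} :
    (Nat.lor m p).testBit j = true ↔ m.testBit j = true ∨ p.testBit j = true := by
  have h' : (Nat.lor m p).testBit j = (m.testBit j || p.testBit j) := Nat.testBit_or _ _ _
  rw [h', Bool.or_eq_true]

/-- The mask `m` belongs to an edge at `i`. -/
def EdgeMask (es : List (ℕ × ℕ)) (i m : ℕ) : Prop :=
  ∃ e ∈ es, (e.1 = i ∨ e.2 = i) ∧ ∀ j, m.testBit j = true ↔ j = e.1 ∨ j = e.2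

theorem edgeMask_of_mem_rowMasks {es : List (ℕ × ℕ)} {i m : ℕ} (h : m ∈ rowMasks es i) :
    EdgeMask es i m := by
  obtain ⟨e, he, h⟩ := List.mem_filterMap.1 h
  split_ifs at h with hi
  obtain rfl := Option.some_injective _ h
  simp only [Bool.or_eq_true, Bool.and_eq_true, Nat.beq_eq] at hi
  refine ⟨e, he, hi.imp And.left And.left, fun j => ?_⟩
  rw [testBit_lor, Nat.testBit_two_pow, Nat.testBit_two_pow, decide_eq_true_eq, decide_eq_true_eq,
    eq_comm (a := e.1), eq_comm (a := e.2)]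

/-- The mask `m` belongs to an edge between `S` and its complement. -/
def CrossMask (es : List (ℕ × ℕ)) (S : Set ℕ) (m : ℕ) : Prop :=
  ∃ e ∈ es, (e.1 ∈ S ∧ e.2 ∉ S ∨ e.2 ∈ S ∧ e.1 ∉ S) ∧
    ∀ j, m.testBit j = true ↔ j = e.1 ∨ j = e.2

/-- The mask `p` is the union of two disjoint masks of crossing edges. -/
def CrossPair (es : List (ℕ × ℕ)) (S : Set ℕ) (p : ℕ) : Prop :=
  ∃ m k, CrossMask es S m ∧ CrossMask es S k ∧ disj m k = true ∧ p = Nat.lor m k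

/-- There are three disjoint edges between `S` and its complement. -/
def CrossTriple (es : List (ℕ × ℕ)) (S : Set ℕ) : Prop :=
  ∃ m p, CrossMask es S m ∧ CrossPair es S p ∧ disj m p = true

open Classical in
/-- The weight of a set of vertices. -/
noncomputable def weight : List ℕ → ℕ → Set ℕ → ℕ
  | [], _, _ => 0
  | w :: ws, i, S => (if i ∈ S then w else 0) + weight ws (i + 1) S

theorem weight_mono (ws : List ℕ) (i : ℕ) {S T : Set ℕ} (h : S ⊆ T) :
    weight ws i S ≤ weight ws i T := by
  induction ws generalizing i with
  | nil => exact le_rfl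
  | cons w ws ih =>
    refine add_le_add ?_ (ih _)
    by_cases hS : i ∈ S
    · simp [hS, h hS]
    · simp [hS]

theorem weight_union_le (ws : List ℕ) (i : ℕ) (S T : Set ℕ) :
    weight ws i (S ∪ T) ≤ weight ws i S + weight ws i T := by
  induction ws generalizing i with
  | nil => exact le_rfl
  | cons w ws ih =>
    have := ih (i + 1)
    simp only [weight]
    by_cases hS : i ∈ S <;> by_cases hT : i ∈ T <;> simp [hS, hT] <;> omega

theorem weight_lt_of_subsingleton {m : ℕ} (ws : List ℕ) (i : ℕ) (hm : 0 < m)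
    (h : ∀ w ∈ ws, 3 * w < m) {S : Set ℕ} (hS : S.Subsingleton) : 3 * weight ws i S < m := by
  induction ws generalizing i with
  | nil => simpa [weight] using hm
  | cons w ws ih =>
    by_cases hi : i ∈ S
    · have hz : ∀ ws' j, i < j → weight ws' j S = 0 := by
        intro ws'
        induction ws' with
        | nil => intro j _; rfl
        | cons w ws' ih =>
          intro j hj
          have : j ∉ S := fun hjS => hj.ne (hS hi hjS)
          simp [weight, this, ih (j + 1) (by omega)]
      simp only [weight, hi, if_true, hz ws (i + 1) (by omega), add_zero]
      exact h w (by simp)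
    · simp only [weight, hi, if_false, zero_add]
      exact ih _ fun w hw => h w (by simp [hw])

theorem weight_univ (ws : List ℕ) (i : ℕ) {S : Set ℕ}
    (h : ∀ j, i ≤ j → j < i + ws.length → j ∈ S) : weight ws i S = ws.sum := by
  induction ws generalizing i with
  | nil => rfl
  | cons w ws ih =>
    rw [weight, if_pos (h i le_rfl (by simp)), ih, List.sum_cons]
    intro j h1 h2
    exact h j (by omega) (by simp only [List.length_cons]; omega)

/-- The invariant is that `I` lies in `S`, `O` avoids `S`, and the lists contain genuine crossing
edges and genuine disjoint pairs. Completeness of the lists is irrelevant for soundness. Nothing is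
lost by joining new edges only with old ones, as the new edges share the vertex just placed. -/
theorem lowerCheck_sound {es : List (ℕ × ℕ)} {tot : ℕ} {S S' : Set ℕ} :
    ∀ (ws : List ℕ) (mss : List (List ℕ)) {i I O a b : ℕ} {L₁ L₂ : List ℕ},
      lowerCheck tot ws mss (2 ^ i) I O a b L₁ L₂ = true →
      (∀ j ms, mss[j]? = some ms → ∀ m ∈ ms, EdgeMask es (i + j) m) →
      (∀ j, I.testBit j = true → j ∈ S) → (∀ j, O.testBit j = true → j ∉ S) →
      (∀ m ∈ L₁, CrossMask es S m) → (∀ p ∈ L₂, CrossPair es S p) →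
      (∀ j, j < i + ws.length → (j ∈ S' ↔ j ∉ S)) →
      3 * (a + weight ws i S) < tot ∨ 3 * (b + weight ws i S') < tot ∨ CrossTriple es S
  | [], _, i, I, O, a, b, L₁, L₂, h, _, _, _, _, _, _ => by
    simp only [lowerCheck, Bool.or_eq_true, Nat.blt_eq] at h
    rcases h with h | h
    · exact Or.inl (by simpa [weight] using h)
    · exact Or.inr (Or.inl (by simpa [weight] using h))
  | _ :: _, [], i, I, O, a, b, L₁, L₂, h, _, _, _, _, _, _ => by
    simp [lowerCheck] at h
  | w :: ws, ms :: mss, i, I, O, a, b, L₁, L₂, h, hms, hI, hO, h1, h2, hS' => by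
    simp only [lowerCheck, force_eq, forceList_eq, forceOnto_eq, Bool.and_eq_true] at h
    have hpow : 2 * 2 ^ i = 2 ^ (i + 1) := by rw [pow_succ]; omega
    rw [hpow] at h
    have hi := hS' i (by simp)
    have hl : i + 1 + ws.length = i + (w :: ws).length := by
      simp only [List.length_cons]; omega
    have hmss : ∀ j ns, mss[j]? = some ns → ∀ m ∈ ns, EdgeMask es (i + 1 + j) m := by
      intro j ns hj m hm
      have := hms (j + 1) ns (by simpa using hj) m hm
      rwa [add_assoc, add_comm 1 j]
    have hrow : ∀ m ∈ ms, EdgeMask es i m := fun m hm => hms 0 ms rfl m hm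
    have htriple : ∀ new : List ℕ, (∀ m ∈ new, CrossMask es S m) →
        new.any (fun m => L₂.any (disj m)) = true → CrossTriple es S := by
      intro new hnew h
      obtain ⟨m, hm, h⟩ := List.any_eq_true.1 h
      obtain ⟨p, hp, h⟩ := List.any_eq_true.1 h
      exact ⟨m, p, hnew m hm, h2 p hp, h⟩
    have hL₁ : ∀ new : List ℕ, (∀ m ∈ new, CrossMask es S m) →
        ∀ m ∈ new ++ L₁, CrossMask es S m := fun new hnew m hm =>
      (List.mem_append.1 hm).elim (hnew m) (h1 m)
    have hL₂ : ∀ new : List ℕ, (∀ m ∈ new, CrossMask es S m) →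
        ∀ p ∈ joinDisjoint new L₁ ++ L₂, CrossPair es S p := by
      intro new hnew p hp
      rcases List.mem_append.1 hp with hp | hp
      · obtain ⟨m, hm, hp⟩ := List.mem_flatMap.1 hp
        obtain ⟨m', hm', rfl⟩ := List.mem_map.1 hp
        obtain ⟨hm', hd⟩ := List.mem_filter.1 hm'
        exact ⟨m, m', hnew m hm, h1 m' hm', hd, rfl⟩
      · exact h2 p hp
    have hor : ∀ M j : ℕ, (Nat.lor M (2 ^ i)).testBit j = true → M.testBit j = true ∨ j = i := by
      intro M j hj
      rw [testBit_lor, Nat.testBit_two_pow, decide_eq_true_eq] at hj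
      exact hj.imp_right Eq.symm
    by_cases hiS : i ∈ S
    · have hiS' : i ∉ S' := fun h => hi.1 h hiS
      have hnew : ∀ m ∈ ms.filter fun m => !disj m O, CrossMask es S m := by
        intro m hm
        obtain ⟨hm, hd⟩ := List.mem_filter.1 hm
        obtain ⟨j, hmj, hOj⟩ := exists_testBit_of_not_disj (by simpa using hd)
        obtain ⟨e, he, hei, hbits⟩ := hrow m hm
        have hj := hO j hOj
        refine ⟨e, he, ?_, hbits⟩
        rcases (hbits j).1 hmj with rfl | rfl <;> rcases hei with rfl | rfl
        exacts [(hj hiS).elim, Or.inr ⟨hiS, hj⟩, Or.inl ⟨hiS, hj⟩, (hj hiS).elim]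
      rcases Bool.or_eq_true _ _ ▸ h.1 with h | h
      · exact Or.inr (Or.inr (htriple _ hnew h))
      · have := lowerCheck_sound ws mss h hmss (S := S) (S' := S') (fun j hj => ?_) hO
          (hL₁ _ hnew) (hL₂ _ hnew) fun j hj => hS' j (hl ▸ hj)
        · simp only [weight, hiS, hiS', if_true, if_false, zero_add]
          simpa only [add_assoc] using this
        · rcases hor I j hj with h | rfl
          exacts [hI j h, hiS]
    · have hiS' : i ∈ S' := hi.2 hiS
      have hnew : ∀ m ∈ ms.filter fun m => !disj m I, CrossMask es S m := by
        intro m hm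
        obtain ⟨hm, hd⟩ := List.mem_filter.1 hm
        obtain ⟨j, hmj, hIj⟩ := exists_testBit_of_not_disj (by simpa using hd)
        obtain ⟨e, he, hei, hbits⟩ := hrow m hm
        have hj := hI j hIj
        refine ⟨e, he, ?_, hbits⟩
        rcases (hbits j).1 hmj with rfl | rfl <;> rcases hei with rfl | rfl
        exacts [(hiS hj).elim, Or.inl ⟨hj, hiS⟩, Or.inr ⟨hj, hiS⟩, (hiS hj).elim]
      rcases Bool.or_eq_true _ _ ▸ h.2 with h | h
      · exact Or.inr (Or.inr (htriple _ hnew h))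
      · have := lowerCheck_sound ws mss h hmss (S := S) (S' := S') hI (fun j hj => ?_)
          (hL₁ _ hnew) (hL₂ _ hnew) fun j hj => hS' j (hl ▸ hj)
        · simp only [weight, hiS, hiS', if_true, if_false, zero_add]
          simpa only [add_assoc] using this
        · rcases hor O j hj with h | rfl
          exacts [hO j h, hiS]

/-- The complete test that the weights `ws` witness maximum matching width above two. -/
def lowerTest (g : EdgeList) (ws : List ℕ) : Bool :=
  force g.order fun n => forcePairs g.edges fun es => forceList ws fun vs =>
    Nat.beq vs.length n && (vs.all (fun w => Nat.blt (3 * w) vs.sum) &&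
      (es.all (fun e => !Nat.beq e.1 e.2 && (Nat.blt e.1 n && Nat.blt e.2 n)) &&
        (Nat.blt 1 vs.sum && forceLists ((List.range n).map (rowMasks es)) fun mss =>
          force vs.sum fun tot => lowerCheck tot vs mss 1 0 0 0 0 [] [])))

/-- A subset of `V` gets the weight of those minor vertices whose chosen representative `r` it
contains. Representatives are distinct, so a single vertex of `V` carries the weight of at most one
minor vertex. -/
theorem two_lt_mmw_of_lowerTest {g : EdgeList} {ws : List ℕ} (h : g.lowerTest ws = true)
    {V : Type*} [Finite V] {G : SimpleGraph V} (hm : IsMinor g.graph G) : 2 < mmw G := by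
  simp only [lowerTest, forceLists_eq, forcePairs_eq, forceList_eq, force_eq, Bool.and_eq_true,
    List.all_eq_true, Nat.blt_eq, Nat.beq_eq, Bool.not_eq_true', ← Bool.not_eq_true] at h
  obtain ⟨hlen, hws, hes, htot, hchk⟩ := h
  obtain ⟨B, hc, hd, ha⟩ := hm
  have hne : ∀ w, (B w).Nonempty := fun w => (connSet_of_induce_connected (hc w)).1
  choose r hr using hne
  have hrinj : Function.Injective r := fun v w hvw => by
    by_contra hne
    exact (hd v w hne).le_bot ⟨hr v, hvw ▸ hr w⟩
  let pre : Set V → Set ℕ := fun A => {i | ∃ h : i < g.order, r ⟨i, h⟩ ∈ A}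
  have huniv : weight ws 0 (pre univ) = ws.sum :=
    weight_univ ws 0 fun j _ hj => ⟨by omega, trivial⟩
  have hsing : ∀ x, 3 * weight ws 0 (pre {x}) < ws.sum := fun x =>
    weight_lt_of_subsingleton ws 0 (by omega) hws (by
      rintro i ⟨hi, hi'⟩ j ⟨hj, hj'⟩
      exact Fin.mk.inj_iff.1 (hrinj (hi'.trans hj'.symm)))
  -- A lone vertex would carry the whole weight although it has less than a third of it; with no
  -- vertex at all the total would vanish.
  have hnt : Nontrivial V := by
    by_contra hnt
    rw [not_nontrivial_iff_subsingleton] at hnt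
    by_cases hV : Nonempty V
    · obtain ⟨x⟩ := hV
      have : ({x} : Set V) = univ := eq_univ_of_forall fun y => Subsingleton.elim y x
      have h1 := hsing x
      rw [this, huniv] at h1
      omega
    · have : pre univ = ∅ := by
        ext i
        simp only [pre, mem_ofPred_eq, mem_empty_iff_false, iff_false]
        rintro ⟨h, -⟩
        exact hV ⟨r ⟨i, h⟩⟩
      have h2 : ws.length = 0 := by
        rw [hlen]
        by_contra h0
        have : (0 : ℕ) ∈ pre univ := ⟨by omega, trivial⟩
        simp_all
      rw [List.length_eq_zero_iff] at h2
      subst h2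
      simp at htot
  refine two_lt_mmw G (fun A => weight ws 0 (pre A)) (fun A B hAB => weight_mono _ _
    fun i ⟨h, hi⟩ => ⟨h, hAB hi⟩) (fun A B => ?_) (fun x => by rw [huniv]; exact hsing x) ?_
  · refine le_trans (weight_mono _ _ ?_) (weight_union_le _ _ _ _)
    rintro i ⟨h, hi | hi⟩
    exacts [Or.inl ⟨h, hi⟩, Or.inr ⟨h, hi⟩]
  · intro A h1 h2
    rw [huniv] at h1 h2
    obtain h | h | ⟨m, _, hm, ⟨m', m'', hm', hm'', hd', rfl⟩, hd''⟩ :=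
      lowerCheck_sound (es := g.edges) (S := pre A) (S' := pre Aᶜ) ws _ (i := 0) hchk
      (fun j ms hj m hm => by
        rw [List.getElem?_map, Option.map_eq_some_iff] at hj
        obtain ⟨k, hk, rfl⟩ := hj
        obtain ⟨hk', rfl⟩ := List.getElem?_eq_some_iff.1 hk
        rw [List.getElem_range] at hm
        rw [zero_add]
        exact edgeMask_of_mem_rowMasks hm)
      (by simp) (by simp) (by simp) (by simp) (fun j hj => by
        have hj' : j < g.order := by omega
        simp [pre, hj'])
    · omega
    · omega
    · refine Matching3.of_minor hc hd ha hr ?_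
      have key : ∀ m, CrossMask g.edges (pre A) m → ∃ x y : Fin g.order,
          (m.testBit x = true ∧ m.testBit y = true) ∧ r x ∈ A ∧ r y ∉ A ∧ g.graph.Adj x y := by
        rintro m ⟨e, he, h, hbits⟩
        obtain ⟨h0, h1, h2⟩ := hes e he
        have hadj := graph_adj_of_mem he h0 h1 h2
        rcases h with ⟨⟨_, h⟩, h'⟩ | ⟨⟨_, h⟩, h'⟩
        · exact ⟨⟨e.1, h1⟩, ⟨e.2, h2⟩, ⟨(hbits _).2 (Or.inl rfl), (hbits _).2 (Or.inr rfl)⟩, h,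
            fun h => h' ⟨h2, h⟩, hadj⟩
        · exact ⟨⟨e.2, h2⟩, ⟨e.1, h1⟩, ⟨(hbits _).2 (Or.inr rfl), (hbits _).2 (Or.inl rfl)⟩, h,
            fun h => h' ⟨h1, h⟩, hadj.symm⟩
      obtain ⟨x₁, y₁, ⟨hx₁, hy₁⟩, h₁⟩ := key m hm
      obtain ⟨x₂, y₂, ⟨hx₂, hy₂⟩, h₂⟩ := key m' hm'
      obtain ⟨x₃, y₃, ⟨hx₃, hy₃⟩, h₃⟩ := key m'' hm''
      have h12 : ∀ x y : Fin g.order, m.testBit x = true → m'.testBit y = true → x ≠ y :=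
        fun x y hx hy h => not_testBit_of_disj hd'' hx (testBit_lor.2 (Or.inl (h ▸ hy)))
      have h13 : ∀ x y : Fin g.order, m.testBit x = true → m''.testBit y = true → x ≠ y :=
        fun x y hx hy h => not_testBit_of_disj hd'' hx (testBit_lor.2 (Or.inr (h ▸ hy)))
      have h23 : ∀ x y : Fin g.order, m'.testBit x = true → m''.testBit y = true → x ≠ y :=
        fun x y hx hy h => not_testBit_of_disj hd' hx (h ▸ hy)
      have hinj : ∀ {a b c : Fin g.order}, a ≠ b → a ≠ c → b ≠ c →
          Function.Injective ![a, b, c] := by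
        intro a b c hab hac hbc i j hij
        fin_cases i <;> fin_cases j <;> first | rfl | (exfalso; simp_all)
      refine ⟨![x₁, x₂, x₃], ![y₁, y₂, y₃],
        hinj (h12 _ _ hx₁ hx₂) (h13 _ _ hx₁ hx₃) (h23 _ _ hx₂ hx₃),
        hinj (h12 _ _ hy₁ hy₂) (h13 _ _ hy₁ hy₃) (h23 _ _ hy₂ hy₃), ?_⟩
      intro i
      fin_cases i
      exacts [h₁, h₂, h₃]

/-- Vertices of weight `c` in a graph all of whose other vertices have weight two. -/
def weightsOf (n : ℕ) (c : ℕ) (l : List ℕ) : List ℕ :=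
  (List.range n).map fun i => if l.contains i then c else 2

/-- For every obstruction, a set of vertices and their common weight. -/
def lightVertices : List (ℕ × List ℕ) :=
  [(0, []), (0, []), (0, []), (0, []), (0, []),
   (0, [0, 1]), (0, [0, 3]), (0, [0, 3]), (0, [1, 2, 3]), (0, [1, 2, 3]), (0, [1, 2, 3]),
   (0, [0, 1, 2]), (0, [0, 1, 2]), (0, [0, 1, 2]), (0, [0, 1, 2]),
   (0, [1]), (0, [0]), (1, [0, 1, 2]), (0, [2, 4]), (0, [1, 3]), (0, [0, 3]), (0, [1, 2]),
   (0, [1, 3]), (0, [1, 3]), (0, [1, 2]), (0, [1, 2]), (0, [1, 2]), (0, [1, 2]),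
   (0, [0, 1]), (0, [0, 1]), (0, [0, 1]), (0, [0, 1]), (1, [0, 1, 3]),
   (0, [0]), (0, [0]), (0, [1]), (0, [0]), (0, [0]), (0, [0]), (0, [0]), (0, [0]),
   (0, [0]), (0, [0]), (0, [1]), (0, [2])]

/-- Where the exceptional weight is `0`, exactly seven vertices have weight two, so the total is
`14` and a side that is not light contains at least three of the seven. The two cases of weight `1`
have total `13`, so both sides must weigh at least five. -/
theorem lowerTest_obstructions : ((obstructions.zip lightVertices).all
    fun p => p.1.lowerTest (weightsOf p.1.order p.2.1 p.2.2)) = true := by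
  decide +kernel

theorem two_lt_mmw_of_isMinor {H : EdgeList} (hH : H ∈ obstructions) {V : Type*} [Finite V]
    {G : SimpleGraph V} (hm : IsMinor H.graph G) : 2 < mmw G := by
  rw [← List.map_fst_zip (l₁ := obstructions) (l₂ := lightVertices) (by decide)] at hH
  obtain ⟨p, hp, rfl⟩ := List.mem_map.1 hH
  exact two_lt_mmw_of_lowerTest (List.all_eq_true.1 lowerTest_obstructions p hp) hm

end EdgeList

/-! ### Pairwise non-isomorphism by colour refinement. -/

namespace EdgeList

/-- Adjacency of vertices, as a boolean. -/
def adjb (g : EdgeList) (v u : ℕ) : Bool :=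
  g.edges.any fun e => (Nat.beq e.1 v && Nat.beq e.2 u) || (Nat.beq e.1 u && Nat.beq e.2 v)

theorem adjb_iff (g : EdgeList) (v u : ℕ) :
    g.adjb v u = true ↔ (v, u) ∈ g.edges ∨ (u, v) ∈ g.edges := by
  simp only [adjb, List.any_eq_true, Bool.or_eq_true, Bool.and_eq_true, Nat.beq_eq]
  constructor
  · rintro ⟨⟨a, b⟩, he, ⟨rfl, rfl⟩ | ⟨rfl, rfl⟩⟩
    exacts [Or.inl he, Or.inr he]
  · rintro (h | h)
    exacts [⟨_, h, Or.inl ⟨rfl, rfl⟩⟩, ⟨_, h, Or.inr ⟨rfl, rfl⟩⟩]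

/-- The neighbours of a vertex. -/
def nbrs (g : EdgeList) (v : ℕ) : List ℕ := (List.range g.order).filter fun u =>
  g.adjb v u && !Nat.beq v u

/-- Colour refinement: the colour of a vertex after `k` rounds. -/
def colour (g : EdgeList) : ℕ → ℕ → ℕ
  | 0, _ => 1
  | k + 1, v => g.colour k v + ((g.nbrs v).map fun u => g.colour k u ^ 2).sum

/-- A round is rewritten as a sum over the neighbour set in the graph itself, in which form
invariance under isomorphism is immediate. -/
theorem colour_succ (g : EdgeList) (k v : ℕ) (hv : v < g.order) : g.colour (k + 1) v =
    g.colour k v + ∑ u : Fin g.order, (g.graph.neighborSet ⟨v, hv⟩).indicator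
      (fun u => g.colour k u ^ 2) u := by
  classical
  rw [colour, nbrs, ← List.sum_toFinset _ ((List.nodup_range).filter _),
    List.toFinset_filter, List.toFinset_range, Finset.sum_filter, Finset.sum_range]
  congr 1
  refine Finset.sum_congr rfl fun u _ => ?_
  rw [indicator_apply]
  refine if_congr ?_ rfl rfl
  rw [Bool.and_eq_true, adjb_iff, SimpleGraph.mem_neighborSet, graph, SimpleGraph.fromRel_adj]
  have hb : (!Nat.beq v u) = true ↔ v ≠ (u : ℕ) := by
    rw [Bool.not_eq_true', ← Bool.not_eq_true, Nat.beq_eq]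
  rw [hb, and_comm]
  simp [Fin.ext_iff]

theorem colour_iso {g h : EdgeList} (φ : g.graph ≃g h.graph) (k : ℕ) (v : Fin g.order) :
    g.colour k v = h.colour k (φ v) := by
  classical
  induction k generalizing v with
  | zero => rfl
  | succ k ih =>
    rw [colour_succ _ _ _ v.2, colour_succ _ _ _ (φ v).2, ih v, ← Equiv.sum_comp φ.toEquiv]
    congr 1
    refine Finset.sum_congr rfl fun u _ => ?_
    rw [indicator_apply, indicator_apply]
    refine if_congr ?_ (by rw [ih]; rfl) rfl
    exact (φ.map_adj_iff (v := v) (w := u)).symm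

/-- The sum of the colours of all vertices after `k` rounds of colour refinement. -/
def colourSum (g : EdgeList) (k : ℕ) : ℕ := ((List.range g.order).map (g.colour k)).sum

theorem colourSum_iso {g h : EdgeList} (φ : g.graph ≃g h.graph) (k : ℕ) :
    g.colourSum k = h.colourSum k := by
  have key : ∀ g : EdgeList, g.colourSum k = ∑ v : Fin g.order, g.colour k v := fun g => by
    rw [colourSum, ← List.sum_toFinset _ List.nodup_range, List.toFinset_range,
      Finset.sum_range]
  rw [key, key, ← Equiv.sum_comp φ.toEquiv]
  exact Finset.sum_congr rfl fun v _ => colour_iso φ k v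

/-- The list of all colours, computed round by round. -/
def colours (ns : List (List ℕ)) : ℕ → (List ℕ → ℕ) → ℕ
  | 0, c => c (ns.map fun _ => 1)
  | k + 1, c => colours ns k fun cs => forceList
      (List.zipWith (fun a l => a + (l.map fun u => cs.getD u 0 ^ 2).sum) cs ns) c

theorem colours_eq (g : EdgeList) (k : ℕ) (c : List ℕ → ℕ) :
    colours ((List.range g.order).map g.nbrs) k c = c ((List.range g.order).map (g.colour k)) := by
  induction k generalizing c with
  | zero => rw [colours, List.map_map]; rfl
  | succ k ih =>
    rw [colours, ih, forceList_eq, List.zipWith_map, List.zipWith_self]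
    congr 1
    refine List.map_congr_left fun v _ => ?_
    rw [colour]
    congr 2
    refine List.map_congr_left fun u hu => ?_
    have hlt : u < g.order := by
      have := (List.mem_filter.1 hu).1
      simpa using this
    simp [List.getD, hlt]

/-- An efficient form of `colourSum`. -/
def fastColourSum (g : EdgeList) (k : ℕ) : ℕ :=
  forceLists ((List.range g.order).map g.nbrs) fun ns => colours ns k List.sum

theorem fastColourSum_eq (g : EdgeList) (k : ℕ) : g.fastColourSum k = g.colourSum k := by
  rw [fastColourSum, forceLists_eq, colours_eq, colourSum]

/-- A boolean test that a list has no repetitions. -/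
def nodupb : List ℕ → Bool
  | [] => true
  | a :: l => l.all (fun b => !Nat.beq a b) && nodupb l

theorem nodup_of_nodupb {l : List ℕ} (h : nodupb l = true) : l.Nodup := by
  induction l with
  | nil => exact List.nodup_nil
  | cons a l ih =>
    rw [nodupb, Bool.and_eq_true, List.all_eq_true] at h
    refine List.nodup_cons.2 ⟨fun ha => ?_, ih h.2⟩
    simpa using h.1 a ha

/-- Four rounds of this refinement already give the 45 graphs distinct colour sums. -/
theorem nodupb_fastColourSum :
    forceList (obstructions.map fun g => g.fastColourSum 4) nodupb = true := by
  decide +kernel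

theorem pairwise_obstructions :
    obstructions.Pairwise fun H K => IsEmpty (H.graph ≃g K.graph) := by
  have h := nodup_of_nodupb ((forceList_eq _ _).symm.trans nodupb_fastColourSum)
  rw [List.Nodup, List.pairwise_map] at h
  refine h.imp fun {H K} hne => ⟨fun φ => hne ?_⟩
  rw [fastColourSum_eq, fastColourSum_eq, colourSum_iso φ]

end EdgeList

/-! ### Connectivity and contractible edges -/

section Connectivity

variable {V : Type*} {G : SimpleGraph V}

/-- The open neighbourhood of a vertex set. -/
def nb (G : SimpleGraph V) (J : Set V) : Set V := {v | v ∉ J ∧ ∃ u ∈ J, G.Adj u v}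

/-- No set of fewer than `k` vertices separates the graph. -/
def KConnected (k : ℕ) (G : SimpleGraph V) : Prop :=
  ∀ J : Set V, J.Nonempty → (∃ v, v ∉ J ∧ v ∉ nb G J) → k ≤ (nb G J).ncard

theorem mem_or_mem_nb {J : Set V} {u v : V} (hu : u ∈ J) (huv : G.Adj u v) : v ∈ J ∨ v ∈ nb G J :=
  or_iff_not_imp_left.2 fun h => ⟨h, u, hu, huv⟩

theorem KConnected.not_nb_subset_pair [Finite V] (h : KConnected 3 G) {J : Set V}
    (hJ : J.Nonempty) {a b o : V} (ho : o ∉ J) (hoa : o ≠ a) (hob : o ≠ b) :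
    ¬ nb G J ⊆ {a, b} := fun hsub => by
  have h1 := h J hJ ⟨o, ho, fun h => by rcases hsub h with h | h <;> contradiction⟩
  have h2 := (ncard_le_ncard hsub).trans (ncard_insert_le a {b})
  rw [ncard_singleton] at h2
  omega

/-- No vertex of a separating triple is superfluous: without `c` the set `J` would be cut off by two
vertices. -/
theorem KConnected.mem_nb_of_subset_triple [Finite V] (h : KConnected 3 G) {J : Set V}
    (hJ : J.Nonempty) {a b c o : V} (ho : o ∉ J) (hoa : o ≠ a) (hob : o ≠ b)
    (hsub : nb G J ⊆ {a, b, c}) : c ∈ nb G J := by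
  by_contra hc
  refine h.not_nb_subset_pair hJ ho hoa hob fun v hv => ?_
  rcases hsub hv with h | h | h
  · exact Or.inl h
  · exact Or.inr h
  · exact (hc (h ▸ hv)).elim

/-- Contract the edge `xy`, keeping the name `x` for the new vertex. -/
def contractEdge (G : SimpleGraph V) (x y : V) : SimpleGraph {v // v ≠ y} where
  Adj u v := u ≠ v ∧ (G.Adj u v ∨ ((u : V) = x ∧ G.Adj y v) ∨ ((v : V) = x ∧ G.Adj y u))
  symm := ⟨fun u v h => ⟨h.1.symm, by
    rcases h.2 with h | h | h
    exacts [Or.inl h.symm, Or.inr (Or.inr h), Or.inr (Or.inl h)]⟩⟩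
  loopless := ⟨fun _ h => h.1 rfl⟩

/-- A small separator of the contracted graph must contain the merged vertex, since otherwise it
already separates `G`. Undoing the contraction turns it into `x`, `y` and at most one further
vertex. -/
theorem exists_separation_of_not_contractible [Finite V] (h3 : KConnected 3 G) {x y : V}
    (hxy : G.Adj x y) (h : ¬ KConnected 3 (contractEdge G x y)) :
    ∃ (q : V) (C : Set V), C.Nonempty ∧ x ∉ C ∧ y ∉ C ∧ nb G C ⊆ {x, y, q} ∧
      ∃ o, o ∉ C ∧ o ≠ x ∧ o ≠ y ∧ o ≠ q := by
  unfold KConnected at h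
  push Not at h
  obtain ⟨J, ⟨j, hj⟩, ⟨o, hoJ, hon⟩, hlt⟩ := h
  let x' : {v // v ≠ y} := ⟨x, hxy.ne⟩
  set N := nb (contractEdge G x y) J with hN
  let C : Set V := Subtype.val '' J
  have hyC : y ∉ C := by rintro ⟨v, -, hv⟩; exact v.2 hv
  have hNcard : (Subtype.val '' N : Set V).ncard ≤ 2 := by
    have := ncard_image_le (f := Subtype.val) N.toFinite
    omega
  have hoC : (o : V) ∉ C := by rintro ⟨v, hv, h⟩; exact hoJ (Subtype.ext h ▸ hv)
  have hoN : (o : V) ∉ (Subtype.val '' N : Set V) := by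
    rintro ⟨v, hv, h⟩; exact hon (Subtype.ext h ▸ hv)
  -- If the merged vertex lies inside `J`, adding `y` back to `J` creates no new neighbours,
  -- contradicting 3-connectivity of `G`.
  by_cases hxJ : x' ∈ J
  · exfalso
    have hsub : nb G (C ∪ {y}) ⊆ Subtype.val '' N := by
      rintro v ⟨hv, u, hu, huv⟩
      have hvy : v ≠ y := fun h => hv (Or.inr h)
      have hvJ : (⟨v, hvy⟩ : {v // v ≠ y}) ∉ J := fun h => hv (Or.inl ⟨_, h, rfl⟩)
      refine ⟨⟨v, hvy⟩, ⟨hvJ, ?_⟩, rfl⟩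
      rcases hu with ⟨u', hu', rfl⟩ | rfl
      · exact ⟨u', hu', fun h => hvJ (h ▸ hu'), Or.inl huv⟩
      · exact ⟨x', hxJ, fun h => hvJ (h ▸ hxJ), Or.inr (Or.inl ⟨rfl, huv⟩)⟩
    have h1 := h3 (C ∪ {y}) ⟨y, Or.inr rfl⟩ ⟨o, by simp [hoC, o.2], fun h => hoN (hsub h)⟩
    have h2 := ncard_le_ncard hsub
    omega
  have hxC : x ∉ C := by rintro ⟨v, hv, h⟩; exact hxJ ((Subtype.ext h : v = x') ▸ hv)
  have hCN : ∀ v ∈ nb G C, ∀ h : v ≠ y, (⟨v, h⟩ : {v // v ≠ y}) ∈ N := by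
    rintro v ⟨hv, _, ⟨u', hu', rfl⟩, huv⟩ hvy
    have hvJ : (⟨v, hvy⟩ : {v // v ≠ y}) ∉ J := fun h => hv ⟨_, h, rfl⟩
    exact ⟨hvJ, u', hu', fun h => hvJ (h ▸ hu'), Or.inl huv⟩
  by_cases hxN : x' ∈ N
  · obtain ⟨q, hq⟩ : ∃ q, N ⊆ {x', q} := by
      have h1 : (N \ {x'}).ncard ≤ 1 := by
        have := ncard_sdiff_singleton_add_one hxN
        omega
      rcases (ncard_le_one_iff_eq).1 h1 with h1 | ⟨q, h1⟩
      · exact ⟨x', by rw [sdiff_eq_empty] at h1; simpa using h1⟩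
      · refine ⟨q, fun v hv => ?_⟩
        by_cases hvx : v = x'
        · exact Or.inl hvx
        · have : v ∈ N \ {x'} := ⟨hv, hvx⟩
          rw [h1] at this
          exact Or.inr this
    by_cases hqN : q ∈ N
    · refine ⟨q, C, ⟨_, j, hj, rfl⟩, hxC, hyC, fun v hv => ?_, o, hoC, ?_, o.2, ?_⟩
      · by_cases hvy : v = y
        · exact Or.inr (Or.inl hvy)
        · rcases hq (hCN v hv hvy) with h | h
          · exact Or.inl (congrArg Subtype.val h)
          · exact Or.inr (Or.inr (congrArg Subtype.val h))
      · exact fun h => hon ((Subtype.ext h : o = x') ▸ hxN)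
      · exact fun h => hon ((Subtype.ext h : o = q) ▸ hqN)
    -- Here the merged vertex is the whole separator, and `x` serves again as a dummy third vertex.
    · refine ⟨x, C, ⟨_, j, hj, rfl⟩, hxC, hyC, fun v hv => ?_, o, hoC, ?_, o.2, ?_⟩
      · by_cases hvy : v = y
        · exact Or.inr (Or.inl hvy)
        · rcases hq (hCN v hv hvy) with h | h
          · exact Or.inl (congrArg Subtype.val h)
          · exact (hqN (h ▸ hCN v hv hvy)).elim
      all_goals exact fun h => hon ((Subtype.ext h : o = x') ▸ hxN)
  · exfalso
    have hsub : nb G C ⊆ Subtype.val '' N := by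
      intro v hv
      by_cases hvy : v = y
      · obtain ⟨hv, _, ⟨u', hu', rfl⟩, huv⟩ := hv
        exact (hxN ⟨hxJ, u', hu', fun h => hxJ (h ▸ hu'),
          Or.inr (Or.inr ⟨rfl, hvy ▸ huv.symm⟩)⟩).elim
      · exact ⟨_, hCN v hv hvy, rfl⟩
    have h1 := h3 C ⟨_, j, hj, rfl⟩ ⟨o, hoC, fun h => hoN (hsub h)⟩
    have h2 := ncard_le_ncard hsub
    omega

/-- If no edge is contractible, every edge `xy` lies in a separating triple `{x, y, q}` with a side
`C`. Descent on `C.ncard`: for a neighbour `v` of `q` in `C`, the edge `qv` lies in a separating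
triple with a side properly inside `C`. No lower bound on the order is needed, because `KConnected`
holds vacuously for complete graphs. -/
theorem KConnected.exists_contractible [Finite V] (h3 : KConnected 3 G) {u v : V}
    (huv : G.Adj u v) : ∃ x y, G.Adj x y ∧ KConnected 3 (contractEdge G x y) := by
  by_contra! hcon
  have key : ∀ n, ∀ (x y q : V) (C : Set V), C.ncard = n → G.Adj x y → C.Nonempty → x ∉ C →
      y ∉ C → nb G C ⊆ {x, y, q} → (∃ o, o ∉ C ∧ o ≠ x ∧ o ≠ y ∧ o ≠ q) → False := by
    intro n
    induction n using Nat.strong_induction_on with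
    | _ n ih =>
    rintro x y q C rfl hxy hC hxC hyC hsub ⟨o, hoC, hox, hoy, hoq⟩
    obtain ⟨hqC, v, hvC, hvq⟩ := h3.mem_nb_of_subset_triple hC hoC hox hoy hsub
    obtain ⟨r, D, hD, hqD, hvD, hDsub, o', ho'D, ho'q, ho'v, ho'r⟩ :=
      exists_separation_of_not_contractible h3 hvq.symm (hcon _ _ hvq.symm)
    have hrD := (h3.mem_nb_of_subset_triple hD ho'D ho'q ho'v hDsub).1
    -- As `x` and `y` are adjacent, they cannot lie strictly on different sides of `{q, v, r}`; so
    -- one of the two sides avoids both.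
    obtain ⟨E, hE, hxE, hyE, hqE, hvE, hEsub, o'', ho''E, ho''q, ho''v, ho''r⟩ : ∃ E : Set V,
        E.Nonempty ∧ x ∉ E ∧ y ∉ E ∧ q ∉ E ∧ v ∉ E ∧ nb G E ⊆ {q, v, r} ∧
        ∃ o, o ∉ E ∧ o ≠ q ∧ o ≠ v ∧ o ≠ r := by
      by_cases hxyD : x ∉ D ∧ y ∉ D
      · exact ⟨D, hD, hxyD.1, hxyD.2, hqD, hvD, hDsub, o', ho'D, ho'q, ho'v, ho'r⟩
      · obtain ⟨d, hd⟩ := hD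
        have hmem : ∀ {s t}, G.Adj s t → s ∈ D → t ∈ D ∪ {q, v, r} := fun hst hs =>
          (mem_or_mem_nb hs hst).imp id fun h => hDsub h
        have hx : x ∈ D ∪ {q, v, r} := by
          by_cases hxD : x ∈ D
          · exact Or.inl hxD
          · exact hmem hxy.symm (by tauto)
        have hy : y ∈ D ∪ {q, v, r} := by
          by_cases hyD : y ∈ D
          · exact Or.inl hyD
          · exact hmem hxy (by tauto)
        refine ⟨(D ∪ {q, v, r})ᶜ, ⟨o', by simp [ho'D, ho'q, ho'v, ho'r]⟩, not_not.2 hx,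
          not_not.2 hy, by simp, by simp, ?_, d, not_not.2 (Or.inl hd),
          fun h => hqD (h ▸ hd), fun h => hvD (h ▸ hd), fun h => hrD (h ▸ hd)⟩
        rintro w ⟨hw, s, hs, hsw⟩
        rcases not_not.1 hw with hw | hw
        · exact (hs (hmem hsw.symm hw)).elim
        · exact hw
    have hrE := (h3.mem_nb_of_subset_triple hE ho''E ho''q ho''v hEsub).1
    obtain ⟨-, s, hsE, hsv⟩ : v ∈ nb G E := h3.mem_nb_of_subset_triple hE ho''E ho''q ho''r
      (hEsub.trans fun w => by simp only [mem_insert_iff, mem_singleton_iff]; tauto)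
    -- The neighbours of `C` are among `x`, `y`, `q`, none of which is in `E`.
    have hCE : ∀ t ∈ E, ∀ c ∈ C, G.Adj c t → t ∈ C := by
      intro t ht c hc hct
      rcases mem_or_mem_nb hc hct with h | h
      · exact h
      · rcases hsub h with rfl | rfl | rfl <;> contradiction
    have hsC : s ∈ C := hCE s hsE v hvC hsv.symm
    -- Otherwise `E \ C` is nonempty and has no edge to `v`, which lies in `C`; then the two
    -- vertices `q` and `r` cut it off. The inclusion is proper because `v` is not in `E`.
    have hEC : E ⊆ C := by
      by_contra hEC
      obtain ⟨t, htE, htC⟩ := not_subset.1 hEC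
      refine h3.not_nb_subset_pair (J := E \ C) ⟨t, htE, htC⟩ (a := q) (b := r) (o := s)
        (fun h => h.2 hsC) (fun h => hqE (h ▸ hsE)) (fun h => hrE (h ▸ hsE)) ?_
      rintro w ⟨hw, p, ⟨hpE, hpC⟩, hpw⟩
      have hwC : w ∉ C := fun hwC => hpC (hCE p hpE w hwC hpw.symm)
      have hwE : w ∉ E := fun hwE => hw ⟨hwE, hwC⟩
      rcases hEsub ⟨hwE, p, hpE, hpw⟩ with h | h | h
      · exact Or.inl h
      · exact (hwC (h ▸ hvC)).elim
      · exact Or.inr h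
    exact ih _ (ncard_lt_ncard ((ssubset_iff_of_subset hEC).2 ⟨v, hvC, hvE⟩) (toFinite _))
      q v r E rfl hvq.symm hE hqE hvE hEsub ⟨o'', ho''E, ho''q, ho''v, ho''r⟩
  obtain ⟨q, C, h1, h2, hv, h4, h5⟩ := exists_separation_of_not_contractible h3 huv (hcon _ _ huv)
  exact key _ u v q C rfl huv h1 h2 hv h4 h5

/-- In a 3-connected graph on at least four vertices all degrees are at least three. -/
theorem KConnected.three_le_degree [Finite V] (h3 : KConnected 3 G) (hV : 4 ≤ Nat.card V) (v : V) :
    3 ≤ (G.neighborSet v).ncard := by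
  have hnb : nb G {v} = G.neighborSet v := by
    ext w
    simp only [nb, mem_singleton_iff, exists_eq_left, mem_ofPred_eq, SimpleGraph.mem_neighborSet]
    exact ⟨fun h => h.2, fun h => ⟨h.ne', h⟩⟩
  by_cases h : ∃ w, w ∉ ({v} : Set V) ∧ w ∉ nb G {v}
  · rw [← hnb]; exact h3 _ (singleton_nonempty v) h
  · push Not at h
    have : ({v}ᶜ : Set V) ⊆ G.neighborSet v := fun w hw => hnb ▸ h w hw
    have h1 := ncard_le_ncard this
    have h2 := ncard_add_ncard_compl ({v} : Set V)
    rw [ncard_singleton] at h2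
    omega

end Connectivity

/-! ### Composition of minors and contraction. -/

section Minor

theorem IsMinor.trans {A B C : Type*} {F : SimpleGraph A} {H : SimpleGraph B} {G : SimpleGraph C}
    (h1 : IsMinor F H) (h2 : IsMinor H G) : IsMinor F G := by
  obtain ⟨P, hPc, hPd, hPa⟩ := h1
  obtain ⟨Q, hQc, hQd, hQa⟩ := h2
  have hQc' := fun w => connSet_of_induce_connected (hQc w)
  refine ⟨fun a => ⋃ b ∈ P a, Q b, fun a => ?_, fun a a' haa' => ?_, fun a a' h => ?_⟩
  · obtain ⟨⟨b, hb⟩, hP⟩ := connSet_of_induce_connected (hPc a)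
    refine ConnSet.induce_connected ⟨?_, fun T hT ⟨t, ht⟩ hc => hT.antisymm ?_⟩
    · obtain ⟨x, hx⟩ := (hQc' b).1
      exact ⟨x, mem_biUnion hb hx⟩
    have hfull : ∀ b ∈ P a, (T ∩ Q b).Nonempty → Q b ⊆ T := fun b hb hne => by
      rw [← (hQc' b).2 (T ∩ Q b) inter_subset_right hne
        fun u hu v hv huv => ⟨hc u hu.1 v (mem_biUnion hb hv) huv, hv⟩]
      exact inter_subset_left
    have hall := hP {b ∈ P a | Q b ⊆ T} (fun b hb => hb.1) (by
        obtain ⟨b, hb, htb⟩ := mem_iUnion₂.1 (hT ht)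
        exact ⟨b, hb, hfull b hb ⟨t, ht, htb⟩⟩)
      (fun b hb b' hb' hbb' => ⟨hb', hfull b' hb' (by
        obtain ⟨x, hx, y, hy, hxy⟩ := hQa b b' hbb'
        exact ⟨y, hc x (hb.2 hx) y (mem_biUnion hb' hy) hxy, hy⟩)⟩)
    refine iUnion₂_subset fun b hb => ?_
    rw [← hall] at hb
    exact hb.2
  · simp only [disjoint_iUnion_left, disjoint_iUnion_right]
    exact fun b hb b' hb' => hQd _ _ fun h => (hPd a a' haa').le_bot ⟨hb', h ▸ hb⟩
  · obtain ⟨b, hb, b', hb', hbb'⟩ := hPa a a' h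
    obtain ⟨x, hx, y, hy, hxy⟩ := hQa b b' hbb'
    exact ⟨x, mem_biUnion hb hx, y, mem_biUnion hb' hy, hxy⟩

theorem isMinor_contractEdge {V : Type*} {G : SimpleGraph V} {x y : V} (hxy : G.Adj x y) :
    IsMinor (contractEdge G x y) G := by
  refine ⟨fun v => {w | w = v ∨ ((v : V) = x ∧ w = y)}, fun v => ?_, fun v w hvw => ?_,
    fun v w h => ?_⟩
  · refine ConnSet.induce_connected ?_
    by_cases hv : (v : V) = x
    · convert (connSet_singleton (G := G) x).union_of_adj (connSet_singleton y) rfl rfl hxy using 1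
      ext w; simp only [mem_ofPred_eq, hv, true_and, mem_union, mem_singleton_iff]
    · convert connSet_singleton (G := G) (v : V) using 1
      ext w; simp [hv]
  · rw [disjoint_left]
    rintro u (rfl | ⟨h, rfl⟩) (h' | ⟨h', h''⟩)
    · exact hvw (Subtype.ext h')
    · exact v.2 h''
    · exact w.2 h'.symm
    · exact hvw (Subtype.ext (h.trans h'.symm))
  · rcases h.2 with h | ⟨h1, h2⟩ | ⟨h1, h2⟩
    · exact ⟨v, Or.inl rfl, w, Or.inl rfl, h⟩
    · exact ⟨y, Or.inr ⟨h1, rfl⟩, w, Or.inl rfl, h2⟩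
    · exact ⟨v, Or.inl rfl, y, Or.inr ⟨h1, rfl⟩, h2.symm⟩

end Minor

/-! ### Labelled graphs as bit masks -/

/-- Bit `i` of `I`, in a form that evaluates quickly. -/
def bit (I i : ℕ) : Bool := Nat.beq (Nat.land (Nat.shiftRight I i) 1) 1

theorem bit_eq (I i : ℕ) : bit I i = I.testBit i := by
  have h : Nat.land (Nat.shiftRight I i) 1 = (I >>> i) % 2 := Nat.and_one_is_mod _
  rw [bit, h, Nat.testBit, Bool.eq_iff_iff, Nat.beq_eq, bne_iff_ne, Nat.and_comm,
    Nat.and_one_is_mod]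
  omega

/-- The code of the pair `uv` of vertices below eight with the label `k`. -/
def code (k u v : ℕ) : ℕ :=
  64 * k + if Nat.ble u v then 8 * u + v else 8 * v + u

theorem code_inj {k u v k' u' v' : ℕ} (hu : u < 8) (hv : v < 8) (hu' : u' < 8) (hv' : v' < 8)
    (h : code k u v = code k' u' v') : k = k' ∧ (u = u' ∧ v = v' ∨ u = v' ∧ v = u') := by
  unfold code at h
  split_ifs at h <;> omega

/-- The set of the members of a list, as a bit mask. -/
def maskOf (l : List ℕ) : ℕ := l.foldl (fun m c => Nat.lor m (2 ^ c)) 0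

theorem testBit_maskOf {l : List ℕ} {c : ℕ} : (maskOf l).testBit c = true ↔ c ∈ l := by
  have key : ∀ (l : List ℕ) (m : ℕ), (l.foldl (fun m c => Nat.lor m (2 ^ c)) m).testBit c = true ↔
      m.testBit c = true ∨ c ∈ l := by
    intro l
    induction l with
    | nil => simp
    | cons a l ih =>
      intro m
      have h : (Nat.lor m (2 ^ a)).testBit c = (m.testBit c || (2 ^ a).testBit c) :=
        Nat.testBit_or _ _ _
      rw [List.foldl_cons, ih, h, Bool.or_eq_true, Nat.testBit_two_pow, List.mem_cons,
        decide_eq_true_eq, or_assoc, eq_comm (a := a)]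
  rw [maskOf, key]
  simp

/-- Inclusion of bit masks. -/
def sub (m h : ℕ) : Bool := Nat.beq (Nat.land m h) m

theorem testBit_of_sub {m h c : ℕ} (hs : sub m h = true) (hc : m.testBit c = true) :
    h.testBit c = true := by
  rw [sub, Nat.beq_eq] at hs
  have hand : (Nat.land m h).testBit c = (m.testBit c && h.testBit c) := Nat.testBit_and _ _ _
  rw [hs, hc, Bool.true_and] at hand
  exact hand.symm

/-- Entry `i` of a list of numbers below eight that is coded by decimal digits, the last one
being the entry at `0`. -/
def digit (q i : ℕ) : ℕ := Nat.mod (Nat.div q (Nat.pow 10 i)) 10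

/-- The digits of `q` permute `0, …, n - 1`. -/
def isPerm (n q : ℕ) : Bool :=
  EdgeList.nodupb ((List.range n).map (digit q)) &&
    (List.range n).all fun i => Nat.blt (digit q i) n

theorem bijOn_digit {n q : ℕ} (h : isPerm n q = true) : BijOn (digit q) (Iio n) (Iio n) := by
  simp only [isPerm, Bool.and_eq_true, List.all_eq_true, Nat.blt_eq, List.mem_range] at h
  have hmaps : MapsTo (digit q) (Iio n) (Iio n) := fun i hi => h.2 i hi
  have hinj : InjOn (digit q) (Iio n) := fun i hi j hj hij =>
    List.inj_on_of_nodup_map (EdgeList.nodup_of_nodupb h.1) (List.mem_range.2 hi)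
      (List.mem_range.2 hj) hij
  refine ⟨hmaps, hinj, ?_⟩
  rw [← Finset.coe_range] at hmaps hinj ⊢
  exact Finset.surjOn_of_injOn_of_card_le _ hmaps hinj le_rfl

/-- A pattern is a list of edges `ab`, each with a label `k`, written `(k, a, b)`. -/
abbrev Pattern := List (ℕ × ℕ × ℕ)

/-- The image of a pattern under the permutations coded by `q` and `r`. -/
def patMask (pat : Pattern) (r q : ℕ) : ℕ :=
  maskOf (pat.map fun e => code e.1 (digit r (digit q e.2.1)) (digit r (digit q e.2.2)))

/-- The images of patterns under permutations. -/
def placements (certs : List (Pattern × ℕ)) (rs : List ℕ) : List ℕ :=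
  certs.flatMap fun c => rs.map fun r => patMask c.1 r c.2

/-- The codes in a list of permutations and patterns make sense. -/
def placementsOK (n : ℕ) (certs : List (Pattern × ℕ)) (rs : List ℕ) : Bool :=
  Nat.ble n 8 && (certs.all (fun c => isPerm n c.2 &&
    c.1.all fun e => Nat.blt e.2.1 n && Nat.blt e.2.2 n) && rs.all (isPerm n))

/-- The composition of two coded permutations. -/
def comp (r q : ℕ) : ℕ := (List.range 8).foldr (fun i m => 10 * m + digit r (digit q i)) 0

/-- All products of members of the given lists of coded permutations. -/
def products : List (List ℕ) → List ℕ
  | [] => [76543210]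
  | l :: ls => l.flatMap fun r => (products ls).map (comp r)

/-- A statement about labelled pairs of vertices, read off from its code. -/
def Holds (Sat : ℕ → ℕ → ℕ → Prop) (c : ℕ) : Prop :=
  ∀ k u v, u < 8 → v < 8 → c = code k u v → Sat k u v

/-- A computed mask is turned back into a bijection that preserves labels. Only the permutation
property of the codes matters here: the lists of automorphisms shorten the certificates, but
soundness never uses that they preserve a graph. -/
theorem exists_of_mem_placements {n : ℕ} {certs : List (Pattern × ℕ)} {rs : List ℕ} {m : ℕ}
    (hm : m ∈ placements certs rs) (hok : placementsOK n certs rs = true)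
    {Sat : ℕ → ℕ → ℕ → Prop} (h : ∀ c, m.testBit c = true → Holds Sat c) :
    ∃ c ∈ certs, ∃ f : ℕ → ℕ, BijOn f (Iio n) (Iio n) ∧
      ∀ e ∈ c.1, e.2.1 < n ∧ e.2.2 < n ∧ Sat e.1 (f e.2.1) (f e.2.2) := by
  simp only [placementsOK, Bool.and_eq_true, Nat.ble_eq, List.all_eq_true, Nat.blt_eq] at hok
  obtain ⟨hn, hcs, hrs⟩ := hok
  obtain ⟨c, hc, hm⟩ := List.mem_flatMap.1 hm
  obtain ⟨r, hr, rfl⟩ := List.mem_map.1 hm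
  have hbij := (bijOn_digit (hrs r hr)).comp (bijOn_digit (hcs c hc).1)
  refine ⟨c, hc, _, hbij, fun e he => ?_⟩
  obtain ⟨h1, h2⟩ := (hcs c hc).2 e he
  refine ⟨h1, h2, h _ (testBit_maskOf.2 (List.mem_map.2 ⟨e, he, rfl⟩)) _ _ _ ?_ ?_ rfl⟩
  · exact lt_of_lt_of_le (hbij.mapsTo h1) hn
  · exact lt_of_lt_of_le (hbij.mapsTo h2) hn

/-! ### Spanning subgraphs of 3-connected graphs -/

/-- The graph with edge list `g` is isomorphic to a spanning subgraph of `H`. -/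
def SpanIn (g : EdgeList) {W : Type*} (H : SimpleGraph W) : Prop :=
  ∃ φ : ℕ → W, BijOn φ (Iio g.order) univ ∧ ∀ e ∈ g.edges, H.Adj (φ e.1) (φ e.2)

theorem SpanIn.isMinor {g : EdgeList} {W : Type*} {H : SimpleGraph W} (h : SpanIn g H) :
    IsMinor g.graph H := by
  obtain ⟨φ, hφ, he⟩ := h
  refine ⟨fun i => {φ i}, fun i => (connSet_singleton _).induce_connected, fun i j hij => ?_,
    fun i j hij => ⟨_, rfl, _, rfl, ?_⟩⟩
  · rw [disjoint_singleton]
    exact fun h => hij (Fin.ext (hφ.injOn i.2 j.2 h))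
  · rcases ((SimpleGraph.fromRel_adj _ _ _).1 hij).2 with h | h
    exacts [he _ h, (he _ h).symm]

/-- The codes of the edges after splitting `z` into `z` and a new vertex `n` with further
neighbours `A` and `B`. -/
def splitCodes (es : List (ℕ × ℕ)) (n z : ℕ) (A B : List ℕ) : List ℕ :=
  code 0 z n :: (A.map (code 0 z) ++ (B.map (code 0 n) ++
    (es.filter fun e => !Nat.beq e.1 z && !Nat.beq e.2 z).map fun e => code 0 e.1 e.2))

/-- Membership in a list. -/
def elem (a : ℕ) (l : List ℕ) : Bool := l.any (Nat.beq a)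

theorem elem_iff {a : ℕ} {l : List ℕ} : elem a l = true ↔ a ∈ l := by
  simp [elem, Nat.beq_eq]

/-- The neighbours of `z` in the graph with edge list `es`. -/
def nbrsOf (es : List (ℕ × ℕ)) (z : ℕ) : List ℕ :=
  es.filterMap fun e => if Nat.beq e.1 z then some e.2 else if Nat.beq e.2 z then some e.1 else none

/-- All pairs from a list. -/
def pairsOf : List ℕ → List (List ℕ)
  | [] => []
  | a :: l => l.map (fun b => [a, b]) ++ pairsOf l

/-- The pairs of lists of neighbours that have to be considered when a vertex is split. -/
def splitLists (ns others : List ℕ) : List (List ℕ × List ℕ) :=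
  (pairsOf others).flatMap fun A =>
    force (List.length (ns.filter fun i => !elem i A)) fun d =>
    if Nat.ble 3 d then [(A, ns.filter fun i => !elem i A)]
    else ((pairsOf others).filter fun B => ns.all fun i => elem i A || elem i B).map fun B => (A, B)

/-- The edges of `g` as a pattern of edges of label zero. -/
def plainPattern (g : EdgeList) : Pattern := g.edges.map fun e => (0, e.1, e.2)

/-- Permutations of members of `Ts`, which are given by their positions. -/
def plainCerts (Ts : List EdgeList) (certs : List (ℕ × ℕ)) : List (Pattern × ℕ) :=
  certs.map fun c => (plainPattern (Ts.getD c.1 ⟨0, []⟩), c.2)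

/-- Every graph that arises from `g` by splitting a vertex contains one of the placements. -/
def splitCheck (g : EdgeList) (Ts : List EdgeList) (certs : List (ℕ × ℕ)) (rs : List ℕ) : Bool :=
  forceList (placements (plainCerts Ts certs) rs) fun ms => (List.range g.order).all fun z =>
    (splitLists (nbrsOf g.edges z) ((List.range g.order).filter fun i => !Nat.beq i z)).all
      fun AB => force (maskOf (splitCodes g.edges g.order z AB.1 AB.2)) fun h =>
        ms.any fun m => sub m h

/-- The data used in `splitCheck` are well-formed. -/
def splitOK (g : EdgeList) (Ts : List EdgeList) (certs : List (ℕ × ℕ)) (rs : List ℕ) : Bool :=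
  placementsOK (g.order + 1) (plainCerts Ts certs) rs &&
    (certs.all (fun c => Nat.blt c.1 Ts.length) &&
    (Ts.all (fun T => Nat.beq T.order (g.order + 1)) &&
    ((List.range g.order).all (fun z => Nat.ble (nbrsOf g.edges z).length 5) &&
      g.edges.all fun e => Nat.blt e.1 g.order && Nat.blt e.2 g.order)))

theorem mem_pairsOf {l : List ℕ} {a b : ℕ} (ha : a ∈ l) (hb : b ∈ l) (hab : a ≠ b) :
    [a, b] ∈ pairsOf l ∨ [b, a] ∈ pairsOf l := by
  induction l with
  | nil => simp at ha
  | cons c l ih =>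
    simp only [pairsOf, List.mem_append, List.mem_map]
    rcases List.mem_cons.1 ha with hac | hac <;> rcases List.mem_cons.1 hb with hbc | hbc
    · exact (hab (hac.trans hbc.symm)).elim
    · exact Or.inl (Or.inl ⟨b, hbc, by rw [hac]⟩)
    · exact Or.inr (Or.inl ⟨a, hac, by rw [hbc]⟩)
    · exact (ih hac hbc).imp Or.inr Or.inr

theorem exists_mem_pairsOf {l L : List ℕ} {S : Set ℕ} (hS : ∀ i ∈ S, i ∈ l) (h2 : 2 ≤ S.ncard)
    (hL : ∀ i ∈ L, i ∈ S) (hlen : L.length ≤ 2) :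
    ∃ A ∈ pairsOf l, (∀ i ∈ A, i ∈ S) ∧ ∀ i ∈ L, i ∈ A := by
  have key : ∀ a ∈ S, ∀ b ∈ S, a ≠ b → (∀ i ∈ L, i = a ∨ i = b) →
      ∃ A ∈ pairsOf l, (∀ i ∈ A, i ∈ S) ∧ ∀ i ∈ L, i ∈ A := by
    intro a ha b hb hab h
    rcases mem_pairsOf (hS a ha) (hS b hb) hab with h' | h'
    · exact ⟨_, h', by simp [ha, hb], by simpa using h⟩
    · exact ⟨_, h', by simp [ha, hb], by simpa [or_comm] using h⟩
  have hother : ∀ a, ∃ b ∈ S, a ≠ b := fun a => by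
    obtain ⟨b, hb, hba⟩ := exists_ne_of_one_lt_ncard (s := S) (by omega) a
    exact ⟨b, hb, hba.symm⟩
  match L, hlen with
  | [], _ =>
    obtain ⟨a, ha, -⟩ := hother 0
    obtain ⟨b, hb, hab⟩ := hother a
    exact key a ha b hb hab (by simp)
  | [a], _ =>
    obtain ⟨b, hb, hab⟩ := hother a
    exact key a (hL a (by simp)) b hb hab (by simp)
  | [a, b], _ =>
    by_cases hab : a = b
    · obtain ⟨c, hc, hac⟩ := hother a
      exact key a (hL a (by simp)) c hc hac (by simp [hab])
    · exact key a (hL a (by simp)) b (hL b (by simp)) hab (by simp)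

/-- Let `S` and `T` be the neighbours of the two halves of a split vertex. Of at most five old
neighbours, one half has at most two private ones. Two neighbours of that half containing its
private ones form the first list; the other half then receives all the remaining old neighbours,
padded to a pair if there are fewer than three. -/
theorem exists_mem_splitLists {ns others : List ℕ} {S T : Set ℕ} (hS : ∀ i ∈ S, i ∈ others)
    (hT : ∀ i ∈ T, i ∈ others) (hS2 : 2 ≤ S.ncard) (hT2 : 2 ≤ T.ncard)
    (hns : ∀ i ∈ ns, i ∈ S ∨ i ∈ T) (hlen : ns.length ≤ 5) :
    ∃ AB ∈ splitLists ns others, ((∀ i ∈ AB.1, i ∈ S) ∧ ∀ i ∈ AB.2, i ∈ T) ∨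
      ((∀ i ∈ AB.1, i ∈ T) ∧ ∀ i ∈ AB.2, i ∈ S) := by
  classical
  have key : ∀ {S T : Set ℕ}, (∀ i ∈ S, i ∈ others) → (∀ i ∈ T, i ∈ others) → 2 ≤ S.ncard →
      2 ≤ T.ncard → (∀ i ∈ ns, i ∈ S ∨ i ∈ T) → (ns.filter fun i => i ∉ T).length ≤ 2 →
      ∃ AB ∈ splitLists ns others, (∀ i ∈ AB.1, i ∈ S) ∧ ∀ i ∈ AB.2, i ∈ T := by
    intro S T hS hT hS2 hT2 hns hle
    obtain ⟨A, hA, hAS, hAL⟩ := exists_mem_pairsOf hS hS2 (L := ns.filter fun i => i ∉ T)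
      (fun i hi => by
        simp only [List.mem_filter, decide_eq_true_eq] at hi
        exact (hns i hi.1).resolve_right hi.2) hle
    have hB : ∀ i ∈ ns.filter (fun i => !elem i A), i ∈ T := by
      intro i hi
      simp only [List.mem_filter, Bool.not_eq_true', ← Bool.not_eq_true, elem_iff] at hi
      by_contra hiT
      exact hi.2 (hAL i (by simp [hi.1, hiT]))
    by_cases h3 : 3 ≤ (ns.filter fun i => !elem i A).length
    · refine ⟨(A, ns.filter fun i => !elem i A), List.mem_flatMap.2 ⟨A, hA, ?_⟩, hAS, hB⟩
      rw [force_eq, if_pos (Nat.ble_eq_true_of_le h3)]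
      simp
    · obtain ⟨B, hB, hBT, hBL⟩ := exists_mem_pairsOf hT hT2 hB (by omega)
      refine ⟨(A, B), List.mem_flatMap.2 ⟨A, hA, ?_⟩, hAS, hBT⟩
      rw [force_eq, if_neg (fun h => h3 (Nat.le_of_ble_eq_true h))]
      refine List.mem_map.2 ⟨B, List.mem_filter.2 ⟨hB, ?_⟩, rfl⟩
      simp only [List.all_eq_true, Bool.or_eq_true, elem_iff]
      intro i hi
      by_cases hiA : i ∈ A
      · exact Or.inl hiA
      · exact Or.inr (hBL i (by
          simp only [List.mem_filter, Bool.not_eq_true', ← Bool.not_eq_true, elem_iff]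
          exact ⟨hi, hiA⟩))
  by_cases hle : (ns.filter fun i => i ∉ T).length ≤ 2
  · obtain ⟨AB, h1, h2⟩ := key hS hT hS2 hT2 hns hle
    exact ⟨AB, h1, Or.inl h2⟩
  · have h1 : (ns.filter fun i => i ∉ S).length ≤ (ns.filter fun i => i ∈ T).length := by
      simp only [← List.countP_eq_length_filter]
      exact List.countP_mono_left fun i hi h => by
        simp only [decide_eq_true_eq] at h ⊢
        exact (hns i hi).resolve_left h
    have h2 := List.length_eq_length_filter_add (l := ns) (fun i => decide (i ∈ T))
    have h3 : (ns.filter fun i => !decide (i ∈ T)) = ns.filter fun i => i ∉ T := by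
      congr 1; ext i; simp
    rw [h3] at h2
    obtain ⟨AB, h1, h2⟩ := key hT hS hT2 hS2 (fun i hi => (hns i hi).symm) (by omega)
    exact ⟨AB, h1, Or.inr h2⟩

theorem mem_nbrsOf {es : List (ℕ × ℕ)} {z i : ℕ} (h : i ∈ nbrsOf es z) :
    (z, i) ∈ es ∨ (i, z) ∈ es := by
  obtain ⟨⟨a, b⟩, he, h⟩ := List.mem_filterMap.1 h
  split_ifs at h with h1 h2
  · obtain rfl := Option.some_injective _ h
    obtain rfl := Nat.eq_of_beq_eq_true h1
    exact Or.inl he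
  · obtain rfl := Option.some_injective _ h
    obtain rfl := Nat.eq_of_beq_eq_true h2
    exact Or.inr he

/-- A placement of a member of `Ts` in the graph that arises by splitting the vertex `z`. -/
theorem spanIn_of_mem_splitLists {g : EdgeList} {Ts : List EdgeList} {certs : List (ℕ × ℕ)}
    {rs : List ℕ} (hchk : splitCheck g Ts certs rs = true) (hok : splitOK g Ts certs rs = true)
    {W : Type*} {H : SimpleGraph W} {φ : ℕ → W} (hφ : BijOn φ (Iio (g.order + 1)) univ) {z : ℕ}
    (hz : z < g.order) {A B : List ℕ} (hAB : (A, B) ∈ splitLists (nbrsOf g.edges z)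
      ((List.range g.order).filter fun i => !Nat.beq i z))
    (h0 : H.Adj (φ z) (φ g.order)) (hA : ∀ i ∈ A, i < g.order ∧ H.Adj (φ z) (φ i))
    (hB : ∀ i ∈ B, i < g.order ∧ H.Adj (φ g.order) (φ i))
    (he : ∀ e ∈ g.edges, e.1 ≠ z → e.2 ≠ z → H.Adj (φ e.1) (φ e.2)) : ∃ T ∈ Ts, SpanIn T H := by
  simp only [splitOK, Bool.and_eq_true, List.all_eq_true, Nat.blt_eq, Nat.beq_eq, Nat.ble_eq] at hok
  obtain ⟨hpl, hidx, hord, -, hlt⟩ := hok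
  have hn : g.order + 1 ≤ 8 := by
    simp only [placementsOK, Bool.and_eq_true, Nat.ble_eq] at hpl
    exact hpl.1
  rw [splitCheck, forceList_eq, List.all_eq_true] at hchk
  have h := List.all_eq_true.1 (hchk z (List.mem_range.2 hz)) _ hAB
  rw [force_eq, List.any_eq_true] at h
  obtain ⟨m, hm, hsub⟩ := h
  let Sat : ℕ → ℕ → ℕ → Prop := fun k u v => k = 0 → H.Adj (φ u) (φ v)
  have hcode : ∀ u v, u < 8 → v < 8 → H.Adj (φ u) (φ v) → Holds Sat (code 0 u v) := by
    intro u v hu hv huv k u' v' hu' hv' hc _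
    rcases (code_inj hu hv hu' hv' hc).2 with ⟨rfl, rfl⟩ | ⟨rfl, rfl⟩
    exacts [huv, huv.symm]
  obtain ⟨c, hc, f, hf, hpat⟩ := exists_of_mem_placements hm hpl (Sat := Sat) (by
    intro c hc
    have hc := testBit_maskOf.1 (testBit_of_sub hsub hc)
    simp only [splitCodes, List.mem_cons, List.mem_append, List.mem_map, List.mem_filter,
      Bool.and_eq_true, Bool.not_eq_true', ← Bool.not_eq_true, Nat.beq_eq] at hc
    rcases hc with rfl | ⟨a, ha, rfl⟩ | ⟨b, hb, rfl⟩ | ⟨e, ⟨he1, he2, he3⟩, rfl⟩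
    · exact hcode _ _ (by omega) (by omega) h0
    · exact hcode _ _ (by omega) (by have := (hA a ha).1; omega) (hA a ha).2
    · exact hcode _ _ (by omega) (by have := (hB b hb).1; omega) (hB b hb).2
    · have := hlt e he1
      exact hcode _ _ (by omega) (by omega) (he e he1 he2 he3))
  obtain ⟨i, hi, rfl⟩ := List.mem_map.1 hc
  have hT : Ts.getD i.1 ⟨0, []⟩ ∈ Ts := by
    rw [List.getD_eq_getElem _ _ (hidx i hi)]
    exact List.getElem_mem _
  refine ⟨_, hT, φ ∘ f, ?_, fun e he => ?_⟩
  · rw [hord _ hT]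
    exact hφ.comp hf
  · exact (hpat (0, e.1, e.2) (List.mem_map.2 ⟨e, he, rfl⟩)).2.2 rfl

/-- Undoing the contraction splits the vertex `z` of `g` that stands for the merged vertex: every
old neighbour goes to `x` or `y`, and all other edges persist. The check covers minimal choices of
neighbours, and further edges do no harm. -/
theorem SpanIn.of_contractEdge {g : EdgeList} {Ts : List EdgeList} {certs : List (ℕ × ℕ)}
    {rs : List ℕ} (hchk : splitCheck g Ts certs rs = true) (hok : splitOK g Ts certs rs = true)
    {W : Type*} [Finite W] {H : SimpleGraph W} (h3 : KConnected 3 H) (hW : 4 ≤ Nat.card W) {x y : W}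
    (hxy : H.Adj x y) (hs : SpanIn g (contractEdge H x y)) : ∃ T ∈ Ts, SpanIn T H := by
  classical
  obtain ⟨φ, hφ, he⟩ := hs
  have hok' := hok
  simp only [splitOK, Bool.and_eq_true, List.all_eq_true, Nat.blt_eq, Nat.beq_eq, Nat.ble_eq,
    List.mem_range] at hok'
  obtain ⟨-, -, -, hdeg, hlt⟩ := hok'
  set n := g.order with hn
  obtain ⟨z, hz, hzx⟩ := hφ.surjOn (mem_univ ⟨x, hxy.ne⟩)
  have hz : z < n := hz
  let ψ : ℕ → W := fun i => if i < n then φ i else y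
  have hψ : ∀ i, i < n → ψ i = φ i := fun i hi => if_pos hi
  have hψn : ψ n = y := if_neg (lt_irrefl n)
  have hψz : ψ z = x := by rw [hψ z hz, hzx]
  have hbij : BijOn ψ (Iio (n + 1)) univ := by
    refine ⟨fun _ _ => mem_univ _, fun i hi j hj hij => ?_, fun w _ => ?_⟩
    · rcases Nat.lt_succ_iff_lt_or_eq.1 hi with hi | rfl <;>
        rcases Nat.lt_succ_iff_lt_or_eq.1 hj with hj | rfl
      · rw [hψ i hi, hψ j hj] at hij
        exact hφ.injOn hi hj (Subtype.ext hij)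
      · rw [hψ i hi, hψn] at hij
        exact ((φ i).2 hij).elim
      · rw [hψ j hj, hψn] at hij
        exact ((φ j).2 hij.symm).elim
      · rfl
    · by_cases hw : w = y
      · exact ⟨n, Nat.lt_succ_self n, hψn.trans hw.symm⟩
      · obtain ⟨i, hi, hiw⟩ := hφ.surjOn (mem_univ ⟨w, hw⟩)
        exact ⟨i, Nat.lt_succ_of_lt hi, by rw [hψ i hi, hiw]⟩
  have hedge : ∀ e ∈ g.edges, e.1 ≠ z → e.2 ≠ z → H.Adj (ψ e.1) (ψ e.2) := by
    intro e hee h1 h2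
    obtain ⟨l1, l2⟩ := hlt e hee
    rw [hψ _ l1, hψ _ l2]
    have hne : ∀ i, i < n → i ≠ z → (φ i : W) ≠ x := fun i hi hiz h =>
      hiz (hφ.injOn hi hz ((Subtype.ext h : φ i = ⟨x, hxy.ne⟩).trans hzx.symm))
    rcases (he e hee).2 with h | h | h
    · exact h
    · exact (hne _ l1 h1 h.1).elim
    · exact (hne _ l2 h2 h.1).elim
  let S : W → Set ℕ := fun w => {i | i < n ∧ i ≠ z ∧ H.Adj w (ψ i)}
  -- Minimum degree three leaves each end of `xy` two neighbours apart from the other end.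
  have hS2 : ∀ w w', (w = x ∧ w' = y ∨ w = y ∧ w' = x) → 2 ≤ (S w).ncard := by
    intro w w' hww'
    have h1 : H.neighborSet w ⊆ insert w' (ψ '' S w) := by
      intro v hv
      by_cases hvw : v = w'
      · exact Or.inl hvw
      · obtain ⟨i, hi, rfl⟩ := hbij.surjOn (mem_univ v)
        have hadj : H.Adj w (ψ i) := hv
        refine Or.inr ⟨i, ⟨?_, ?_, hadj⟩, rfl⟩
        · rcases Nat.lt_succ_iff_lt_or_eq.1 hi with hi | rfl
          · exact hi
          · rw [hψn] at hvw hadj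
            rcases hww' with ⟨-, h⟩ | ⟨h, -⟩
            exacts [(hvw h.symm).elim, (hadj.ne h).elim]
        · rintro rfl
          rw [hψz] at hvw hadj
          rcases hww' with ⟨h, -⟩ | ⟨-, h⟩
          exacts [(hadj.ne h).elim, (hvw h.symm).elim]
    have h2 := ncard_le_ncard h1
    have h6 := ncard_insert_le w' (ψ '' S w)
    have h4 : (ψ '' S w).ncard ≤ (S w).ncard :=
      ncard_image_le ((finite_Iio n).subset fun i hi => hi.1)
    have h5 := h3.three_le_degree hW w
    omega
  have hothers : ∀ w, ∀ i ∈ S w, i ∈ (List.range n).filter fun i => !Nat.beq i z := by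
    rintro w i ⟨h1, h2, -⟩
    simp only [List.mem_filter, List.mem_range, Bool.not_eq_true', ← Bool.not_eq_true, Nat.beq_eq]
    exact ⟨h1, h2⟩
  have hns : ∀ i ∈ nbrsOf g.edges z, i ∈ S x ∨ i ∈ S y := by
    intro i hi
    have key : i < n ∧ (contractEdge H x y).Adj (φ z) (φ i) := by
      rcases mem_nbrsOf hi with h | h
      · exact ⟨(hlt _ h).2, he _ h⟩
      · exact ⟨(hlt _ h).1, (he _ h).symm⟩
    obtain ⟨hin, hne, hadj⟩ := key
    have hiz : i ≠ z := fun h => hne (by rw [h])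
    rw [hzx] at hadj
    simp only [S, mem_ofPred_eq, hψ i hin]
    rcases hadj with h | h | h
    · exact Or.inl ⟨hin, hiz, h⟩
    · exact Or.inr ⟨hin, hiz, h.2⟩
    · exact (hne (by rw [hzx]; exact Subtype.ext h.1.symm)).elim
  obtain ⟨⟨A, B⟩, hAB, ⟨hA, hB⟩ | ⟨hA, hB⟩⟩ := exists_mem_splitLists (hothers x) (hothers y)
    (hS2 x y (by simp)) (hS2 y x (by simp)) hns (hdeg z hz)
  · exact spanIn_of_mem_splitLists hchk hok hbij hz hAB (by rw [hψz, hψn]; exact hxy)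
      (fun i hi => ⟨(hA i hi).1, by rw [hψz]; exact (hA i hi).2.2⟩)
      (fun i hi => ⟨(hB i hi).1, by rw [hψn]; exact (hB i hi).2.2⟩) hedge
  -- The roles of `x` and `y` are exchanged by transposing `z` and the new vertex.
  · have hsw : ∀ i, i < n → i ≠ z → Equiv.swap z n i = i := fun i h1 h2 =>
      Equiv.swap_apply_of_ne_of_ne h2 h1.ne
    have hswb : BijOn (Equiv.swap z n) (Iio (n + 1)) (Iio (n + 1)) := by
      have hm : MapsTo (Equiv.swap z n) (Iio (n + 1)) (Iio (n + 1)) := by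
        intro i hi
        have hi : i < n + 1 := hi
        rw [Equiv.swap_apply_def]
        split_ifs <;> simp <;> omega
      exact ⟨hm, (Equiv.injective _).injOn, fun i hi => ⟨_, hm hi, by simp⟩⟩
    refine spanIn_of_mem_splitLists hchk hok (φ := ψ ∘ Equiv.swap z n) (hbij.comp hswb) hz hAB ?_
      (fun i hi => ⟨(hA i hi).1, ?_⟩) (fun i hi => ⟨(hB i hi).1, ?_⟩) fun e hee h1 h2 => ?_
    · simp only [Function.comp_apply, Equiv.swap_apply_left]
      rw [← hn, Equiv.swap_apply_right, hψz, hψn]; exact hxy.symm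
    · obtain ⟨a, b, c⟩ := hA i hi
      simp only [Function.comp_apply, Equiv.swap_apply_left, hsw i a b, hψn]
      exact c
    · obtain ⟨a, b, c⟩ := hB i hi
      simp only [Function.comp_apply, hsw i a b]
      rw [← hn, Equiv.swap_apply_right, hψz]; exact c
    · obtain ⟨l1, l2⟩ := hlt e hee
      simp only [Function.comp_apply, hsw _ l1 h1, hsw _ l2 h2]
      exact hedge e hee h1 h2

/-- Automorphisms of `K₄`. -/
def k4Autos : List ℕ := products [[76543210, 76540321, 76541032, 76542103],
  [76543210, 76543021, 76543102], [76543210, 76543201]]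

/-- Automorphisms of the wheel on five vertices. -/
def w5Autos : List ℕ := products [[76543210, 76514320, 76521430, 76532140],
  [76543210, 76523410]]

/-- Automorphisms of `K₃,₃`. -/
def k33Autos : List ℕ := products [[76543210, 76543021, 76543102],
  [76543210, 76354210, 76435210], [76543210, 76210543], [76543210, 76543201],
  [76543210, 76534210]]

/-- Automorphisms of the prism. -/
def prismAutos : List ℕ := products [[76543210, 76354021, 76435102],
  [76543210, 76534201], [76543210, 76210543]]

/-- Automorphisms of the wheel on six vertices. -/
def w6Autos : List ℕ := products [[76543210, 76154320, 76215430, 76321540, 76432150],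
  [76543210, 76234510]]

/-- Graphs contained in the graphs that arise from `K₄` by splitting a vertex. -/
def k4Splits : List (ℕ × ℕ) :=
  [(0, 76543210)]

theorem splitCheck_k4 :
    splitCheck EdgeList.k4 [EdgeList.w5] k4Splits k4Autos = true := by
  decide +kernel

theorem splitOK_k4 :
    splitOK EdgeList.k4 [EdgeList.w5] k4Splits k4Autos = true := by
  decide +kernel

/-- Graphs contained in the graphs that arise from the wheel on five vertices by splitting a
vertex. -/
def w5Splits : List (ℕ × ℕ) :=
  [(1, 76345210), (1, 76543210), (1, 76423510), (0, 76542310), (0, 76432510),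
   (2, 76543210)]

theorem splitCheck_w5 :
    splitCheck EdgeList.w5 [EdgeList.k33, EdgeList.prism, EdgeList.w6] w5Splits w5Autos = true := by
  decide +kernel

theorem splitOK_w5 :
    splitOK EdgeList.w5 [EdgeList.k33, EdgeList.prism, EdgeList.w6] w5Splits w5Autos = true := by
  decide +kernel

/-- Graphs contained in the graphs that arise from `K₃,₃` by splitting a vertex. -/
def k33Splits : List (ℕ × ℕ) :=
  [(1, 75463210), (1, 75432610), (4, 75432610)]

theorem splitCheck_k33 :
    splitCheck EdgeList.k33 EdgeList.obs3 k33Splits k33Autos = true := by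
  decide +kernel

theorem splitOK_k33 :
    splitOK EdgeList.k33 EdgeList.obs3 k33Splits k33Autos = true := by
  decide +kernel

/-- Graphs contained in the graphs that arise from the prism by splitting a vertex. -/
def prismSplits : List (ℕ × ℕ) :=
  [(0, 71653240), (0, 71365240), (1, 75312640), (2, 73621540), (2, 73152640),
   (1, 76312540), (1, 75234106), (2, 73126540)]

theorem splitCheck_prism :
    splitCheck EdgeList.prism EdgeList.obs3 prismSplits prismAutos = true := by
  decide +kernel

theorem splitOK_prism :
    splitOK EdgeList.prism EdgeList.obs3 prismSplits prismAutos = true := by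
  decide +kernel

/-- Graphs contained in the graphs that arise from the wheel on six vertices by splitting a
vertex. -/
def w6Splits : List (ℕ × ℕ) :=
  [(0, 76534210), (1, 76254310), (1, 75423610), (2, 76534210), (2, 72564310),
   (2, 75243610), (0, 73465210), (0, 72564310), (1, 72054316), (2, 70534216),
   (3, 76543210)]

theorem splitCheck_w6 :
    splitCheck EdgeList.w6 EdgeList.obs3 w6Splits w6Autos = true := by
  decide +kernel

theorem splitOK_w6 :
    splitOK EdgeList.w6 EdgeList.obs3 w6Splits w6Autos = true := by
  decide +kernel

/-! ### Small spanning subgraphs of 3-connected graphs. -/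

section Chain

variable {W : Type*} [Finite W] {H : SimpleGraph W}

theorem KConnected.exists_adj (h3 : KConnected 3 H) (hW : 4 ≤ Nat.card W) : ∃ x y, H.Adj x y := by
  have : Nonempty W := Nat.card_pos_iff.1 (by omega) |>.1
  obtain ⟨x⟩ := this
  have h := h3.three_le_degree hW x
  obtain ⟨y, hy⟩ := (ncard_pos (toFinite _)).1 (show 0 < (H.neighborSet x).ncard by omega)
  exact ⟨x, y, hy⟩

theorem card_ne (y : W) : Nat.card {v // v ≠ y} + 1 = Nat.card W := by
  have h := ncard_add_ncard_compl ({y} : Set W)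
  rw [ncard_singleton, add_comm] at h
  exact h

/-- Minimum degree three on four vertices forces completeness. -/
theorem KConnected.spanIn_k4 (h3 : KConnected 3 H) (hW : Nat.card W = 4) :
    SpanIn EdgeList.k4 H := by
  obtain ⟨e⟩ := Finite.equivFinOfCardEq hW |> fun e => Nonempty.intro e
  have hadj : ∀ x y, x ≠ y → H.Adj x y := by
    intro x y hxy
    by_contra hn
    have h1 := h3.three_le_degree hW.ge x
    have h2 : H.neighborSet x ⊆ {x, y}ᶜ := by
      rintro v hv (rfl | rfl)
      exacts [H.loopless.irrefl _ hv, hn hv]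
    have h4 := ncard_le_ncard h2
    have h5 := ncard_add_ncard_compl ({x, y} : Set W)
    rw [ncard_pair hxy] at h5
    omega
  refine ⟨fun i => e.symm (Fin.ofNat 4 i), ⟨fun _ _ => mem_univ _, fun i hi j hj hij => ?_,
    fun w _ => ⟨e w, (e w).2, by simp⟩⟩, fun c hc => hadj _ _ fun h => ?_⟩
  · have := congrArg Fin.val (e.symm.injective hij)
    simp only [Fin.ofNat] at this
    have hi : i < 4 := hi
    have hj : j < 4 := hj
    rwa [Nat.mod_eq_of_lt hi, Nat.mod_eq_of_lt hj] at this
  · have := congrArg Fin.val (e.symm.injective h)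
    clear h
    revert this
    revert c
    decide

theorem KConnected.spanIn_w5 (h3 : KConnected 3 H) (hW : Nat.card W = 5) :
    SpanIn EdgeList.w5 H := by
  obtain ⟨_, _, h⟩ := h3.exists_adj (by omega)
  obtain ⟨x, y, hxy, hc⟩ := h3.exists_contractible h
  have := card_ne y
  obtain ⟨T, hT, hs⟩ := (hc.spanIn_k4 (by omega)).of_contractEdge splitCheck_k4 splitOK_k4 h3
    (by omega) hxy
  rwa [List.mem_singleton.1 hT] at hs

theorem KConnected.spanIn_six (h3 : KConnected 3 H) (hW : Nat.card W = 6) :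
    SpanIn EdgeList.k33 H ∨ SpanIn EdgeList.prism H ∨ SpanIn EdgeList.w6 H := by
  obtain ⟨_, _, h⟩ := h3.exists_adj (by omega)
  obtain ⟨x, y, hxy, hc⟩ := h3.exists_contractible h
  have := card_ne y
  obtain ⟨T, hT, hs⟩ := (hc.spanIn_w5 (by omega)).of_contractEdge splitCheck_w5 splitOK_w5 h3
    (by omega) hxy
  simp only [List.mem_cons, List.not_mem_nil, or_false] at hT
  rcases hT with rfl | rfl | rfl
  exacts [Or.inl hs, Or.inr (Or.inl hs), Or.inr (Or.inr hs)]

/-- A 3-connected graph with at least seven vertices has one of the edge-minimal 3-connected graphs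
on seven vertices as a minor. -/
theorem KConnected.exists_isMinor_obs3 (h3 : KConnected 3 H) (hW : 7 ≤ Nat.card W) :
    ∃ T ∈ EdgeList.obs3, IsMinor T.graph H := by
  obtain ⟨n, hn⟩ : ∃ n, Nat.card W = n + 7 := ⟨Nat.card W - 7, by omega⟩
  induction n generalizing W with
  | zero =>
    obtain ⟨_, _, h⟩ := h3.exists_adj (by omega)
    obtain ⟨x, y, hxy, hc⟩ := h3.exists_contractible h
    have := card_ne y
    suffices h : ∃ T ∈ EdgeList.obs3, SpanIn T H from h.imp fun T hT => ⟨hT.1, hT.2.isMinor⟩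
    rcases hc.spanIn_six (by omega) with hs | hs | hs
    · exact hs.of_contractEdge splitCheck_k33 splitOK_k33 h3 (by omega) hxy
    · exact hs.of_contractEdge splitCheck_prism splitOK_prism h3 (by omega) hxy
    · exact hs.of_contractEdge splitCheck_w6 splitOK_w6 h3 (by omega) hxy
  | succ n ih =>
    obtain ⟨_, _, h⟩ := h3.exists_adj (by omega)
    obtain ⟨x, y, hxy, hc⟩ := h3.exists_contractible h
    have := card_ne y
    obtain ⟨T, hT, hm⟩ := ih hc (by omega) (by omega)
    exact ⟨T, hT, hm.trans (isMinor_contractEdge hxy)⟩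

end Chain

/-! ### Marked edges

A mark is an edge of a 3-connected graph at which a part of the graph is attached. -/

/-- All sublists of length `k`. -/
def chooseList : ℕ → List ℕ → List (List ℕ)
  | 0, _ => [[]]
  | _ + 1, [] => []
  | k + 1, a :: l => (chooseList k l).map (a :: ·) ++ chooseList (k + 1) l

theorem sublist_of_mem_chooseList {k : ℕ} {l s : List ℕ} (h : s ∈ chooseList k l) :
    s.length = k ∧ s.Sublist l := by
  induction l generalizing k s with
  | nil => cases k <;> simp_all [chooseList]
  | cons a l ih =>
    cases k with
    | zero => simp_all [chooseList]
    | succ k =>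
      rcases List.mem_append.1 h with h | h
      · obtain ⟨t, ht, rfl⟩ := List.mem_map.1 h
        exact ⟨by simp [(ih ht).1], (ih ht).2.cons_cons a⟩
      · exact ⟨(ih h).1, (ih h).2.cons a⟩

/-- The codes of the pairs of vertices below `n`. -/
def pairCodes (n : ℕ) : List ℕ :=
  (List.range n).flatMap fun v => (List.range v).map fun u => 8 * u + v

theorem mem_pairCodes {n c : ℕ} : c ∈ pairCodes n ↔ ∃ u v, u < v ∧ v < n ∧ c = 8 * u + v := by
  simp only [pairCodes, List.mem_flatMap, List.mem_range, List.mem_map]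
  constructor
  · rintro ⟨v, hv, u, hu, rfl⟩
    exact ⟨u, v, hu, hv, rfl⟩
  · rintro ⟨u, v, hu, hv, rfl⟩
    exact ⟨v, hv, u, hu, rfl⟩

theorem nodup_pairCodes : ∀ n ≤ 8, (pairCodes n).Nodup := by
  decide +kernel

/-- The vertices below `n` that are on none of the pairs with codes in `l`. -/
def uncovered (n : ℕ) (l : List ℕ) : List ℕ :=
  (List.range n).filter fun i => l.all fun c =>
    !Nat.beq (Nat.shiftRight c 3) i && !Nat.beq (Nat.land c 7) i

theorem mem_uncovered {n : ℕ} {l : List ℕ} {i : ℕ} (hi : i < n) (hn : n ≤ 8)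
    (hl : ∀ c ∈ l, c ∈ pairCodes n) :
    i ∈ uncovered n l ∨ ∃ u v, u < v ∧ v < n ∧ 8 * u + v ∈ l ∧ (i = u ∨ i = v) := by
  by_contra! h
  refine h.1 (List.mem_filter.2 ⟨List.mem_range.2 hi, ?_⟩)
  simp only [List.all_eq_true, Bool.and_eq_true, Bool.not_eq_true', ← Bool.not_eq_true, Nat.beq_eq]
  intro c hc
  obtain ⟨u, v, huv, hv, rfl⟩ := mem_pairCodes.1 (hl c hc)
  have h1 : Nat.shiftRight (8 * u + v) 3 = u := by
    change (8 * u + v) >>> 3 = u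
    rw [Nat.shiftRight_eq_div_pow]; omega
  have h2 : Nat.land (8 * u + v) 7 = v := by
    change (8 * u + v) &&& (2 ^ 3 - 1) = v
    rw [Nat.and_two_pow_sub_one_eq_mod]; omega
  rw [h1, h2]
  exact ⟨fun hb => (h.2 u v huv hv hc).1 hb.symm, fun hb => (h.2 u v huv hv hc).2 hb.symm⟩

/-- The sets of `k` pairs below `n` that leave `j` vertices uncovered, as bit masks. -/
def coverMasks (n k j : ℕ) : List ℕ :=
  ((chooseList k (pairCodes n)).filter fun l => Nat.beq (uncovered n l).length j).map maskOf

/-- Reveal a label. -/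
def addLabel (M c : ℕ) : ℕ := Nat.lor M (2 ^ c)

/-- Mark a pair. -/
def addMark (M c : ℕ) : ℕ := addLabel (addLabel M c) (64 + c)

/-- Given the marked pairs `E` and a mask `M` of the labels that are known to be present, either the
marked pairs can be covered by one of the masks `A`, or by one of the masks `B₀` (`B₁`) and
two (one) further pairs at which nothing large is attached, or a bad mask is present. -/
def solveMarks (A B₀ B₁ bads E : List ℕ) : ℕ → ℕ → Bool
  | 0, _ => false
  | k + 1, M => A.any (fun a => E.all (bit a)) || (bads.any (fun m => sub m M) ||
      (B₀.any (fun b => Nat.ble (E.filter fun c => !bit b c).length 2 &&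
          (E.filter fun c => !bit b c).all fun c => !bit M (128 + c) && (!bit M (192 + c) &&
            (force (addLabel M (128 + c)) (solveMarks A B₀ B₁ bads E k) &&
              force (addLabel M (192 + c)) (solveMarks A B₀ B₁ bads E k)))) ||
        B₁.any (fun b => Nat.ble (E.filter fun c => !bit b c).length 1 &&
          (E.filter fun c => !bit b c).all fun c => !bit M (128 + c) && (!bit M (192 + c) &&
            (force (addLabel M (128 + c)) (solveMarks A B₀ B₁ bads E k) &&
              force (addLabel M (192 + c)) (solveMarks A B₀ B₁ bads E k))))))

/-- Decide for each pair in a list whether it is marked, and solve each case. -/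
def exploreMarks (A B₀ B₁ : List ℕ) : List ℕ → List ℕ → List ℕ → ℕ → Bool
  -- The number five only bounds the recursion. Every recursive call of `solveMarks` records a
  -- series or parallel label at a pair that had neither.
  | [], bads, E, M => solveMarks A B₀ B₁ bads E 5 M
  -- At an unmarked pair no subdivided edge can be placed, so placements with labels `1`, `2` or `3`
  -- there are dropped. The branch for a marked pair also gains the plain label, since a part
  -- provides an edge of the torso.
  | c :: cs, bads, E, M => force (Nat.shiftLeft (2 ^ 64 + 2 ^ 128 + 2 ^ 192) c) (fun d =>
        forceList (bads.filter fun m => Nat.beq (Nat.land m d) 0) fun bads' =>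
          exploreMarks A B₀ B₁ cs bads' E M) &&
      force (addMark M c) fun M' => bads.any (fun m => sub m M') ||
        exploreMarks A B₀ B₁ cs bads (c :: E) M'

section Sound

variable {Q : Prop} {Mk Small : ℕ → Prop} {A B₀ B₁ : List ℕ} {n : ℕ}

theorem testBit_addLabel {M c i : ℕ} (h : (addLabel M c).testBit i = true) :
    M.testBit i = true ∨ i = c := by
  have h' : (Nat.lor M (2 ^ c)).testBit i = (M.testBit i || (2 ^ c).testBit i) :=
    Nat.testBit_or _ _ _
  rw [addLabel, h', Bool.or_eq_true, Nat.testBit_two_pow, decide_eq_true_eq] at h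
  exact h.imp_right Eq.symm

theorem testBit_addMark {M c i : ℕ} (h : (addMark M c).testBit i = true) :
    M.testBit i = true ∨ i = c ∨ i = 64 + c := by
  rcases testBit_addLabel h with h | h
  · exact (testBit_addLabel h).imp_right Or.inl
  · exact Or.inr (Or.inr h)

/-- Given a proposed cover, either all leftover parts are small and the cover is good, or some
leftover pair carries a series or parallel label. Recording that label and continuing ends with a
good cover or a forbidden placement. -/
theorem solveMarks_sound {E bads : List ℕ}
    (hA : ∀ a ∈ A, (∀ c ∈ E, a.testBit c = true) → Q)
    (hB₀ : ∀ b ∈ B₀, ∀ l : List ℕ, l.length ≤ 2 → (∀ c ∈ l, c ∈ E ∧ Small c) →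
      (∀ c ∈ E, b.testBit c = true ∨ c ∈ l) → Q)
    (hB₁ : ∀ b ∈ B₁, ∀ l : List ℕ, l.length ≤ 1 → (∀ c ∈ l, c ∈ E ∧ Small c) →
      (∀ c ∈ E, b.testBit c = true ∨ c ∈ l) → Q)
    (hbad : ∀ m ∈ bads, (∀ i, m.testBit i = true → Mk i) → Q)
    (hE : ∀ c ∈ E, Small c ∨ Mk (128 + c) ∨ Mk (192 + c)) (k M : ℕ)
    (hM : ∀ i, M.testBit i = true → Mk i) (h : solveMarks A B₀ B₁ bads E k M = true) : Q := by
  induction k generalizing M with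
  | zero => simp [solveMarks] at h
  | succ k ih =>
    have key : ∀ b : ℕ, (∀ l : List ℕ, l = E.filter (fun c => !bit b c) →
        (∀ c ∈ l, c ∈ E ∧ Small c) → (∀ c ∈ E, b.testBit c = true ∨ c ∈ l) → Q) →
        ((E.filter fun c => !bit b c).all fun c => !bit M (128 + c) && (!bit M (192 + c) &&
            (force (addLabel M (128 + c)) (solveMarks A B₀ B₁ bads E k) &&
              force (addLabel M (192 + c)) (solveMarks A B₀ B₁ bads E k)))) = true → Q := by
      intro b hb hall
      by_cases hs : ∀ c ∈ E.filter (fun c => !bit b c), Small c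
      · refine hb _ rfl (fun c hc => ⟨(List.mem_filter.1 hc).1, hs c hc⟩) fun c hc => ?_
        by_cases hbc : bit b c = true
        · exact Or.inl (bit_eq b c ▸ hbc)
        · exact Or.inr (List.mem_filter.2 ⟨hc, by simpa using hbc⟩)
      · push Not at hs
        obtain ⟨c, hc, hsc⟩ := hs
        have h' := List.all_eq_true.1 hall c hc
        simp only [Bool.and_eq_true, force_eq] at h'
        rcases (hE c (List.mem_filter.1 hc).1).resolve_left hsc with h1 | h1
        · refine ih _ (fun i hi => ?_) h'.2.2.1
          rcases testBit_addLabel hi with hi | rfl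
          exacts [hM i hi, h1]
        · refine ih _ (fun i hi => ?_) h'.2.2.2
          rcases testBit_addLabel hi with hi | rfl
          exacts [hM i hi, h1]
    rw [solveMarks, Bool.or_eq_true, Bool.or_eq_true, Bool.or_eq_true] at h
    simp only [List.any_eq_true (l := A), List.any_eq_true (l := bads), List.any_eq_true (l := B₀),
      List.any_eq_true (l := B₁)] at h
    rcases h with ⟨a, ha, h⟩ | ⟨m, hm, h⟩ | ⟨b, hb, h⟩ | ⟨b, hb, h⟩
    · exact hA a ha fun c hc => bit_eq a c ▸ List.all_eq_true.1 h c hc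
    · exact hbad m hm fun i hi => hM i (testBit_of_sub h hi)
    · rw [Bool.and_eq_true] at h
      exact key b (fun l hl => hB₀ b hb l (hl ▸ Nat.le_of_ble_eq_true h.1)) h.2
    · rw [Bool.and_eq_true] at h
      exact key b (fun l hl => hB₁ b hb l (hl ▸ Nat.le_of_ble_eq_true h.1)) h.2

/-- The true set of marked pairs selects one branch of the search. Shortening the list of forbidden
placements never harms soundness, so the filter in the unmarked branch requires no justification. -/
theorem exploreMarks_sound
    (hA : ∀ a ∈ A, (∀ c ∈ pairCodes n, Mk (64 + c) → a.testBit c = true) → Q)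
    (hB₀ : ∀ b ∈ B₀, ∀ l : List ℕ, l.length ≤ 2 → (∀ c ∈ l, c ∈ pairCodes n ∧ Small c) →
      (∀ c ∈ pairCodes n, Mk (64 + c) → b.testBit c = true ∨ c ∈ l) → Q)
    (hB₁ : ∀ b ∈ B₁, ∀ l : List ℕ, l.length ≤ 1 → (∀ c ∈ l, c ∈ pairCodes n ∧ Small c) →
      (∀ c ∈ pairCodes n, Mk (64 + c) → b.testBit c = true ∨ c ∈ l) → Q)
    (hmk : ∀ c ∈ pairCodes n, Mk (64 + c) → Mk c ∧ (Small c ∨ Mk (128 + c) ∨ Mk (192 + c)))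
    (cs bads E : List ℕ) (M : ℕ) (hbad : ∀ m ∈ bads, (∀ i, m.testBit i = true → Mk i) → Q)
    (hM : ∀ i, M.testBit i = true → Mk i) (hcs : ∀ c ∈ cs, c ∈ pairCodes n)
    (hE : ∀ c ∈ E, c ∈ pairCodes n ∧ Mk (64 + c))
    (hcov : ∀ c ∈ pairCodes n, Mk (64 + c) → c ∈ E ∨ c ∈ cs)
    (h : exploreMarks A B₀ B₁ cs bads E M = true) : Q := by
  induction cs generalizing bads E M with
  | nil =>
    have hcov' : ∀ c ∈ pairCodes n, Mk (64 + c) → c ∈ E := fun c hc hm =>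
      (hcov c hc hm).resolve_right (List.not_mem_nil)
    refine solveMarks_sound (Small := Small)
      (fun a ha h => hA a ha fun c hc hm => h c (hcov' c hc hm))
      (fun b hb l hl h1 h2 => hB₀ b hb l hl (fun c hc => ⟨(hE c (h1 c hc).1).1, (h1 c hc).2⟩)
        fun c hc hm => h2 c (hcov' c hc hm))
      (fun b hb l hl h1 h2 => hB₁ b hb l hl (fun c hc => ⟨(hE c (h1 c hc).1).1, (h1 c hc).2⟩)
        fun c hc hm => h2 c (hcov' c hc hm))
      hbad (fun c hc => (hmk c (hE c hc).1 (hE c hc).2).2) 5 M hM h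
  | cons c cs ih =>
    rw [exploreMarks, Bool.and_eq_true, force_eq, forceList_eq, force_eq, Bool.or_eq_true] at h
    have hc := hcs c List.mem_cons_self
    have hcs' : ∀ c ∈ cs, c ∈ pairCodes n := fun c' hc' => hcs c' (List.mem_cons_of_mem _ hc')
    by_cases hm : Mk (64 + c)
    · have hM' : ∀ i, (addMark M c).testBit i = true → Mk i := by
        intro i hi
        rcases testBit_addMark hi with hi | rfl | rfl
        exacts [hM i hi, (hmk _ hc hm).1, hm]
      rcases h.2 with h | h
      · obtain ⟨m, hmb, hs⟩ := List.any_eq_true.1 h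
        exact hbad m hmb fun i hi => hM' i (testBit_of_sub hs hi)
      · refine ih bads (c :: E) _ hbad hM' hcs' ?_ ?_ h
        · intro c' hc'
          rcases List.mem_cons.1 hc' with rfl | hc'
          exacts [⟨hc, hm⟩, hE c' hc']
        · intro c' hc' hm'
          rcases hcov c' hc' hm' with h | h
          · exact Or.inl (List.mem_cons_of_mem _ h)
          · rcases List.mem_cons.1 h with rfl | h
            exacts [Or.inl List.mem_cons_self, Or.inr h]
    · refine ih _ E M (fun m hm => hbad m (List.mem_filter.1 hm).1) hM hcs' hE ?_ h.1
      intro c' hc' hm'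
      rcases hcov c' hc' hm' with h | h
      · exact Or.inl h
      · rcases List.mem_cons.1 h with rfl | h
        exacts [(hm hm').elim, Or.inr h]

end Sound

namespace EdgeList

/-- The data of a good subdivision: the edges of `base` in `one`, `two` and `both` are 1-, 2- and
11-subdivided. -/
structure Subdivision where
  base : EdgeList
  one : List (ℕ × ℕ)
  two : List (ℕ × ℕ)
  both : List (ℕ × ℕ)

namespace Subdivision

/-- The subdivided graph. -/
def toEdgeList (s : Subdivision) : EdgeList := s.base.goodSubdiv s.one s.two s.both

/-- All the edges that are subdivided. -/
def subdivided (s : Subdivision) : List (ℕ × ℕ) := s.one ++ s.two ++ s.both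

/-- Membership in a list of pairs. -/
def memb (e : ℕ × ℕ) (l : List (ℕ × ℕ)) : Bool :=
  l.any fun e' => Nat.beq e.1 e'.1 && Nat.beq e.2 e'.2

theorem memb_iff {e : ℕ × ℕ} {l : List (ℕ × ℕ)} : memb e l = true ↔ e ∈ l := by
  simp only [memb, List.any_eq_true, Bool.and_eq_true, Nat.beq_eq]
  constructor
  · rintro ⟨e', he, h1, h2⟩
    rwa [Prod.ext h1 h2]
  · exact fun h => ⟨e, h, rfl, rfl⟩

/-- The edges that are not subdivided. -/
def plain (s : Subdivision) : List (ℕ × ℕ) := s.base.edges.filter fun e => !memb e s.subdivided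

/-- The edges of the base, labelled by the way in which they are subdivided. -/
def pattern (s : Subdivision) : Pattern :=
  s.plain.map (fun e => (0, e.1, e.2)) ++ (s.one.map (fun e => (1, e.1, e.2)) ++
    (s.two.map (fun e => (2, e.1, e.2)) ++ s.both.map fun e => (3, e.1, e.2)))

end Subdivision

/-- The subdivisions of `K₄` among the obstructions. -/
def k4Specs : List Subdivision :=
  [⟨k4, [(0, 1), (0, 2), (0, 3), (1, 2), (1, 3)], [], []⟩,
   ⟨k4, [(0, 1), (0, 2), (1, 3)], [(0, 3)], []⟩, ⟨k4, [(0, 1), (0, 2), (1, 3)], [], [(0, 3)]⟩,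
   ⟨k4, [(0, 1), (0, 2)], [(1, 3), (2, 3)], []⟩, ⟨k4, [(0, 1), (0, 2)], [(1, 3)], [(2, 3)]⟩,
   ⟨k4, [(0, 1), (0, 2)], [], [(1, 3), (2, 3)]⟩, ⟨k4, [], [(0, 1), (0, 2), (1, 2)], []⟩,
   ⟨k4, [], [(0, 1), (0, 2)], [(1, 2)]⟩, ⟨k4, [], [(0, 1)], [(0, 2), (1, 2)]⟩,
   ⟨k4, [], [], [(0, 1), (0, 2), (1, 2)]⟩]

/-- The subdivisions of 3-connected graphs on five vertices among the obstructions. -/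
def w5Specs : List Subdivision :=
  [⟨w5, [(0, 1), (1, 2), (4, 1)], [], []⟩, ⟨w5, [(0, 1), (0, 2), (0, 3)], [], []⟩,
   ⟨w5, [(0, 1), (0, 2), (1, 2)], [], []⟩, ⟨w5, [(1, 2), (2, 3), (3, 4), (4, 1)], [], []⟩,
   ⟨w5, [(0, 1), (1, 2), (2, 3), (3, 4)], [], []⟩, ⟨w5, [(0, 1), (0, 2), (2, 3), (3, 4)], [], []⟩,
   ⟨w5, [(0, 1), (0, 2), (2, 3), (4, 1)], [], []⟩, ⟨w5, [(0, 1), (0, 3), (1, 2), (2, 3)], [], []⟩,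
   ⟨w5, [(0, 1), (0, 3), (1, 2), (3, 4)], [], []⟩, ⟨w5, [(0, 1), (2, 3)], [(1, 2)], []⟩,
   ⟨w5, [(0, 1), (2, 3)], [], [(1, 2)]⟩, ⟨w5, [(4, 1), (2, 3)], [(1, 2)], []⟩,
   ⟨w5, [(4, 1), (2, 3)], [], [(1, 2)]⟩, ⟨w5, [(0, 2), (4, 1)], [(0, 1)], []⟩,
   ⟨w5, [(0, 2), (4, 1)], [], [(0, 1)]⟩, ⟨w5, [(0, 3), (1, 2)], [(0, 1)], []⟩,
   ⟨w5, [(0, 3), (1, 2)], [], [(0, 1)]⟩, ⟨w5.addEdges [(1, 3)], [(0, 1), (0, 3), (1, 3)], [], []⟩]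

/-- The subdivisions of 3-connected graphs on six vertices among the obstructions. -/
def sixSpecs : List Subdivision :=
  [⟨k33, [(0, 3), (0, 4)], [], []⟩, ⟨k33.addEdges [(0, 1)], [(0, 1), (0, 3)], [], []⟩,
   ⟨k33.addEdges [(0, 1), (1, 2)], [(0, 1), (1, 2)], [], []⟩, ⟨prism, [(0, 1), (0, 2)], [], []⟩,
   ⟨prism, [(0, 1), (0, 3)], [], []⟩, ⟨prism.addEdges [(0, 4)], [(0, 4), (0, 1)], [], []⟩,
   ⟨prism.addEdges [(0, 4)], [(0, 4), (0, 2)], [], []⟩,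
   ⟨prism.addEdges [(0, 4)], [(0, 4), (0, 3)], [], []⟩, ⟨w6, [(0, 1), (0, 2)], [], []⟩,
   ⟨w6, [(0, 1), (0, 3)], [], []⟩, ⟨w6, [(0, 1), (1, 2)], [], []⟩, ⟨w6, [(1, 2), (2, 3)], [], []⟩]

/-- The labelled edges of members of a list, each with a coded permutation. -/
def markCerts (specs : List Subdivision) (certs : List (ℕ × ℕ)) : List (Pattern × ℕ) :=
  certs.map fun c => ((specs.getD c.1 ⟨⟨0, []⟩, [], [], []⟩).pattern, c.2)

/-- However edges are marked, one of the good outcomes of `exploreMarks` occurs. -/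
def markCheck (g : EdgeList) (specs : List Subdivision) (certs : List (ℕ × ℕ)) (rs : List ℕ) :
    Bool :=
  forceList (placements (markCerts specs certs) rs) fun bads =>
    forceList (coverMasks g.order 3 0) fun A => forceList (coverMasks g.order 2 0) fun B₀ =>
      forceList (coverMasks g.order 2 1) fun B₁ =>
        forceList (pairCodes g.order) fun cs =>
          force (maskOf (g.edges.map fun e => code 0 e.1 e.2)) fun M =>
            exploreMarks A B₀ B₁ cs bads [] M

/-- The data used in `markCheck` are well-formed. -/
def markOK (g : EdgeList) (specs : List Subdivision) (certs : List (ℕ × ℕ)) (rs : List ℕ) : Bool :=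
  placementsOK g.order (markCerts specs certs) rs &&
    (certs.all (fun c => Nat.blt c.1 specs.length) &&
      g.edges.all fun e => Nat.blt e.1 g.order && Nat.blt e.2 g.order)

theorem exists_of_mem_coverMasks {n k j a : ℕ} (hn : n ≤ 8) (ha : a ∈ coverMasks n k j) :
    ∃ P : List (ℕ × ℕ), ∃ U : List ℕ, P.Nodup ∧ P.length = k ∧ U.length = j ∧
      (∀ e ∈ P, e.1 < e.2 ∧ e.2 < n) ∧ (∀ i ∈ U, i < n) ∧
      (∀ i, i < n → i ∈ U ∨ ∃ e ∈ P, i = e.1 ∨ i = e.2) ∧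
      ∀ u v, u < v → v < n → a.testBit (8 * u + v) = true → (u, v) ∈ P := by
  obtain ⟨l, hl, rfl⟩ := List.mem_map.1 ha
  obtain ⟨hl, hj⟩ := List.mem_filter.1 hl
  obtain ⟨hk, hsub⟩ := sublist_of_mem_chooseList hl
  have hl : ∀ c ∈ l, c ∈ pairCodes n := fun c hc => hsub.subset hc
  have hnd : ((l.map fun c => (c / 8, c % 8)) : List (ℕ × ℕ)).Nodup := by
    refine ((nodup_pairCodes n hn).sublist hsub).map fun c d h => ?_
    have h1 := congrArg Prod.fst h
    have h2 := congrArg Prod.snd h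
    dsimp only at h1 h2
    omega
  refine ⟨l.map fun c => (c / 8, c % 8), uncovered n l, hnd, by simp [hk],
    Nat.eq_of_beq_eq_true hj, ?_, fun i hi => List.mem_range.1 (List.mem_filter.1 hi).1, ?_, ?_⟩
  · intro e he
    obtain ⟨c, hc, rfl⟩ := List.mem_map.1 he
    obtain ⟨u, v, huv, hv, rfl⟩ := mem_pairCodes.1 (hl c hc)
    dsimp only
    omega
  · intro i hi
    rcases mem_uncovered hi hn hl with h | ⟨u, v, huv, hv, hc, hi⟩
    · exact Or.inl h
    · refine Or.inr ⟨_, List.mem_map.2 ⟨_, hc, rfl⟩, ?_⟩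
      dsimp only
      omega
  · intro u v huv hv h
    refine List.mem_map.2 ⟨_, testBit_maskOf.1 h, Prod.ext ?_ ?_⟩ <;> dsimp only <;> omega

/-- If a suitable set of pairs is marked then one of the subdivisions is present, and otherwise the
marked pairs are covered economically. -/
theorem exists_of_markCheck {g : EdgeList} {specs : List Subdivision} {certs : List (ℕ × ℕ)}
    {rs : List ℕ} (hchk : markCheck g specs certs rs = true) (hok : markOK g specs certs rs = true)
    {Sat : ℕ → ℕ → ℕ → Prop} {Small : ℕ → ℕ → Prop}
    (hsymm : ∀ k u v, Sat k u v → Sat k v u) (hg : ∀ e ∈ g.edges, Sat 0 e.1 e.2)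
    (hmk : ∀ u v, Sat 1 u v → Sat 0 u v ∧ (Small u v ∨ Sat 2 u v ∨ Sat 3 u v)) :
    (∃ s ∈ specs, ∃ f : ℕ → ℕ, BijOn f (Iio g.order) (Iio g.order) ∧
      ∀ e ∈ s.pattern, e.2.1 < g.order ∧ e.2.2 < g.order ∧ Sat e.1 (f e.2.1) (f e.2.2)) ∨
    ∃ P : List (ℕ × ℕ), ∃ U : List ℕ, ∃ l : List (ℕ × ℕ), P.Nodup ∧
      (P.length = 3 ∧ U = [] ∧ l = [] ∨ P.length = 2 ∧ U.length + l.length ≤ 2) ∧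
      (∀ e ∈ P ++ l, e.1 < e.2 ∧ e.2 < g.order) ∧ (∀ i ∈ U, i < g.order) ∧
      (∀ i, i < g.order → i ∈ U ∨ ∃ e ∈ P, i = e.1 ∨ i = e.2) ∧ (∀ e ∈ l, Small e.1 e.2) ∧
      ∀ u v, u < v → v < g.order → Sat 1 u v → (u, v) ∈ P ++ l := by
  simp only [markOK, Bool.and_eq_true, List.all_eq_true, Nat.blt_eq] at hok
  obtain ⟨hpl, hidx, hlt⟩ := hok
  have hn : g.order ≤ 8 := by
    simp only [placementsOK, Bool.and_eq_true, Nat.ble_eq] at hpl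
    exact hpl.1
  have hholds : ∀ k u v, u < 8 → v < 8 → Sat k u v → Holds Sat (code k u v) := by
    intro k u v hu hv h k' u' v' hu' hv' hc
    obtain ⟨rfl, ⟨rfl, rfl⟩ | ⟨rfl, rfl⟩⟩ := code_inj hu hv hu' hv' hc
    exacts [h, hsymm _ _ _ h]
  have hcode : ∀ k u v, u < v → v < g.order → 64 * k + (8 * u + v) = code k u v := by
    intro k u v huv hv
    rw [code, if_pos (Nat.ble_eq_true_of_le huv.le)]
  have hiff : ∀ k u v, u < v → v < g.order → (Holds Sat (64 * k + (8 * u + v)) ↔ Sat k u v) := by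
    intro k u v huv hv
    exact ⟨fun h => h k u v (by omega) (by omega) (hcode k u v huv hv), fun h =>
      hcode k u v huv hv ▸ hholds k u v (by omega) (by omega) h⟩
  simp only [markCheck, forceList_eq, force_eq] at hchk
  -- The bound two counts uncovered vertices and small parts together: they are later to fit into a
  -- single third pair.
  have hB : ∀ j, ∀ b ∈ coverMasks g.order 2 j, ∀ l : List ℕ, j + l.length ≤ 2 →
      (∀ c ∈ l, c ∈ pairCodes g.order ∧ Small (c / 8) (c % 8)) →
      (∀ c ∈ pairCodes g.order, Holds Sat (64 + c) → b.testBit c = true ∨ c ∈ l) →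
      ∃ P : List (ℕ × ℕ), ∃ U : List ℕ, ∃ l : List (ℕ × ℕ), P.Nodup ∧
        (P.length = 3 ∧ U = [] ∧ l = [] ∨ P.length = 2 ∧ U.length + l.length ≤ 2) ∧
        (∀ e ∈ P ++ l, e.1 < e.2 ∧ e.2 < g.order) ∧ (∀ i ∈ U, i < g.order) ∧
        (∀ i, i < g.order → i ∈ U ∨ ∃ e ∈ P, i = e.1 ∨ i = e.2) ∧ (∀ e ∈ l, Small e.1 e.2) ∧
        ∀ u v, u < v → v < g.order → Sat 1 u v → (u, v) ∈ P ++ l := by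
    intro j b hb l hl h1 h2
    obtain ⟨P, U, hnd, hP, hU, hPn, hUn, hcov, hbit⟩ := exists_of_mem_coverMasks hn hb
    refine ⟨P, U, l.map fun c => (c / 8, c % 8), hnd, Or.inr ⟨hP, by simp; omega⟩, ?_, hUn, hcov,
      ?_, ?_⟩
    · intro e he
      rcases List.mem_append.1 he with he | he
      · exact hPn e he
      · obtain ⟨c, hc, rfl⟩ := List.mem_map.1 he
        obtain ⟨u, v, huv, hv, rfl⟩ := mem_pairCodes.1 (h1 c hc).1
        dsimp only
        omega
    · intro e he
      obtain ⟨c, hc, rfl⟩ := List.mem_map.1 he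
      exact (h1 c hc).2
    · intro u v huv hv hs
      rcases h2 _ (mem_pairCodes.2 ⟨u, v, huv, hv, rfl⟩) ((hiff 1 u v huv hv).2 hs) with h | h
      · exact List.mem_append_left _ (hbit u v huv hv h)
      · refine List.mem_append_right _ (List.mem_map.2 ⟨_, h, Prod.ext ?_ ?_⟩) <;> dsimp only <;>
          omega
  refine exploreMarks_sound (n := g.order) (Mk := Holds Sat)
    (Small := fun c => Small (c / 8) (c % 8))
    ?_ (fun b hb l hl h1 h2 => Or.inr (hB 0 b hb l (by omega) h1 h2))
    (fun b hb l hl h1 h2 => Or.inr (hB 1 b hb l (by omega) h1 h2)) ?_ _ _ _ _ ?_ ?_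
    (fun c hc => hc) (by simp) (fun c hc _ => Or.inr hc) hchk
  · intro a ha h
    obtain ⟨P, U, hnd, hP, hU, hPn, hUn, hcov, hbit⟩ := exists_of_mem_coverMasks hn ha
    refine Or.inr ⟨P, U, [], hnd, Or.inl ⟨hP, List.length_eq_zero_iff.1 hU, rfl⟩,
      by simpa using hPn, hUn,
      hcov, by simp, fun u v huv hv hs => ?_⟩
    rw [List.append_nil]
    exact hbit u v huv hv (h _ (mem_pairCodes.2 ⟨u, v, huv, hv, rfl⟩) ((hiff 1 u v huv hv).2 hs))
  · intro c hc hm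
    obtain ⟨u, v, huv, hv, rfl⟩ := mem_pairCodes.1 hc
    obtain ⟨h0, h⟩ := hmk u v ((hiff 1 u v huv hv).1 hm)
    have h8 : (8 * u + v) / 8 = u ∧ (8 * u + v) % 8 = v := by omega
    refine ⟨by simpa using (hiff 0 u v huv hv).2 h0, ?_⟩
    rw [h8.1, h8.2]
    exact h.imp_right (Or.imp (hiff 2 u v huv hv).2 (hiff 3 u v huv hv).2)
  · intro m hm h
    obtain ⟨c, hc, f, hf, h⟩ := exists_of_mem_placements hm hpl h
    obtain ⟨i, hi, rfl⟩ := List.mem_map.1 hc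
    refine Or.inl ⟨_, ?_, f, hf, h⟩
    rw [List.getD_eq_getElem _ _ (hidx i hi)]
    exact List.getElem_mem _
  · intro i hi
    obtain ⟨e, he, rfl⟩ := List.mem_map.1 (testBit_maskOf.1 hi)
    have := hlt e he
    exact hholds 0 _ _ (by omega) (by omega) (hg e he)

/-- Placements of obstructions in `K₄`. -/
def k4Marks : List (ℕ × ℕ) :=
  [(0, 76543210), (1, 76543210), (2, 76543210), (3, 76543210), (4, 76543210),
   (5, 76543210), (6, 76543210), (7, 76543210), (8, 76543210), (9, 76543210)]

/-- Placements of obstructions in the wheel on five vertices. -/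
def w5Marks : List (ℕ × ℕ) :=
  [(1, 76543201), (4, 76543210), (4, 76542310), (4, 76540231), (5, 76543210),
   (5, 76504321), (7, 76543201), (8, 76543201), (9, 76543210), (9, 76540231),
   (10, 76543210), (10, 76540231), (13, 76543210), (14, 76543210), (15, 76543210),
   (15, 76543201), (15, 76540231), (16, 76543210), (16, 76543201), (16, 76540231),
   (0, 76543210), (0, 76540231), (1, 76543210), (2, 76543210), (2, 76504321),
   (4, 76542031), (6, 76543210), (7, 76543210), (8, 76543210), (9, 76504231),
   (10, 76504231), (11, 76543210), (12, 76543210), (13, 76540231), (14, 76540231),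
   (3, 76534210), (17, 76543210), (3, 76543210)]

/-- Placements of obstructions in `K₃,₃`. -/
def k33Marks : List (ℕ × ℕ) :=
  [(1, 76543210), (0, 76543210), (2, 76543210)]

/-- Placements of obstructions in the prism. -/
def prismMarks : List (ℕ × ℕ) :=
  [(4, 76543210), (5, 76543210), (6, 76543210), (7, 76543210), (3, 76543210),
   (9, 76125340)]

/-- Placements of obstructions in the wheel on six vertices. -/
def w6Marks : List (ℕ × ℕ) :=
  [(3, 76405321), (4, 76045231), (6, 76405321), (10, 76543210), (5, 76045231),
   (8, 76543210), (9, 76543210), (11, 76543210)]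

/-- This and its analogues for the other spanning graphs are the finite core of the upper bound.
Only the edges of the spanning graph are assumed; a mark at a nonadjacent pair supplies that edge
too, which is how bases with additional edges, such as `w5.addEdges [(1, 3)]`, arise. -/
theorem markCheck_k4 : markCheck k4 k4Specs k4Marks k4Autos = true := by
  decide +kernel

theorem markOK_k4 : markOK k4 k4Specs k4Marks k4Autos = true := by
  decide +kernel

theorem markCheck_w5 : markCheck w5 w5Specs w5Marks w5Autos = true := by
  decide +kernel

theorem markOK_w5 : markOK w5 w5Specs w5Marks w5Autos = true := by
  decide +kernel

theorem markCheck_k33 : markCheck k33 sixSpecs k33Marks k33Autos = true := by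
  decide +kernel

theorem markOK_k33 : markOK k33 sixSpecs k33Marks k33Autos = true := by
  decide +kernel

theorem markCheck_prism : markCheck prism sixSpecs prismMarks prismAutos = true := by
  decide +kernel

theorem markOK_prism : markOK prism sixSpecs prismMarks prismAutos = true := by
  decide +kernel

theorem markCheck_w6 : markCheck w6 sixSpecs w6Marks w6Autos = true := by
  decide +kernel

theorem markOK_w6 : markOK w6 sixSpecs w6Marks w6Autos = true := by
  decide +kernel

end EdgeList

/-! ### Parts attached at two vertices -/

section Links

variable {V : Type*} {G : SimpleGraph V}

/-- The set `J` contains a connected set with neighbours `x` and `y`. -/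
def Link (G : SimpleGraph V) (J : Set V) (x y : V) : Prop :=
  ∃ C ⊆ J, ConnSet G C ∧ (∃ c ∈ C, G.Adj x c) ∧ ∃ c ∈ C, G.Adj c y

/-- The set `J` contains two disjoint connected sets that form a path between `x` and `y`. -/
def SeriesLink (G : SimpleGraph V) (J : Set V) (x y : V) : Prop :=
  ∃ C ⊆ J, ∃ D ⊆ J, Disjoint C D ∧ ConnSet G C ∧ ConnSet G D ∧ (∃ c ∈ C, G.Adj x c) ∧
    (∃ c ∈ C, ∃ d ∈ D, G.Adj c d) ∧ ∃ d ∈ D, G.Adj d y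

/-- The set `J` contains two disjoint connected sets with neighbours `x` and `y`. -/
def ParallelLink (G : SimpleGraph V) (J : Set V) (x y : V) : Prop :=
  ∃ C ⊆ J, ∃ D ⊆ J, Disjoint C D ∧ (ConnSet G C ∧ (∃ c ∈ C, G.Adj x c) ∧ ∃ c ∈ C, G.Adj c y) ∧
    ConnSet G D ∧ (∃ c ∈ D, G.Adj x c) ∧ ∃ c ∈ D, G.Adj c y

theorem Link.symm {J : Set V} {x y : V} (h : Link G J x y) : Link G J y x := by
  obtain ⟨C, hC, h1, ⟨c, hc, hxc⟩, d, hd, hdy⟩ := h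
  exact ⟨C, hC, h1, ⟨d, hd, hdy.symm⟩, c, hc, hxc.symm⟩

theorem SeriesLink.symm {J : Set V} {x y : V} (h : SeriesLink G J x y) : SeriesLink G J y x := by
  obtain ⟨C, hC, D, hD, hCD, h1, h2, ⟨c, hc, hxc⟩, ⟨a, ha, b, hb, hab⟩, d, hd, hdy⟩ := h
  exact ⟨D, hD, C, hC, hCD.symm, h2, h1, ⟨d, hd, hdy.symm⟩, ⟨b, hb, a, ha, hab.symm⟩, c, hc,
    hxc.symm⟩

theorem ParallelLink.symm {J : Set V} {x y : V} (h : ParallelLink G J x y) :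
    ParallelLink G J y x := by
  obtain ⟨C, hC, D, hD, hCD, ⟨h1, ⟨c, hc, hxc⟩, d, hd, hdy⟩, h2, ⟨a, ha, hxa⟩, b, hb, hby⟩ := h
  exact ⟨C, hC, D, hD, hCD, ⟨h1, ⟨d, hd, hdy.symm⟩, c, hc, hxc.symm⟩, h2, ⟨b, hb, hby.symm⟩, a,
    ha, hxa.symm⟩

/-- A component of a vertex set. -/
theorem exists_component [Finite V] {J : Set V} {c : V} (hc : c ∈ J) :
    ∃ D ⊆ J, c ∈ D ∧ ConnSet G D ∧ nb G D ⊆ nb G J := by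
  obtain ⟨D, hcD, hD⟩ := Finite.exists_le_minimal (p := fun D : Set V => D ⊆ J ∧ c ∈ D ∧
    ∀ u ∈ D, ∀ v ∈ J, G.Adj u v → v ∈ D) (a := J) ⟨Subset.rfl, hc, fun _ _ v hv _ => hv⟩
  obtain ⟨⟨hDJ, hcD', hcl⟩, hmin⟩ := hD
  refine ⟨D, hDJ, hcD', ⟨⟨c, hcD'⟩, fun T hT hne hTc => ?_⟩, fun v hv => ?_⟩
  · have key : ∀ S ⊆ D, (∀ u ∈ S, ∀ v ∈ D, G.Adj u v → v ∈ S) → c ∈ S → S = D := by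
      intro S hS hSc hcS
      refine hS.antisymm (hmin ⟨hS.trans hDJ, hcS, fun u hu v hv huv => ?_⟩ hS)
      exact hSc u hu v (hcl u (hS hu) v hv huv) huv
    by_cases hcT : c ∈ T
    · exact key T hT hTc hcT
    · have := key (D \ T) sdiff_subset (fun u hu v hv huv => ⟨hv, fun hvT =>
        hu.2 (hTc v hvT u hu.1 huv.symm)⟩) ⟨hcD', hcT⟩
      obtain ⟨t, ht⟩ := hne
      have h2 : t ∈ D \ T := by rw [this]; exact hT ht
      exact (h2.2 ht).elim
  · obtain ⟨hv, u, hu, huv⟩ := hv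
    exact ⟨fun hvJ => hv (hcl u hu v hvJ huv), u, hDJ hu, huv⟩

variable [Finite V] {J : Set V} {x y o : V}

theorem KConnected.mem_nb_of_subset_pair (h2 : KConnected 2 G) (hJ : J.Nonempty)
    (hnb : nb G J ⊆ {x, y}) (ho : o ∉ J) (hox : o ≠ x) (hoy : o ≠ y) : x ∈ nb G J ∧ y ∈ nb G J := by
  have h := h2 J hJ ⟨o, ho, fun h => by rcases hnb h with h | h <;> contradiction⟩
  constructor <;> by_contra hn
  · have : nb G J ⊆ {y} := fun v hv => by
      rcases hnb hv with rfl | h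
      exacts [(hn hv).elim, h]
    have := ncard_le_ncard this
    rw [ncard_singleton] at this
    omega
  · have : nb G J ⊆ {x} := fun v hv => by
      rcases hnb hv with h | rfl
      exacts [h, (hn hv).elim]
    have := ncard_le_ncard this
    rw [ncard_singleton] at this
    omega

theorem KConnected.link (h2 : KConnected 2 G) (hJ : J.Nonempty) (hnb : nb G J ⊆ {x, y})
    (ho : o ∉ J) (hox : o ≠ x) (hoy : o ≠ y) : Link G J x y := by
  obtain ⟨c, hc⟩ := hJ
  obtain ⟨D, hD, hcD, hconn, hnbD⟩ := exists_component (G := G) hc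
  obtain ⟨⟨-, a, ha, hax⟩, -, b, hb, hby⟩ :=
    h2.mem_nb_of_subset_pair ⟨c, hcD⟩ (hnbD.trans hnb) (fun h => ho (hD h)) hox hoy
  exact ⟨D, hD, hconn, ⟨a, ha, hax.symm⟩, b, hb, hby⟩

/-- Since `D` has no neighbours in the rest of `J`, both `D` and `J \ D` are attached at `x` and `y`
only, and each contains a link. -/
theorem KConnected.parallelLink (h2 : KConnected 2 G) (hnb : nb G J ⊆ {x, y})
    (ho : o ∉ J) (hox : o ≠ x) (hoy : o ≠ y) {D : Set V} (hD : D.Nonempty) (hDJ : D ⊂ J)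
    (hnbD : nb G D ⊆ {x, y}) (hx : x ∉ J) (hy : y ∉ J) : ParallelLink G J x y := by
  obtain ⟨C, hC, h⟩ := h2.link hD hnbD (fun h => ho (hDJ.1 h)) hox hoy
  have hnb' : nb G (J \ D) ⊆ {x, y} := by
    rintro v ⟨hv, u, hu, huv⟩
    rcases mem_or_mem_nb hu.1 huv with h | h
    · have hvD : v ∈ D := by by_contra h'; exact hv ⟨h, h'⟩
      have := (mem_or_mem_nb hvD huv.symm).resolve_left hu.2
      rcases hnbD this with rfl | h
      exacts [(hx hu.1).elim, (hy (mem_singleton_iff.1 h ▸ hu.1)).elim]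
    · exact hnb h
  obtain ⟨C', hC', hl⟩ := h2.link (nonempty_of_ssubset hDJ) hnb' (fun h => ho h.1) hox hoy
  exact ⟨C, hC.trans hDJ.1, C', fun v hv => (hC' hv).1,
    disjoint_left.2 fun v hv hv' => (hC' hv').2 (hC hv), h, hl⟩

/-- If at least two vertices are attached at `x` and `y` then they contain a path with two
branch sets or two parallel paths. -/
theorem KConnected.series_or_parallel (h2 : KConnected 2 G) (hJ : J.Nontrivial)
    (hnb : nb G J ⊆ {x, y}) (hx : x ∉ J) (hy : y ∉ J) (ho : o ∉ J) (hox : o ≠ x) (hoy : o ≠ y) :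
    SeriesLink G J x y ∨ ParallelLink G J x y := by
  obtain ⟨⟨-, c, hc, hcx⟩, -, d, hd, hdy⟩ :=
    h2.mem_nb_of_subset_pair hJ.nonempty hnb ho hox hoy
  -- A component of `J` without `e` either sees `e` or is attached at `x` and `y` alone, and the
  -- latter gives two parallel links.
  have key : ∀ e ∈ J, ∀ D ⊆ J \ {e}, D.Nonempty → nb G D ⊆ nb G (J \ {e}) →
      e ∈ nb G D ∨ ParallelLink G J x y := by
    intro e he D hD hne hDn
    by_contra! hcon
    refine hcon.2 (h2.parallelLink hnb ho hox hoy hne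
      ⟨hD.trans sdiff_subset, fun h => (hD (h he)).2 rfl⟩ (fun v hv => ?_) hx hy)
    obtain ⟨hv', u, hu, huv⟩ := hDn hv
    rcases mem_or_mem_nb hu.1 huv with h | h
    · exact (hcon.1 ((not_not.1 fun h' => hv' ⟨h, h'⟩ : v = e) ▸ hv)).elim
    · exact hnb h
  -- If one vertex serves as the contact of both `x` and `y`, any other component must be used to
  -- lengthen the path; otherwise the two contacts already lead to a path with two branch sets.
  by_cases hcd : c = d
  · subst hcd
    obtain ⟨z, hz, hzc⟩ := hJ.exists_ne c
    obtain ⟨D, hD, hzD, hconn, hDn⟩ := exists_component (G := G) (J := J \ {c}) ⟨hz, hzc⟩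
    rcases key c hc D hD ⟨z, hzD⟩ hDn with ⟨-, a, ha, hac⟩ | h
    -- By 2-connectivity `D` has a neighbour other than `c`, necessarily `x` or `y`; the path goes
    -- through `D` and `c` in the order that this dictates.
    · have hcard := h2 D ⟨z, hzD⟩ ⟨o, fun h => ho (hD h).1, fun h => by
        obtain ⟨-, u, hu, huo⟩ := hDn h
        rcases mem_or_mem_nb hu.1 huo with h | h
        · exact ho h
        · rcases hnb h with h | h <;> contradiction⟩
      obtain ⟨w, hw, hwc⟩ := exists_ne_of_one_lt_ncard (s := nb G D) (by omega) c
      have hDJ : D ⊆ J := hD.trans sdiff_subset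
      have hcJ : {c} ⊆ J := singleton_subset_iff.2 hc
      have hdisj : Disjoint {c} D := disjoint_singleton_left.2 fun h => (hD h).2 rfl
      have hwxy : w = x ∨ w = y := by
        obtain ⟨hw', u, hu, huw⟩ := hDn hw
        rcases mem_or_mem_nb hu.1 huw with h | h
        · exact (hw' ⟨h, hwc⟩).elim
        · exact hnb h
      obtain ⟨-, b, hb, hbw⟩ := hw
      rcases hwxy with rfl | rfl
      · exact Or.inl ⟨D, hDJ, {c}, hcJ, hdisj.symm, hconn, connSet_singleton c, ⟨b, hb, hbw.symm⟩,
          ⟨a, ha, c, rfl, hac⟩, c, rfl, hdy⟩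
      · exact Or.inl ⟨{c}, hcJ, D, hDJ, hdisj, connSet_singleton c, hconn, ⟨c, rfl, hcx.symm⟩,
          ⟨c, rfl, a, ha, hac.symm⟩, b, hb, hbw⟩
    · exact Or.inr h
  · obtain ⟨D, hD, hcD, hconn, hDn⟩ := exists_component (G := G) (J := J \ {d}) ⟨hc, hcd⟩
    rcases key d hd D hD ⟨c, hcD⟩ hDn with ⟨-, a, ha, had⟩ | h
    · exact Or.inl ⟨D, hD.trans sdiff_subset, {d}, singleton_subset_iff.2 hd,
        disjoint_singleton_right.2 fun h => (hD h).2 rfl, hconn, connSet_singleton d,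
        ⟨c, hcD, hcx.symm⟩, ⟨a, ha, d, rfl, had⟩, d, rfl, hdy⟩
    · exact Or.inr h

end Links

/-! ### Minors from attached parts -/

section Models

variable {V : Type*} {G : SimpleGraph V} {φ : ℕ → V} {J : V → V → Set V} {n : ℕ} {g : EdgeList}

/-- A model of the graph `g` in `G` that lacks the edges in `pend`. The branch sets of the
first `n` vertices contain the values of `φ`, and no branch set meets a part that is attached at an
edge in `pend`. -/
def PartialModel (G : SimpleGraph V) (φ : ℕ → V) (J : V → V → Set V) (n : ℕ) (g : EdgeList)
    (pend : List (ℕ × ℕ)) : Prop :=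
  ∃ B : ℕ → Set V, n ≤ g.order ∧ (∀ i < g.order, ConnSet G (B i)) ∧
    (∀ i < g.order, ∀ j < g.order, i ≠ j → Disjoint (B i) (B j)) ∧ (∀ i < n, φ i ∈ B i) ∧
    (∀ e ∈ g.edges, e.1 < g.order ∧ e.2 < g.order ∧
      (e ∈ pend ∨ ∃ x ∈ B e.1, ∃ y ∈ B e.2, G.Adj x y)) ∧
    ∀ e ∈ pend, (e.1 < n ∧ e.2 < n) ∧ ∀ i < g.order, Disjoint (J (φ e.1) (φ e.2)) (B i)

theorem PartialModel.isMinor (h : PartialModel G φ J n g []) : IsMinor g.graph G := by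
  obtain ⟨B, -, h1, h2, -, h3, -⟩ := h
  refine ⟨fun i => B i, fun i => (h1 i i.2).induce_connected,
    fun i j hij => h2 i i.2 j j.2 fun h => hij (Fin.ext h), fun i j hij => ?_⟩
  rcases ((SimpleGraph.fromRel_adj _ _ _).1 hij).2 with h | h
  · exact (h3 _ h).2.2.resolve_left List.not_mem_nil
  · obtain ⟨x, hx, y, hy, hxy⟩ := (h3 _ h).2.2.resolve_left List.not_mem_nil
    exact ⟨y, hy, x, hx, hxy.symm⟩

/-- Two pairs differ as unordered pairs. -/
def PairNe (e e' : ℕ × ℕ) : Prop := ¬ (e.1 = e'.1 ∧ e.2 = e'.2) ∧ ¬ (e.1 = e'.2 ∧ e.2 = e'.1)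

instance : DecidableRel PairNe := fun _ _ => inferInstanceAs (Decidable (_ ∧ _))

theorem partialModel_start (hφ : InjOn φ (Iio g.order))
    (hlt : ∀ e ∈ g.edges, e.1 < g.order ∧ e.2 < g.order)
    (hJ : ∀ x y, ∀ i < g.order, φ i ∉ J x y) {pend : List (ℕ × ℕ)}
    (hp : ∀ e, e ∈ pend ↔ e ∈ g.edges) : PartialModel G φ J g.order g pend :=
  ⟨fun i => {φ i}, le_rfl, fun _ _ => connSet_singleton _, fun _ hi _ hj hij =>
    disjoint_singleton.2 fun h => hij (hφ hi hj h), fun _ _ => rfl,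
    fun e he => ⟨(hlt e he).1, (hlt e he).2, Or.inl ((hp e).2 he)⟩,
    fun e he => ⟨hlt e ((hp e).1 he), fun i hi => disjoint_singleton_right.2 (hJ _ _ i hi)⟩⟩

variable {e : ℕ × ℕ} {pend : List (ℕ × ℕ)}

/-- Realize an edge by a link that is added to the branch set of one end. -/
theorem PartialModel.absorb (h : PartialModel G φ J n g (e :: pend))
    (hd : ∀ e' ∈ pend, Disjoint (J (φ e'.1) (φ e'.2)) (J (φ e.1) (φ e.2)))
    (hl : G.Adj (φ e.1) (φ e.2) ∨ Link G (J (φ e.1) (φ e.2)) (φ e.1) (φ e.2)) :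
    PartialModel G φ J n g pend := by
  obtain ⟨B, hn, h1, h2, h3, h4, h5⟩ := h
  obtain ⟨⟨he1, he2⟩, hJe⟩ := h5 e List.mem_cons_self
  have hadj : ∀ {B' : ℕ → Set V}, (∀ i, B i ⊆ B' i) → (∃ x ∈ B' e.1, ∃ y ∈ B' e.2, G.Adj x y) →
      ∀ e' ∈ g.edges, e'.1 < g.order ∧ e'.2 < g.order ∧
        (e' ∈ pend ∨ ∃ x ∈ B' e'.1, ∃ y ∈ B' e'.2, G.Adj x y) := by
    intro B' hB' he e' he'
    obtain ⟨a, b, h⟩ := h4 e' he'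
    refine ⟨a, b, ?_⟩
    rcases h with h | ⟨x, hx, y, hy, hxy⟩
    · rcases List.mem_cons.1 h with rfl | h
      exacts [Or.inr he, Or.inl h]
    · exact Or.inr ⟨x, hB' _ hx, y, hB' _ hy, hxy⟩
  rcases hl with hl | ⟨C, hC, hconn, ⟨c, hc, hxc⟩, d, hd', hdy⟩
  · exact ⟨B, hn, h1, h2, h3, hadj (fun _ => Subset.rfl) ⟨_, h3 _ he1, _, h3 _ he2, hl⟩,
      fun e' he' => h5 e' (List.mem_cons_of_mem _ he')⟩
  · have hB' : ∀ i, B i ⊆ Function.update B e.1 (B e.1 ∪ C) i := by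
      intro i
      by_cases hi : i = e.1
      · subst hi; rw [Function.update_self]; exact subset_union_left
      · rw [Function.update_of_ne hi]
    have hCB : ∀ i < g.order, Disjoint C (B i) := fun i hi => (hJe i hi).mono_left hC
    refine ⟨Function.update B e.1 (B e.1 ∪ C), hn, fun i hi => ?_, fun i hi j hj hij => ?_,
      fun i hi => hB' i (h3 i hi), hadj hB' ?_, fun e' he' => ?_⟩
    · by_cases hie : i = e.1
      · subst hie
        rw [Function.update_self]
        exact (h1 _ hi).union_of_adj hconn (h3 _ he1) hc hxc
      · rw [Function.update_of_ne hie]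
        exact h1 i hi
    · by_cases hie : i = e.1
      · subst hie
        rw [Function.update_self, Function.update_of_ne hij.symm]
        exact (h2 _ hi j hj hij).union_left (hCB j hj)
      · by_cases hje : j = e.1
        · subst hje
          rw [Function.update_self, Function.update_of_ne hie]
          exact (h2 i hi _ hj hij).union_right (hCB i hi).symm
        · rw [Function.update_of_ne hie, Function.update_of_ne hje]
          exact h2 i hi j hj hij
    · refine ⟨d, ?_, φ e.2, hB' _ (h3 _ he2), hdy⟩
      rw [Function.update_self]
      exact Or.inr hd'
    · obtain ⟨ha, hb⟩ := h5 e' (List.mem_cons_of_mem _ he')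
      refine ⟨ha, fun i hi => ?_⟩
      by_cases hie : i = e.1
      · subst hie
        rw [Function.update_self]
        exact (hb _ hi).union_right ((hd e' he').mono_right hC)
      · rw [Function.update_of_ne hie]
        exact hb i hi

/-- Replace an edge by new vertices whose branch sets are in the part attached at the edge. -/
theorem PartialModel.extend (h : PartialModel G φ J n g (e :: pend))
    (hd : ∀ e' ∈ pend, Disjoint (J (φ e'.1) (φ e'.2)) (J (φ e.1) (φ e.2))) (k : ℕ) (C : ℕ → Set V)
    (hC : ∀ i < k, C i ⊆ J (φ e.1) (φ e.2) ∧ ConnSet G (C i))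
    (hCC : ∀ i < k, ∀ j < k, i ≠ j → Disjoint (C i) (C j)) {g' : EdgeList}
    (hord : g'.order = g.order + k)
    (hedges : ∀ e' ∈ g'.edges, e' ∈ g.edgesWithout e ∨
      (∃ i < k, e' = (e.1, g.order + i) ∧ ∃ c ∈ C i, G.Adj (φ e.1) c) ∨
      (∃ i < k, e' = (g.order + i, e.2) ∧ ∃ c ∈ C i, G.Adj c (φ e.2)) ∨
      ∃ i < k, ∃ j < k, e' = (g.order + i, g.order + j) ∧ ∃ c ∈ C i, ∃ d ∈ C j, G.Adj c d) :
    PartialModel G φ J n g' pend := by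
  obtain ⟨B, hn, h1, h2, h3, h4, h5⟩ := h
  obtain ⟨⟨he1, he2⟩, hJe⟩ := h5 e List.mem_cons_self
  let B' : ℕ → Set V := fun i => if i < g.order then B i else C (i - g.order)
  have hB : ∀ i, i < g.order → B' i = B i := fun i hi => if_pos hi
  have hB' : ∀ i, B' (g.order + i) = C i := fun i => by
    simp only [B', if_neg (Nat.not_lt.2 (Nat.le_add_right _ _)), Nat.add_sub_cancel_left]
  have hcase : ∀ i < g'.order, i < g.order ∨ ∃ j < k, i = g.order + j := by
    intro i hi
    rcases Nat.lt_or_ge i g.order with h | h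
    · exact Or.inl h
    · exact Or.inr ⟨i - g.order, by omega, by omega⟩
  refine ⟨B', by omega, fun i hi => ?_, fun i hi j hj hij => ?_, fun i hi => ?_, fun e' he' => ?_,
    fun e' he' => ?_⟩
  · rcases hcase i hi with h | ⟨i, h, rfl⟩
    · rw [hB i h]; exact h1 i h
    · rw [hB']; exact (hC i h).2
  · rcases hcase i hi with h | ⟨i, h, rfl⟩ <;> rcases hcase j hj with h' | ⟨j, h', rfl⟩
    · rw [hB i h, hB j h']; exact h2 i h j h' hij
    · rw [hB i h, hB']; exact ((hJe i h).mono_left (hC j h').1).symm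
    · rw [hB j h', hB']; exact (hJe j h').mono_left (hC i h).1
    · rw [hB', hB']; exact hCC i h j h' fun h => hij (by rw [h])
  · rw [hB i (by omega)]; exact h3 i hi
  · rcases hedges e' he' with h | ⟨i, hi, rfl, c, hc, hadj⟩ | ⟨i, hi, rfl, c, hc, hadj⟩ |
      ⟨i, hi, j, hj, rfl, c, hc, d, hd, hadj⟩
    · obtain ⟨h, hne⟩ := List.mem_filter.1 h
      simp only [decide_eq_true_eq] at hne
      obtain ⟨a, b, h⟩ := h4 e' h
      refine ⟨by omega, by omega, ?_⟩
      rcases h with h | h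
      · exact Or.inl ((List.mem_cons.1 h).resolve_left hne.1)
      · rw [hB _ a, hB _ b]; exact Or.inr h
    · refine ⟨by dsimp only; omega, by dsimp only; omega, Or.inr ⟨φ e.1, ?_, c, ?_, hadj⟩⟩
      · rw [hB _ (by dsimp only; omega)]; exact h3 _ he1
      · rw [hB']; exact hc
    · refine ⟨by dsimp only; omega, by dsimp only; omega, Or.inr ⟨c, ?_, φ e.2, ?_, hadj⟩⟩
      · rw [hB']; exact hc
      · rw [hB _ (by dsimp only; omega)]; exact h3 _ he2
    · refine ⟨by dsimp only; omega, by dsimp only; omega, Or.inr ⟨c, ?_, d, ?_, hadj⟩⟩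
      · rw [hB']; exact hc
      · rw [hB']; exact hd
  · obtain ⟨ha, hb⟩ := h5 e' (List.mem_cons_of_mem _ he')
    refine ⟨ha, fun i hi => ?_⟩
    rcases hcase i hi with h | ⟨i, h, rfl⟩
    · rw [hB i h]; exact hb i h
    · rw [hB']; exact (hd e' he').mono_right (hC i h).1

theorem PartialModel.subdiv1 (h : PartialModel G φ J n g (e :: pend))
    (hd : ∀ e' ∈ pend, Disjoint (J (φ e'.1) (φ e'.2)) (J (φ e.1) (φ e.2)))
    (hl : Link G (J (φ e.1) (φ e.2)) (φ e.1) (φ e.2)) :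
    PartialModel G φ J n (g.subdiv1 e) pend := by
  obtain ⟨C, hC, hconn, hx, hy⟩ := hl
  refine h.extend hd 1 (fun _ => C) (fun _ _ => ⟨hC, hconn⟩) (fun i hi j hj hij => by omega) rfl ?_
  intro e' he'
  rcases List.mem_append.1 he' with he' | he'
  · exact Or.inl he'
  · simp only [List.mem_cons, List.not_mem_nil, or_false] at he'
    rcases he' with rfl | rfl
    · exact Or.inr (Or.inl ⟨0, one_pos, rfl, hx⟩)
    · exact Or.inr (Or.inr (Or.inl ⟨0, one_pos, rfl, hy⟩))

/-- Common form of 2- and 11-subdivision: both insert two new vertices and differ only in which of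
the five possible new edges occur. -/
theorem PartialModel.extend_two (h : PartialModel G φ J n g (e :: pend))
    (hd : ∀ e' ∈ pend, Disjoint (J (φ e'.1) (φ e'.2)) (J (φ e.1) (φ e.2))) {C D : Set V}
    (hC : C ⊆ J (φ e.1) (φ e.2)) (hD : D ⊆ J (φ e.1) (φ e.2)) (hCD : Disjoint C D)
    (hCc : ConnSet G C) (hDc : ConnSet G D) {g' : EdgeList} (hord : g'.order = g.order + 2)
    (hedges : ∀ e' ∈ g'.edges, e' ∈ g.edgesWithout e ∨
      (e' = (e.1, g.order) ∧ ∃ c ∈ C, G.Adj (φ e.1) c) ∨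
      (e' = (g.order, e.2) ∧ ∃ c ∈ C, G.Adj c (φ e.2)) ∨
      (e' = (e.1, g.order + 1) ∧ ∃ c ∈ D, G.Adj (φ e.1) c) ∨
      (e' = (g.order + 1, e.2) ∧ ∃ c ∈ D, G.Adj c (φ e.2)) ∨
      e' = (g.order, g.order + 1) ∧ ∃ c ∈ C, ∃ d ∈ D, G.Adj c d) :
    PartialModel G φ J n g' pend := by
  refine h.extend hd 2 (fun i => if i = 0 then C else D) ?_ ?_ hord ?_
  · intro i _
    split_ifs
    exacts [⟨hC, hCc⟩, ⟨hD, hDc⟩]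
  · intro i hi j hj hij
    split_ifs
    · omega
    · exact hCD
    · exact hCD.symm
    · omega
  · intro e' he'
    rcases hedges e' he' with h | h | h | h | h | h
    · exact Or.inl h
    · exact Or.inr (Or.inl ⟨0, two_pos, h⟩)
    · exact Or.inr (Or.inr (Or.inl ⟨0, two_pos, h⟩))
    · exact Or.inr (Or.inl ⟨1, one_lt_two, h⟩)
    · exact Or.inr (Or.inr (Or.inl ⟨1, one_lt_two, h⟩))
    · exact Or.inr (Or.inr (Or.inr ⟨0, two_pos, 1, one_lt_two, h⟩))

theorem PartialModel.subdiv2 (h : PartialModel G φ J n g (e :: pend))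
    (hd : ∀ e' ∈ pend, Disjoint (J (φ e'.1) (φ e'.2)) (J (φ e.1) (φ e.2)))
    (hl : SeriesLink G (J (φ e.1) (φ e.2)) (φ e.1) (φ e.2)) :
    PartialModel G φ J n (g.subdiv2 e) pend := by
  obtain ⟨C, hC, D, hD, hCD, hCc, hDc, hx, hcd, hy⟩ := hl
  refine h.extend_two hd hC hD hCD hCc hDc rfl fun e' he' => ?_
  rcases List.mem_append.1 he' with he' | he'
  · exact Or.inl he'
  · simp only [List.mem_cons, List.not_mem_nil, or_false] at he'
    rcases he' with rfl | rfl | rfl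
    · exact Or.inr (Or.inl ⟨rfl, hx⟩)
    · exact Or.inr (Or.inr (Or.inr (Or.inr (Or.inr ⟨rfl, hcd⟩))))
    · exact Or.inr (Or.inr (Or.inr (Or.inr (Or.inl ⟨rfl, hy⟩))))

theorem PartialModel.subdiv11 (h : PartialModel G φ J n g (e :: pend))
    (hd : ∀ e' ∈ pend, Disjoint (J (φ e'.1) (φ e'.2)) (J (φ e.1) (φ e.2)))
    (hl : ParallelLink G (J (φ e.1) (φ e.2)) (φ e.1) (φ e.2)) :
    PartialModel G φ J n (g.subdiv11 e) pend := by
  obtain ⟨C, hC, D, hD, hCD, ⟨hCc, hCx, hCy⟩, hDc, hDx, hDy⟩ := hl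
  refine h.extend_two hd hC hD hCD hCc hDc rfl fun e' he' => ?_
  rcases List.mem_append.1 he' with he' | he'
  · exact Or.inl he'
  · simp only [List.mem_cons, List.not_mem_nil, or_false] at he'
    rcases he' with rfl | rfl | rfl | rfl
    · exact Or.inr (Or.inl ⟨rfl, hCx⟩)
    · exact Or.inr (Or.inr (Or.inl ⟨rfl, hCy⟩))
    · exact Or.inr (Or.inr (Or.inr (Or.inl ⟨rfl, hDx⟩)))
    · exact Or.inr (Or.inr (Or.inr (Or.inr (Or.inl ⟨rfl, hDy⟩))))

/-- Realize a list of edges one after the other. -/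
theorem PartialModel.foldl {f : EdgeList → ℕ × ℕ → EdgeList} {Ok : ℕ × ℕ → Prop}
    (hf : ∀ (g : EdgeList) (e : ℕ × ℕ) (pend : List (ℕ × ℕ)), PartialModel G φ J n g (e :: pend) →
      (∀ e' ∈ pend, Disjoint (J (φ e'.1) (φ e'.2)) (J (φ e.1) (φ e.2))) → Ok e →
      PartialModel G φ J n (f g e) pend)
    (hJ : ∀ e e' : ℕ × ℕ, e.1 < n → e.2 < n → e'.1 < n → e'.2 < n → PairNe e e' →
      Disjoint (J (φ e'.1) (φ e'.2)) (J (φ e.1) (φ e.2)))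
    (l pend : List (ℕ × ℕ)) (hl : (l ++ pend).Pairwise PairNe) (hok : ∀ e ∈ l, Ok e)
    (h : PartialModel G φ J n g (l ++ pend)) : PartialModel G φ J n (l.foldl f g) pend := by
  induction l generalizing g with
  | nil => exact h
  | cons e l ih =>
    rw [List.cons_append, List.pairwise_cons] at hl
    refine ih hl.2 (fun e he => hok e (List.mem_cons_of_mem _ he))
      (hf g e _ h (fun e' hm => ?_) (hok e List.mem_cons_self))
    obtain ⟨B, -, -, -, -, -, h5⟩ := h
    exact hJ e e' (h5 e (by simp)).1.1 (h5 e (by simp)).1.2 (h5 e' (List.mem_cons_of_mem _ hm)).1.1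
      (h5 e' (List.mem_cons_of_mem _ hm)).1.2 (hl.1 _ hm)

/-- The ways in which `x` and `y` can be connected. -/
def Linked (G : SimpleGraph V) (J : V → V → Set V) : ℕ → V → V → Prop
  | 0, x, y => G.Adj x y ∨ Link G (J x y) x y
  | 1, x, y => Link G (J x y) x y
  | 2, x, y => SeriesLink G (J x y) x y
  | _, x, y => ParallelLink G (J x y) x y

theorem Linked.symm (hJ : ∀ x y, J x y = J y x) {k : ℕ} {x y : V} (h : Linked G J k x y) :
    Linked G J k y x := by
  match k with
  | 0 =>
    simp only [Linked, hJ y x] at h ⊢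
    exact h.imp SimpleGraph.Adj.symm Link.symm
  | 1 =>
    simp only [Linked, hJ y x] at h ⊢
    exact h.symm
  | 2 =>
    simp only [Linked, hJ y x] at h ⊢
    exact h.symm
  | _ + 3 =>
    simp only [Linked, hJ y x] at h ⊢
    exact h.symm

/-- The edges of the base of a subdivision are distinct, and the subdivided ones are among them. -/
def EdgeList.Subdivision.WF (s : EdgeList.Subdivision) : Prop :=
  (s.plain ++ (s.one ++ (s.two ++ s.both))).Pairwise PairNe ∧
    (∀ e ∈ s.one ++ (s.two ++ s.both), e ∈ s.base.edges) ∧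
    ∀ e ∈ s.base.edges, e.1 < s.base.order ∧ e.2 < s.base.order

instance : DecidablePred EdgeList.Subdivision.WF := fun _ => inferInstanceAs (Decidable (_ ∧ _))

/-- Pending edges are realized in the order plain, `one`, `two`, `both`, which is the order of
`goodSubdiv`, so the new vertices receive matching numbers. Different edges draw on disjoint sets `J
x y`, so the steps do not interfere. -/
theorem EdgeList.Subdivision.isMinor {s : EdgeList.Subdivision} (hs : s.WF)
    (hφ : InjOn φ (Iio s.base.order)) (hJφ : ∀ x y, ∀ i < s.base.order, φ i ∉ J x y)
    (hJ : ∀ x y x' y', ¬ (x = x' ∧ y = y') → ¬ (x = y' ∧ y = x') → Disjoint (J x y) (J x' y'))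
    (h : ∀ e ∈ s.pattern, Linked G J e.1 (φ e.2.1) (φ e.2.2)) : IsMinor s.toEdgeList.graph G := by
  obtain ⟨h1, h2, h3⟩ := hs
  have hJ' : ∀ e e' : ℕ × ℕ, e.1 < s.base.order → e.2 < s.base.order → e'.1 < s.base.order →
      e'.2 < s.base.order → PairNe e e' →
      Disjoint (J (φ e'.1) (φ e'.2)) (J (φ e.1) (φ e.2)) := by
    intro e e' ha hb hc hd hne
    refine (hJ _ _ _ _ (fun h => ?_) fun h => ?_).symm
    · exact hne.1 ⟨hφ ha hc h.1, hφ hb hd h.2⟩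
    · exact hne.2 ⟨hφ ha hd h.1, hφ hb hc h.2⟩
  have hstart : PartialModel G φ J s.base.order s.base
      (s.plain ++ (s.one ++ (s.two ++ s.both))) := by
    refine partialModel_start hφ h3 hJφ fun e => ?_
    rw [List.mem_append]
    refine ⟨fun h => h.elim (fun h => (List.mem_filter.1 h).1) (h2 e), fun h => ?_⟩
    by_cases he : e ∈ s.subdivided
    · exact Or.inr (by simpa [subdivided] using he)
    · refine Or.inl (List.mem_filter.2 ⟨h, ?_⟩)
      rw [Bool.not_eq_true', ← Bool.not_eq_true, memb_iff]
      exact he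
  have hpat : ∀ k : ℕ, ∀ e : ℕ × ℕ, (k, e.1, e.2) ∈ s.pattern → Linked G J k (φ e.1) (φ e.2) :=
    fun k e he => h _ he
  have hplain := hstart.foldl (f := fun g _ => g) (fun g e pend h hd hok => h.absorb hd hok) hJ'
    s.plain _ h1 fun e he => hpat 0 e (by simp [pattern, he])
  rw [List.foldl_fixed] at hplain
  have h1' := (List.pairwise_append.1 h1).2.1
  have h1'' := (List.pairwise_append.1 h1').2.1
  have hone := hplain.foldl (fun g e pend h hd hok => h.subdiv1 hd hok) hJ' s.one _ h1'
    fun e he => hpat 1 e (by simp [pattern, he])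
  have htwo := hone.foldl (fun g e pend h hd hok => h.subdiv2 hd hok) hJ' s.two _ h1''
    fun e he => hpat 2 e (by simp [pattern, he])
  have hboth := PartialModel.foldl (l := s.both) (pend := [])
    (fun g e pend h hd hok => h.subdiv11 hd hok) hJ'
    (by simpa using (List.pairwise_append.1 h1'').2.1)
    (fun e he => hpat 3 e (by simp [pattern, he])) (by simpa using htwo)
  exact hboth.isMinor

theorem EdgeList.wf_specs : ∀ s ∈ k4Specs ++ (w5Specs ++ sixSpecs), s.WF := by
  decide +kernel

theorem EdgeList.toEdgeList_mem_obstructions {s : EdgeList.Subdivision}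
    (hs : s ∈ k4Specs ++ (w5Specs ++ sixSpecs)) : s.toEdgeList ∈ obstructions := by
  have h4 : obs4 = k4Specs.map Subdivision.toEdgeList := rfl
  have h5 : obs5 = w5Specs.map Subdivision.toEdgeList := rfl
  have h6 : obs6 = sixSpecs.map Subdivision.toEdgeList := rfl
  simp only [obstructions, List.mem_append, h4, h5, h6] at hs ⊢
  rcases hs with h | h | h
  · exact Or.inl (Or.inl (Or.inr (List.mem_map_of_mem h)))
  · exact Or.inl (Or.inr (List.mem_map_of_mem h))
  · exact Or.inr (List.mem_map_of_mem h)

end Models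

/-! ### Feasible sets -/

section Feasible

variable {V : Type*} {G : SimpleGraph V}

/-- The set `A` is empty or occurs as a cluster of a rooted binary tree all of whose clusters have
cuts that are covered by two vertices. -/
def Feasible (G : SimpleGraph V) (A : Set V) : Prop := A = ∅ ∨ Feas (Cov2 G) A

theorem feasible_empty : Feasible G ∅ := Or.inl rfl

theorem Feasible.union {A B : Set V} (hA : Feasible G A) (hB : Feasible G B) (hd : Disjoint A B)
    (h : Cov2 G (A ∪ B)) : Feasible G (A ∪ B) := by
  rcases hA with rfl | hA
  · rwa [empty_union]
  · rcases hB with rfl | hB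
    · rw [union_empty]; exact Or.inr hA
    · exact Or.inr (hA.join hB hd h)

/-- An edge leaving `X` either starts at `a` or `b`, or starts in `K` and must then end in one of
them. It is thus irrelevant how `a` and `b` are distributed over the two sides of the cut. -/
theorem cov2_of_subset {K X : Set V} {a b : V} (hK : nb G K ⊆ {a, b}) (h1 : K ⊆ X)
    (h2 : X ⊆ K ∪ {a, b}) : Cov2 G X := by
  refine ⟨a, b, fun x hx y hy hxy => ?_⟩
  rcases h2 hx with h | h
  · have hy' := (mem_or_mem_nb h hxy).resolve_left fun h => hy (h1 h)
    rcases hK hy' with h | h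
    exacts [Or.inr (Or.inr (Or.inl h)), Or.inr (Or.inr (Or.inr h))]
  · rcases h with h | h
    exacts [Or.inl h, Or.inr (Or.inl h)]

theorem cov2_of_nb {K : Set V} {a b : V} (hK : nb G K ⊆ {a, b}) : Cov2 G K :=
  cov2_of_subset hK Subset.rfl subset_union_left

theorem cov2_singleton (v : V) : Cov2 G {v} := ⟨v, v, fun _ hx _ _ _ => Or.inl hx⟩

theorem feasible_singleton (v : V) : Feasible G {v} := Or.inr (.single v (cov2_singleton v))

/-- The attachment vertices are added as leaves one at a time; all sets on the way lie between `K`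
and `K ∪ {a, b}`. -/
theorem Feasible.of_subset {K X : Set V} {a b : V} (hF : Feasible G K) (hK : nb G K ⊆ {a, b})
    (h1 : K ⊆ X) (h2 : X ⊆ K ∪ {a, b}) : Feasible G X := by
  have step : ∀ (Y : Set V) (v : V), Feasible G Y → K ⊆ Y → Y ⊆ K ∪ {a, b} → (v = a ∨ v = b) →
      Feasible G (Y ∪ {v}) := by
    intro Y v hY hKY hY' hv
    by_cases hvY : v ∈ Y
    · rwa [union_eq_self_of_subset_right (singleton_subset_iff.2 hvY)]
    · refine hY.union (feasible_singleton v) (disjoint_singleton_right.2 hvY)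
        (cov2_of_subset hK (hKY.trans subset_union_left) (union_subset hY' ?_))
      exact singleton_subset_iff.2 (Or.inr hv)
  by_cases ha : a ∈ X <;> by_cases hb : b ∈ X
  · have : X = K ∪ {a} ∪ {b} := by
      refine Subset.antisymm (fun v hv => ?_) (union_subset (union_subset h1 ?_) ?_)
      · rcases h2 hv with h | h | h
        exacts [Or.inl (Or.inl h), Or.inl (Or.inr h), Or.inr h]
      · exact singleton_subset_iff.2 ha
      · exact singleton_subset_iff.2 hb
    rw [this]
    exact step _ b (step K a hF Subset.rfl subset_union_left (Or.inl rfl)) subset_union_left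
      (union_subset subset_union_left (singleton_subset_iff.2 (Or.inr (Or.inl rfl)))) (Or.inr rfl)
  · have : X = K ∪ {a} := by
      refine Subset.antisymm (fun v hv => ?_) (union_subset h1 (singleton_subset_iff.2 ha))
      rcases h2 hv with h | h | h
      exacts [Or.inl h, Or.inr h, (hb ((mem_singleton_iff.1 h) ▸ hv)).elim]
    rw [this]
    exact step K a hF Subset.rfl subset_union_left (Or.inl rfl)
  · have : X = K ∪ {b} := by
      refine Subset.antisymm (fun v hv => ?_) (union_subset h1 (singleton_subset_iff.2 hb))
      rcases h2 hv with h | h | h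
      exacts [Or.inl h, (ha (h ▸ hv)).elim, Or.inr h]
    rw [this]
    exact step K b hF Subset.rfl subset_union_left (Or.inr rfl)
  · have : X = K := by
      refine Subset.antisymm (fun v hv => ?_) h1
      rcases h2 hv with h | h | h
      exacts [h, (ha (h ▸ hv)).elim, (hb ((mem_singleton_iff.1 h) ▸ hv)).elim]
    rwa [this]

/-- A graph made of three parts, each attached at two vertices: the part outside the first one. -/
theorem feasible_compl {K₁ K₂ K₃ : Set V} {a₁ b₁ a₂ b₂ a₃ b₃ : V} (h₁ : nb G K₁ ⊆ {a₁, b₁})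
    (h₂ : nb G K₂ ⊆ {a₂, b₂}) (h₃ : nb G K₃ ⊆ {a₃, b₃}) (hF₂ : Feasible G K₂)
    (hF₃ : Feasible G K₃) (hd₂ : Disjoint K₂ (K₁ ∪ {a₁, b₁}))
    (hd₃ : Disjoint K₃ (K₁ ∪ {a₁, b₁})) (hd₃₂ : Disjoint K₃ (K₂ ∪ {a₂, b₂}))
    (hcov : ∀ v, v ∈ K₁ ∪ {a₁, b₁} ∨ v ∈ K₂ ∪ {a₂, b₂} ∨ v ∈ K₃ ∪ {a₃, b₃}) :
    Feasible G (K₁ ∪ {a₁, b₁})ᶜ := by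
  set X₁ := K₁ ∪ {a₁, b₁}
  have hF : Feasible G ((K₂ ∪ {a₂, b₂}) \ X₁) := hF₂.of_subset h₂
    (fun v hv => ⟨Or.inl hv, disjoint_left.1 hd₂ hv⟩) sdiff_subset
  have hF' : Feasible G (X₁ᶜ \ (K₂ ∪ {a₂, b₂})) := hF₃.of_subset h₃
    (fun v hv => ⟨disjoint_left.1 hd₃ hv, disjoint_left.1 hd₃₂ hv⟩)
    fun v hv => ((hcov v).resolve_left hv.1).resolve_left hv.2
  -- These are the three branches at a cubic node: the first piece, the second without the first,
  -- and the remainder. Attachment vertices shared by several pieces go to the earliest one.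
  have heq : X₁ᶜ = (K₂ ∪ {a₂, b₂}) \ X₁ ∪ X₁ᶜ \ (K₂ ∪ {a₂, b₂}) := by
    ext v
    simp only [mem_compl_iff, mem_union, mem_sdiff]
    tauto
  rw [heq]
  refine hF.union hF' (disjoint_left.2 fun v h h' => h'.2 h.1) ?_
  rw [← heq]
  exact (cov2_of_subset h₁ subset_union_left Subset.rfl).compl

theorem feasible_univ_of_compl {K : Set V} {a b : V} (hK : nb G K ⊆ {a, b}) (hF : Feasible G K)
    (hF' : Feasible G (K ∪ {a, b})ᶜ) : Feasible G univ := by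
  rw [← union_compl_self (K ∪ {a, b})]
  refine (hF.of_subset hK subset_union_left Subset.rfl).union hF' disjoint_compl_right ?_
  rw [union_compl_self]
  exact ⟨a, a, fun _ _ y hy => (hy (mem_univ y)).elim⟩

theorem nb_empty : nb G ∅ = ∅ := by
  ext v
  simp [nb]

/-- Six vertices form three pairs, which are three pieces with empty parts. -/
theorem feasible_univ_of_card_le [Finite V] (h : Nat.card V ≤ 6) : Feasible G univ := by
  rcases isEmpty_or_nonempty V with hV | ⟨⟨z⟩⟩
  · exact Or.inl (univ_eq_empty_iff.2 hV)
  · obtain ⟨f, hf⟩ : ∃ f : Fin 6 → V, Function.Surjective f := by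
      let e := Finite.equivFin V
      refine ⟨fun i => if h : (i : ℕ) < Nat.card V then e.symm ⟨i, h⟩ else z, fun v => ?_⟩
      refine ⟨⟨e v, lt_of_lt_of_le (e v).2 h⟩, ?_⟩
      simp
    have hnb : ∀ a b : V, nb G ∅ ⊆ {a, b} := fun a b => by rw [nb_empty]; exact empty_subset _
    refine feasible_univ_of_compl (hnb (f 0) (f 1)) feasible_empty
      (feasible_compl (hnb _ _) (hnb (f 2) (f 3)) (hnb (f 4) (f 5)) feasible_empty feasible_empty
        (by simp) (by simp) (by simp) fun v => ?_)
    obtain ⟨i, rfl⟩ := hf v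
    fin_cases i <;> simp

end Feasible

/-! ### Torsos -/

section Torso

variable {V : Type*} {G : SimpleGraph V} {𝓙 : Set (Set V)}

/-- The members of `𝓙` are disjoint and nonadjacent parts, attached at different pairs of vertices
outside of the parts. -/
structure IsTorso (G : SimpleGraph V) (𝓙 : Set (Set V)) : Prop where
  nonempty : ∀ J ∈ 𝓙, J.Nonempty
  disjoint : ∀ J ∈ 𝓙, ∀ K ∈ 𝓙, J ≠ K → Disjoint J K
  ncard_nb : ∀ J ∈ 𝓙, (nb G J).ncard = 2
  nb_inj : ∀ J ∈ 𝓙, ∀ K ∈ 𝓙, nb G J = nb G K → J = K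
  nb_disjoint : ∀ J ∈ 𝓙, ∀ K ∈ 𝓙, Disjoint (nb G J) K

/-- The vertices outside of the parts. -/
def core (𝓙 : Set (Set V)) : Set V := (⋃₀ 𝓙)ᶜ

/-- The graph on the core in which parts are replaced by edges. -/
def torso (G : SimpleGraph V) (𝓙 : Set (Set V)) : SimpleGraph (core 𝓙) where
  Adj x y := x ≠ y ∧ (G.Adj x y ∨ ∃ J ∈ 𝓙, nb G J = {(x : V), (y : V)})
  symm := ⟨fun x y h => ⟨h.1.symm, h.2.imp SimpleGraph.Adj.symm
    fun ⟨J, hJ, h⟩ => ⟨J, hJ, by rw [h, pair_comm]⟩⟩⟩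
  loopless := ⟨fun _ h => h.1 rfl⟩

/-- The part attached at `x` and `y`. -/
def attached (G : SimpleGraph V) (𝓙 : Set (Set V)) (x y : V) : Set V :=
  {v | ∃ J ∈ 𝓙, nb G J = {x, y} ∧ v ∈ J}

theorem attached_comm (x y : V) : attached G 𝓙 x y = attached G 𝓙 y x := by
  simp only [attached, pair_comm]

theorem notMem_attached {v : V} (hv : v ∈ core 𝓙) (x y : V) : v ∉ attached G 𝓙 x y := by
  rintro ⟨J, hJ, -, h⟩
  exact hv ⟨J, hJ, h⟩

namespace IsTorso

theorem attached_eq (h : IsTorso G 𝓙) {J : Set V} (hJ : J ∈ 𝓙) {x y : V} (hxy : nb G J = {x, y}) :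
    attached G 𝓙 x y = J := by
  ext v
  refine ⟨?_, fun hv => ⟨J, hJ, hxy, hv⟩⟩
  rintro ⟨K, hK, hKxy, hv⟩
  rwa [h.nb_inj J hJ K hK (hxy.trans hKxy.symm)]

theorem attached_eq_empty_or (h : IsTorso G 𝓙) (x y : V) :
    attached G 𝓙 x y = ∅ ∨ attached G 𝓙 x y ∈ 𝓙 ∧ nb G (attached G 𝓙 x y) = {x, y} := by
  rcases (attached G 𝓙 x y).eq_empty_or_nonempty with h' | ⟨v, J, hJ, hxy, hv⟩
  · exact Or.inl h'
  · rw [h.attached_eq hJ hxy]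
    exact Or.inr ⟨hJ, hxy⟩

theorem disjoint_attached (h : IsTorso G 𝓙) {x y x' y' : V} (h1 : ¬ (x = x' ∧ y = y'))
    (h2 : ¬ (x = y' ∧ y = x')) : Disjoint (attached G 𝓙 x y) (attached G 𝓙 x' y') := by
  refine disjoint_left.2 ?_
  rintro v ⟨J, hJ, hxy, hv⟩ ⟨K, hK, hxy', hv'⟩
  have hJK : J = K := by
    by_contra hne
    exact disjoint_left.1 (h.disjoint J hJ K hK hne) hv hv'
  rw [hJK, hxy'] at hxy
  rcases pair_eq_pair_iff.1 hxy with h | h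
  exacts [h1 ⟨h.1.symm, h.2.symm⟩, h2 ⟨h.2.symm, h.1.symm⟩]

theorem exists_pair (h : IsTorso G 𝓙) {J : Set V} (hJ : J ∈ 𝓙) :
    ∃ x ∈ core 𝓙, ∃ y ∈ core 𝓙, x ≠ y ∧ nb G J = {x, y} := by
  obtain ⟨x, y, hxy, hnb⟩ := ncard_eq_two.1 (h.ncard_nb J hJ)
  have hc : ∀ v ∈ nb G J, v ∈ core 𝓙 := by
    rintro v hv ⟨K, hK, hvK⟩
    exact disjoint_left.1 (h.nb_disjoint J hJ K hK) hv hvK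
  exact ⟨x, hc x (hnb ▸ Or.inl rfl), y, hc y (hnb ▸ Or.inr rfl), hxy, hnb⟩

variable [Finite V]

theorem exists_other (hW : 3 ≤ Nat.card (core 𝓙)) (x y : V) : ∃ o ∈ core 𝓙, o ≠ x ∧ o ≠ y := by
  by_contra! hcon
  have hsub : core 𝓙 ⊆ {x, y} := fun v hv => by
    by_cases hvx : v = x
    exacts [Or.inl hvx, Or.inr (hcon v hv hvx)]
  have h1 := ncard_le_ncard hsub
  have h2 := ncard_insert_le x {y}
  rw [ncard_singleton] at h2
  have h3 : Nat.card (core 𝓙) = (core 𝓙).ncard := rfl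
  omega

theorem linked_of_mem (h : IsTorso G 𝓙) (h2 : KConnected 2 G) (hW : 3 ≤ Nat.card (core 𝓙))
    {J : Set V} (hJ : J ∈ 𝓙) {x y : V} (hxy : nb G J = {x, y}) :
    Linked G (attached G 𝓙) 1 x y := by
  obtain ⟨o, ho, hox, hoy⟩ := exists_other hW x y
  have hl := h2.link (h.nonempty J hJ) hxy.subset (fun h => ho ⟨J, hJ, h⟩) hox hoy
  rwa [← h.attached_eq hJ hxy] at hl

theorem linked_of_adj (h : IsTorso G 𝓙) (h2 : KConnected 2 G) (hW : 3 ≤ Nat.card (core 𝓙))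
    {x y : core 𝓙} (hxy : (torso G 𝓙).Adj x y) : Linked G (attached G 𝓙) 0 x y := by
  rcases hxy.2 with hadj | ⟨J, hJ, hnb⟩
  · exact Or.inl hadj
  · exact Or.inr (h.linked_of_mem h2 hW hJ hnb)

theorem subsingleton_or_linked (h : IsTorso G 𝓙) (h2 : KConnected 2 G)
    (hW : 3 ≤ Nat.card (core 𝓙)) (x y : V) :
    (attached G 𝓙 x y).Subsingleton ∨ Linked G (attached G 𝓙) 2 x y ∨
      Linked G (attached G 𝓙) 3 x y := by
  rcases (attached G 𝓙 x y).subsingleton_or_nontrivial with hs | hs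
  · exact Or.inl hs
  · refine Or.inr ?_
    obtain ⟨hmem, hnb⟩ := (h.attached_eq_empty_or x y).resolve_left hs.nonempty.ne_empty
    obtain ⟨o, ho, hox, hoy⟩ := exists_other hW x y
    have hx : x ∈ nb G (attached G 𝓙 x y) := hnb ▸ Or.inl rfl
    have hy : y ∈ nb G (attached G 𝓙 x y) := hnb ▸ Or.inr rfl
    exact h2.series_or_parallel hs hnb.subset hx.1 hy.1 (fun h => ho ⟨_, hmem, h⟩) hox hoy

/-- The torso is a minor. -/
theorem isMinor_torso (h : IsTorso G 𝓙) (h2 : KConnected 2 G) (hW : 3 ≤ Nat.card (core 𝓙)) :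
    IsMinor (torso G 𝓙) G := by
  classical
  set n := Nat.card (core 𝓙) with hn
  let e : core 𝓙 ≃ Fin n := Finite.equivFin (core 𝓙)
  let φ' : ℕ → core 𝓙 := fun i => e.symm ⟨i % n, Nat.mod_lt _ (by omega)⟩
  have hφ' : ∀ w, φ' (e w) = w := fun w => by
    simp only [φ', Nat.mod_eq_of_lt (e w).2, Fin.eta, Equiv.symm_apply_apply]
  have hinj : InjOn φ' (Iio n) := fun i hi j hj hij => by
    have := congrArg Fin.val (e.symm.injective hij)
    dsimp only at this
    rwa [Nat.mod_eq_of_lt hi, Nat.mod_eq_of_lt hj] at this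
  let l : List (ℕ × ℕ) := ((List.range n).product (List.range n)).filter fun c =>
    c.1 < c.2 ∧ (torso G 𝓙).Adj (φ' c.1) (φ' c.2)
  have hl : ∀ c, c ∈ l ↔ (c.1 < n ∧ c.2 < n) ∧ c.1 < c.2 ∧ (torso G 𝓙).Adj (φ' c.1) (φ' c.2) := by
    rintro ⟨a, b⟩
    simp only [l, List.mem_filter, List.pair_mem_product, List.mem_range, decide_eq_true_eq]
  have hnd : l.Pairwise PairNe := by
    have : l.Nodup := ((List.nodup_range).product (List.nodup_range)).filter _
    refine List.Pairwise.imp_of_mem (fun {c d} hc hd hne => ?_) this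
    have h1 := ((hl c).1 hc).2.1
    have h2 := ((hl d).1 hd).2.1
    refine ⟨fun h => hne (Prod.ext h.1 h.2), fun h => ?_⟩
    omega
  -- The torso is coded as an edge list so that its edges can be absorbed one after the other, each
  -- using a link through its own part where `G` has no edge.
  let g : EdgeList := ⟨n, l⟩
  have hstart : PartialModel G (fun i => (φ' i : V)) (attached G 𝓙) n g (l ++ []) :=
    partialModel_start (g := g) (fun i hi j hj hij => hinj hi hj (Subtype.ext hij))
      (fun c hc => ((hl c).1 hc).1) (fun x y i _ => notMem_attached (φ' i).2 x y) fun _ => by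
        rw [List.append_nil]
  have hmodel := hstart.foldl (φ := fun i => (φ' i : V)) (J := attached G 𝓙) (f := fun g _ => g)
    (Ok := fun c => Linked G (attached G 𝓙) 0 (φ' c.1) (φ' c.2))
    (fun _ _ _ h hd hok => h.absorb hd hok)
    (fun c d hc1 hc2 hd1 hd2 hne => (h.disjoint_attached
      (fun h => hne.1 ⟨hinj hc1 hd1 (Subtype.ext h.1), hinj hc2 hd2 (Subtype.ext h.2)⟩)
      (fun h => hne.2 ⟨hinj hc1 hd2 (Subtype.ext h.1), hinj hc2 hd1 (Subtype.ext h.2)⟩)).symm)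
    l [] (by rwa [List.append_nil]) (fun c hc => h.linked_of_adj h2 hW ((hl c).1 hc).2.2)
  rw [List.foldl_fixed] at hmodel
  obtain ⟨B, hB, hdisj, hadj⟩ := hmodel.isMinor
  refine ⟨fun w => B (e w), fun w => hB _, fun w w' hne => hdisj _ _ fun h => hne (e.injective h),
    fun w w' hww' => hadj _ _ ?_⟩
  rw [EdgeList.graph, SimpleGraph.fromRel_adj]
  refine ⟨fun h => hww'.ne (e.injective h), ?_⟩
  change ((e w : ℕ), (e w' : ℕ)) ∈ l ∨ ((e w' : ℕ), (e w : ℕ)) ∈ l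
  have hne : (e w : ℕ) ≠ e w' := fun h => hww'.ne (e.injective (Fin.ext h))
  simp only [hl, hφ']
  rcases Nat.lt_or_gt_of_ne hne with hlt | hlt
  · exact Or.inl ⟨⟨(e w).2, (e w').2⟩, hlt, hww'⟩
  · exact Or.inr ⟨⟨(e w').2, (e w).2⟩, hlt, hww'.symm⟩

end IsTorso

/-- The graph consists of three parts, each attached at two vertices, and every part in `𝓙` that is
not a single vertex is one of them. -/
def IsTripartite (G : SimpleGraph V) (𝓙 : Set (Set V)) : Prop :=
  ∃ (a b : Fin 3 → V) (K : Fin 3 → Set V), (∀ i, K i = ∅ ∨ K i ∈ 𝓙 ∧ nb G (K i) = {a i, b i}) ∧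
    (∀ v, ∃ i, v ∈ K i ∪ {a i, b i}) ∧ (∀ i j, i ≠ j → Disjoint (K i) (K j ∪ {a j, b j})) ∧
    ∀ J ∈ 𝓙, J.Nontrivial → ∃ i, K i = J

end Torso

/-! ### Torsos of graphs without obstructions -/

section Tripartite

variable {V : Type*} {G : SimpleGraph V} {𝓙 : Set (Set V)}

/-- No obstruction is a minor. -/
def ObstructionFree (G : SimpleGraph V) : Prop :=
  ∀ H ∈ EdgeList.obstructions, ¬ IsMinor H.graph G

/-- Parts are attached at pairs of core vertices, and a three-element core has only three pairs,
each carrying at most one part. -/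
theorem IsTorso.isTripartite_of_card_eq_three (h : IsTorso G 𝓙) (hW : Nat.card (core 𝓙) = 3) :
    IsTripartite G 𝓙 := by
  obtain ⟨x, y, z, hxy, hxz, hyz, hc⟩ := ncard_eq_three.1 (show (core 𝓙).ncard = 3 from hW)
  have hx : x ∈ core 𝓙 := hc ▸ by simp
  have hy : y ∈ core 𝓙 := hc ▸ by simp
  have hz : z ∈ core 𝓙 := hc ▸ by simp
  have hpiece : ∀ J ∈ 𝓙, ∃ i : Fin 3, attached G 𝓙 (![x, x, y] i) (![y, z, z] i) = J := by
    intro J hJ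
    obtain ⟨u, hu, v, hv, huv, hnb⟩ := h.exists_pair hJ
    rw [hc] at hu hv
    simp only [mem_insert_iff, mem_singleton_iff] at hu hv
    rcases hu with rfl | rfl | rfl <;> rcases hv with rfl | rfl | rfl
    · exact (huv rfl).elim
    · exact ⟨0, h.attached_eq hJ hnb⟩
    · exact ⟨1, h.attached_eq hJ hnb⟩
    · exact ⟨0, h.attached_eq hJ (by rw [hnb, pair_comm]; rfl)⟩
    · exact (huv rfl).elim
    · exact ⟨2, h.attached_eq hJ hnb⟩
    · exact ⟨1, h.attached_eq hJ (by rw [hnb, pair_comm]; rfl)⟩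
    · exact ⟨2, h.attached_eq hJ (by rw [hnb, pair_comm]; rfl)⟩
    · exact (huv rfl).elim
  refine ⟨![x, x, y], ![y, z, z], fun i => attached G 𝓙 (![x, x, y] i) (![y, z, z] i),
    fun i => h.attached_eq_empty_or _ _, fun v => ?_, fun i j hij => ?_, fun J hJ _ => hpiece J hJ⟩
  · by_cases hv : v ∈ core 𝓙
    · rw [hc] at hv
      simp only [mem_insert_iff, mem_singleton_iff] at hv
      rcases hv with rfl | rfl | rfl
      exacts [⟨0, Or.inr (Or.inl rfl)⟩, ⟨0, Or.inr (Or.inr rfl)⟩, ⟨1, Or.inr (Or.inr rfl)⟩]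
    · obtain ⟨J, hJ, hvJ⟩ := not_not.1 hv
      obtain ⟨i, rfl⟩ := hpiece J hJ
      exact ⟨i, Or.inl hvJ⟩
  · refine Disjoint.union_right ?_ (disjoint_right.2 ?_)
    · fin_cases i <;> fin_cases j <;> first | exact (hij rfl).elim | skip
      all_goals
        refine h.disjoint_attached ?_ ?_ <;>
          simp [hxy, hxz, hyz, hxy.symm, hxz.symm, hyz.symm]
    · have hcore : ∀ k : Fin 3, ![x, x, y] k ∈ core 𝓙 ∧ ![y, z, z] k ∈ core 𝓙 := by
        intro k
        fin_cases k
        exacts [⟨hx, hy⟩, ⟨hx, hz⟩, ⟨hy, hz⟩]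
      rintro v (rfl | rfl)
      exacts [notMem_attached (hcore j).1 _ _, notMem_attached (hcore j).2 _ _]

theorem feasible_compl_of_tripartite {i : Fin 3} {a b : Fin 3 → V} {K : Fin 3 → Set V}
    (hK : ∀ i, K i = ∅ ∨ K i ∈ 𝓙 ∧ nb G (K i) = {a i, b i}) (hcov : ∀ v, ∃ i, v ∈ K i ∪ {a i, b i})
    (hd : ∀ i j, i ≠ j → Disjoint (K i) (K j ∪ {a j, b j}))
    (hF : ∀ j, j ≠ i → Feasible G (K j)) : Feasible G (K i ∪ {a i, b i})ᶜ := by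
  have hnb : ∀ i, nb G (K i) ⊆ {a i, b i} := fun i => by
    rcases hK i with h | h
    · rw [h, nb_empty]; exact empty_subset _
    · exact h.2.subset
  have hother : ∀ i : Fin 3, ∃ j k : Fin 3, j ≠ i ∧ k ≠ i ∧ k ≠ j ∧
      ∀ l, l = i ∨ l = j ∨ l = k := by
    decide
  obtain ⟨j, k, hji, hki, hkj, hall⟩ := hother i
  refine feasible_compl (hnb i) (hnb j) (hnb k) (hF j hji) (hF k hki) (hd j i hji) (hd k i hki)
    (hd k j hkj) fun v => ?_
  obtain ⟨l, hl⟩ := hcov v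
  rcases hall l with rfl | rfl | rfl
  exacts [Or.inl hl, Or.inr (Or.inl hl), Or.inr (Or.inr hl)]

variable [Finite V]

-- The labels of the search are interpreted by `Linked`, and a pair is small if its part has at most
-- one vertex. A forbidden placement would be an obstruction minor, so the search yields a cover.
open EdgeList in
theorem IsTorso.isTripartite_of_spanIn (h : IsTorso G 𝓙) (h2 : KConnected 2 G)
    (hW : 3 ≤ Nat.card (core 𝓙)) (hO : ObstructionFree G) {g : EdgeList}
    {specs : List Subdivision} {certs : List (ℕ × ℕ)} {rs : List ℕ}
    (hchk : markCheck g specs certs rs = true) (hok : markOK g specs certs rs = true)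
    (hspecs : ∀ s ∈ specs, s ∈ k4Specs ++ (w5Specs ++ sixSpecs) ∧ s.base.order = g.order)
    (hs : SpanIn g (torso G 𝓙)) : IsTripartite G 𝓙 := by
  classical
  obtain ⟨φ', hφ', he⟩ := hs
  let φ : ℕ → V := fun i => φ' i
  have hφc : ∀ i, φ i ∈ core 𝓙 := fun i => (φ' i).2
  have hφ : InjOn φ (Iio g.order) := fun i hi j hj hij => hφ'.injOn hi hj (Subtype.ext hij)
  have hφs : ∀ w ∈ core 𝓙, ∃ i < g.order, φ i = w := fun w hw => by
    obtain ⟨i, hi, hiw⟩ := hφ'.surjOn (mem_univ ⟨w, hw⟩)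
    exact ⟨i, hi, congrArg Subtype.val hiw⟩
  let A := attached G 𝓙
  rcases exists_of_markCheck hchk hok (Sat := fun k u v => Linked G A k (φ u) (φ v))
    (Small := fun u v => (A (φ u) (φ v)).Subsingleton) (fun k u v h => h.symm attached_comm)
    (fun e hee => h.linked_of_adj h2 hW (he e hee))
    (fun u v huv => ⟨Or.inr huv, h.subsingleton_or_linked h2 hW _ _⟩) with
    ⟨s, hss, f, hf, hpat⟩ | ⟨P, U, l, hnd, hlen, hlt, hU, hcov, hsmall, hmark⟩
  · obtain ⟨hs1, hs2⟩ := hspecs s hss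
    refine (hO _ (toEdgeList_mem_obstructions hs1) (Subdivision.isMinor (φ := φ ∘ f) (J := A)
      (wf_specs s hs1) ?_ (fun x y i _ => notMem_attached (hφc _) x y)
      (fun x y x' y' h1 h2 => h.disjoint_attached h1 h2) fun e hee => (hpat e hee).2.2)).elim
    rw [hs2]
    exact hφ.comp hf.injOn hf.mapsTo
  · -- each part is attached at a pair in `P` or in `l`
    have hpiece : ∀ J ∈ 𝓙, ∃ e ∈ P ++ l, A (φ e.1) (φ e.2) = J := by
      intro J hJ
      obtain ⟨x, hx, y, hy, hxy, hnb⟩ := h.exists_pair hJ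
      obtain ⟨i, hi, rfl⟩ := hφs x hx
      obtain ⟨j, hj, rfl⟩ := hφs y hy
      have hij : i ≠ j := fun h => hxy (by rw [h])
      rcases Nat.lt_or_gt_of_ne hij with hlt | hlt
      · exact ⟨_, hmark i j hlt hj (h.linked_of_mem h2 hW hJ hnb), h.attached_eq hJ hnb⟩
      · rw [pair_comm] at hnb
        exact ⟨_, hmark j i hlt hi (h.linked_of_mem h2 hW hJ hnb), h.attached_eq hJ hnb⟩
    have hdisj : ∀ e ∈ P ++ l, ∀ e' ∈ P ++ l, e ≠ e' →
        Disjoint (A (φ e.1) (φ e.2)) (A (φ e'.1) (φ e'.2)) := by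
      intro e hee e' hee' hne
      have h1 := hlt e hee
      have h2 := hlt e' hee'
      refine h.disjoint_attached (fun h => hne (Prod.ext ?_ ?_)) fun h => ?_
      · exact hφ (mem_Iio.2 (by omega)) (mem_Iio.2 (by omega)) h.1
      · exact hφ (mem_Iio.2 (by omega)) (mem_Iio.2 (by omega)) h.2
      · have h3 := hφ (mem_Iio.2 (by omega)) (mem_Iio.2 (by omega)) h.1
        have h4 := hφ (mem_Iio.2 (by omega)) (mem_Iio.2 (by omega)) h.2
        omega
    have hdisjc : ∀ x y, ∀ i j, Disjoint (A x y) {φ i, φ j} := by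
      intro x y i j
      refine disjoint_right.2 ?_
      rintro v (rfl | rfl)
      exacts [notMem_attached (hφc _) x y, notMem_attached (hφc _) x y]
    rcases hlen with ⟨hP, rfl, rfl⟩ | ⟨hP, hUl⟩
    · rw [List.append_nil] at hpiece hdisj
      let p : Fin 3 → ℕ × ℕ := fun i => P[i]
      have hp : ∀ i, p i ∈ P := fun i => List.getElem_mem _
      have hpinj : ∀ i j, i ≠ j → p i ≠ p j := fun i j hij h => hij (Fin.ext
        ((hnd.getElem_inj_iff (hi := by omega) (hj := by omega)).1 h))
      have hps : ∀ e ∈ P, ∃ i, p i = e := fun e hee => by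
        obtain ⟨i, hi, rfl⟩ := List.mem_iff_getElem.1 hee
        exact ⟨⟨i, by omega⟩, rfl⟩
      refine ⟨fun i => φ (p i).1, fun i => φ (p i).2, fun i => A (φ (p i).1) (φ (p i).2),
        fun i => h.attached_eq_empty_or _ _, fun v => ?_, fun i j hij => ?_, fun J hJ _ => ?_⟩
      · by_cases hv : v ∈ core 𝓙
        · obtain ⟨i, hi, rfl⟩ := hφs v hv
          rcases hcov i hi with h' | ⟨e, hee, h'⟩
          · exact (List.not_mem_nil h').elim
          · obtain ⟨j, rfl⟩ := hps e hee
            refine ⟨j, Or.inr ?_⟩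
            rcases h' with rfl | rfl
            exacts [Or.inl rfl, Or.inr rfl]
        · obtain ⟨J, hJ, hvJ⟩ := not_not.1 hv
          obtain ⟨e, hee, rfl⟩ := hpiece J hJ
          obtain ⟨j, rfl⟩ := hps e hee
          exact ⟨j, Or.inl hvJ⟩
      · exact (hdisj _ (hp i) _ (hp j) (hpinj i j hij)).union_right (hdisjc _ _ _ _)
      · obtain ⟨e, hee, rfl⟩ := hpiece J hJ
        obtain ⟨j, rfl⟩ := hps e hee
        exact ⟨j, rfl⟩
    -- Two pairs carry parts. The third piece has an empty part, and its pair collects the uncovered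
    -- core vertices and the vertices of the small parts, at most two in total.
    · obtain ⟨p, q, rfl⟩ := List.length_eq_two.1 hP
      have hpq : p ≠ q := fun h => by simp [h] at hnd
      -- the remaining single vertices
      let pt : ℕ × ℕ → V := fun e =>
        if hne : (A (φ e.1) (φ e.2)).Nonempty then hne.some else φ 0
      let Q : List V := U.map φ ++ (l.filter fun e => e ∉ [p, q]).map pt
      have hQlen : Q.length ≤ 2 := by
        have := List.length_filter_le (fun e => decide (e ∉ [p, q])) l
        simp only [Q, List.length_append, List.length_map]
        omega
      have hQ : ∀ v ∈ φ 0 :: Q, v ∉ A (φ p.1) (φ p.2) ∧ v ∉ A (φ q.1) (φ q.2) := by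
        have hc : ∀ i, φ i ∉ A (φ p.1) (φ p.2) ∧ φ i ∉ A (φ q.1) (φ q.2) := fun i =>
          ⟨notMem_attached (hφc i) _ _, notMem_attached (hφc i) _ _⟩
        intro v hv
        rcases List.mem_cons.1 hv with rfl | hv
        · exact hc 0
        · rcases List.mem_append.1 hv with hv | hv
          · obtain ⟨i, -, rfl⟩ := List.mem_map.1 hv
            exact hc i
          · obtain ⟨e, hee, rfl⟩ := List.mem_map.1 hv
            obtain ⟨hel, hepq⟩ := List.mem_filter.1 hee
            simp only [List.mem_cons, List.not_mem_nil, or_false, not_or, decide_eq_true_eq] at hepq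
            by_cases hne : (A (φ e.1) (φ e.2)).Nonempty
            · have hpt : pt e ∈ A (φ e.1) (φ e.2) := by
                simp only [pt, dif_pos hne]
                exact hne.some_mem
              exact ⟨disjoint_left.1 (hdisj e (by simp [hel]) p (by simp) hepq.1) hpt,
                disjoint_left.1 (hdisj e (by simp [hel]) q (by simp) hepq.2) hpt⟩
            · simp only [pt, dif_neg hne]
              exact hc 0
      -- If `Q` has fewer than two members, the pair is filled up by repetition or by `φ 0`, which
      -- lies in the core and hence in no part.
      obtain ⟨a, ha, b, hb, hab⟩ : ∃ a ∈ φ 0 :: Q, ∃ b ∈ φ 0 :: Q, ∀ v ∈ Q, v = a ∨ v = b := by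
        match Q, hQlen with
        | [], _ => exact ⟨φ 0, by simp, φ 0, by simp, by simp⟩
        | [a], _ => exact ⟨a, by simp, a, by simp, by simp⟩
        | [a, b], _ => exact ⟨a, by simp, b, by simp, by simp⟩
      have hQab : ∀ v ∈ Q, v ∈ ({a, b} : Set V) := hab
      have hdab : ∀ e ∈ [p, q], Disjoint (A (φ e.1) (φ e.2)) {a, b} := by
        intro e hee
        simp only [List.mem_cons, List.not_mem_nil, or_false] at hee
        refine disjoint_right.2 ?_
        rintro v (rfl | rfl) <;> rcases hee with rfl | rfl
        exacts [(hQ _ ha).1, (hQ _ ha).2, (hQ _ hb).1, (hQ _ hb).2]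
      refine ⟨![φ p.1, φ q.1, a], ![φ p.2, φ q.2, b], ![A (φ p.1) (φ p.2), A (φ q.1) (φ q.2), ∅],
        ?_, fun v => ?_, ?_, fun J hJ hJn => ?_⟩
      · intro i
        fin_cases i
        exacts [h.attached_eq_empty_or _ _, h.attached_eq_empty_or _ _, Or.inl rfl]
      · by_cases hv : v ∈ core 𝓙
        · obtain ⟨i, hi, rfl⟩ := hφs v hv
          rcases hcov i hi with h' | ⟨e, hee, h'⟩
          · exact ⟨2, Or.inr (hQab _ (List.mem_append_left _ (List.mem_map_of_mem h')))⟩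
          · simp only [List.mem_cons, List.not_mem_nil, or_false] at hee
            rcases hee with rfl | rfl
            · refine ⟨0, Or.inr ?_⟩
              rcases h' with rfl | rfl
              exacts [Or.inl rfl, Or.inr rfl]
            · refine ⟨1, Or.inr ?_⟩
              rcases h' with rfl | rfl
              exacts [Or.inl rfl, Or.inr rfl]
        · obtain ⟨J, hJ, hvJ⟩ := not_not.1 hv
          obtain ⟨e, hee, rfl⟩ := hpiece J hJ
          by_cases hepq : e ∈ [p, q]
          · simp only [List.mem_cons, List.not_mem_nil, or_false] at hepq
            rcases hepq with rfl | rfl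
            exacts [⟨0, Or.inl hvJ⟩, ⟨1, Or.inl hvJ⟩]
          · have hel := (List.mem_append.1 hee).resolve_left hepq
            have hpt : pt e ∈ A (φ e.1) (φ e.2) := by
              have hne : (A (φ e.1) (φ e.2)).Nonempty := ⟨v, hvJ⟩
              simp only [pt, dif_pos hne]
              exact hne.some_mem
            rw [hsmall e hel hvJ hpt]
            exact ⟨2, Or.inr (hQab _ (List.mem_append_right _ (List.mem_map_of_mem
              (List.mem_filter.2 ⟨hel, by simpa using hepq⟩))))⟩
      · have h01 := hdisj p (by simp) q (by simp) hpq
        intro i j hij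
        fin_cases i <;> fin_cases j
        · exact (hij rfl).elim
        · exact h01.union_right (hdisjc _ _ _ _)
        · exact (disjoint_empty _).union_right (hdab p (by simp))
        · exact h01.symm.union_right (hdisjc _ _ _ _)
        · exact (hij rfl).elim
        · exact (disjoint_empty _).union_right (hdab q (by simp))
        · exact empty_disjoint _
        · exact empty_disjoint _
        · exact (hij rfl).elim
      · obtain ⟨e, hee, rfl⟩ := hpiece J hJ
        rcases List.mem_append.1 hee with hee | hee
        · simp only [List.mem_cons, List.not_mem_nil, or_false] at hee
          rcases hee with rfl | rfl
          exacts [⟨0, rfl⟩, ⟨1, rfl⟩]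
        · exact (not_subsingleton_iff.2 hJn (hsmall e hee)).elim

-- A torso on seven or more vertices would contain a member of `obs3`; smaller ones are settled by
-- their spanning subgraph and the corresponding search.
open EdgeList in
theorem IsTorso.isTripartite (h : IsTorso G 𝓙) (h2 : KConnected 2 G) (hO : ObstructionFree G)
    (hW : 3 ≤ Nat.card (core 𝓙)) (h3 : KConnected 3 (torso G 𝓙)) : IsTripartite G 𝓙 := by
  have h4 : ∀ s ∈ k4Specs, s ∈ k4Specs ++ (w5Specs ++ sixSpecs) ∧ s.base.order = 4 := by
    refine fun s hs => ⟨by simp [hs], ?_⟩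
    revert s
    decide
  have h5 : ∀ s ∈ w5Specs, s ∈ k4Specs ++ (w5Specs ++ sixSpecs) ∧ s.base.order = 5 := by
    refine fun s hs => ⟨by simp [hs], ?_⟩
    revert s
    decide
  have h6 : ∀ s ∈ sixSpecs, s ∈ k4Specs ++ (w5Specs ++ sixSpecs) ∧ s.base.order = 6 := by
    refine fun s hs => ⟨by simp [hs], ?_⟩
    revert s
    decide
  rcases Nat.lt_or_ge (Nat.card (core 𝓙)) 7 with hlt | hge
  · have : Nat.card (core 𝓙) = 3 ∨ Nat.card (core 𝓙) = 4 ∨ Nat.card (core 𝓙) = 5 ∨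
      Nat.card (core 𝓙) = 6 := by omega
    rcases this with hc | hc | hc | hc
    · exact h.isTripartite_of_card_eq_three hc
    · exact h.isTripartite_of_spanIn h2 hW hO markCheck_k4 markOK_k4 h4 (h3.spanIn_k4 hc)
    · exact h.isTripartite_of_spanIn h2 hW hO markCheck_w5 markOK_w5 h5 (h3.spanIn_w5 hc)
    · rcases h3.spanIn_six hc with hs | hs | hs
      · exact h.isTripartite_of_spanIn h2 hW hO markCheck_k33 markOK_k33 h6 hs
      · exact h.isTripartite_of_spanIn h2 hW hO markCheck_prism markOK_prism h6 hs
      · exact h.isTripartite_of_spanIn h2 hW hO markCheck_w6 markOK_w6 h6 hs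
  · obtain ⟨T, hT, hm⟩ := h3.exists_isMinor_obs3 hge
    exact (hO T (by simp [obstructions, hT]) (hm.trans (h.isMinor_torso h2 hW))).elim

end Tripartite

/-! ### Small separations -/

section Separations

variable {V : Type*} {G : SimpleGraph V}

/-- Submodularity of the number of neighbours, used to uncross separations of order two. -/
theorem ncard_nb_inter_add_ncard_nb_union [Finite V] (J K : Set V) :
    (nb G (J ∩ K)).ncard + (nb G (J ∪ K)).ncard ≤ (nb G J).ncard + (nb G K).ncard := by
  rw [← ncard_union_add_ncard_inter, ← ncard_union_add_ncard_inter (nb G J)]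
  refine add_le_add (ncard_le_ncard ?_) (ncard_le_ncard ?_)
  · rintro v (⟨hv, u, hu, huv⟩ | ⟨hv, u, hu, huv⟩)
    · by_cases hvJ : v ∈ J
      · exact Or.inr ⟨fun h => hv ⟨hvJ, h⟩, u, hu.2, huv⟩
      · exact Or.inl ⟨hvJ, u, hu.1, huv⟩
    · rcases hu with hu | hu
      · exact Or.inl ⟨fun h => hv (Or.inl h), u, hu, huv⟩
      · exact Or.inr ⟨fun h => hv (Or.inr h), u, hu, huv⟩
  · rintro v ⟨⟨-, u, hu, huv⟩, hv, -⟩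
    exact ⟨⟨fun h => hv (Or.inl h), u, hu.1, huv⟩, fun h => hv (Or.inr h), u, hu.2, huv⟩

theorem exists_subset_pair [Finite V] [Nonempty V] {S : Set V} (h : S.ncard ≤ 2) :
    ∃ a b, S ⊆ {a, b} := by
  rcases Nat.lt_or_ge S.ncard 2 with h' | h'
  · rcases (ncard_le_one_iff_eq).1 (Nat.lt_succ_iff.1 h') with rfl | ⟨a, rfl⟩
    · obtain ⟨a⟩ := ‹Nonempty V›
      exact ⟨a, a, empty_subset _⟩
    · exact ⟨a, a, by simp⟩
  · obtain ⟨a, b, -, rfl⟩ := ncard_eq_two.1 (le_antisymm h h')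
    exact ⟨a, b, Subset.rfl⟩

theorem nb_subset_union {J I : Set V} (h : J ⊆ I) : nb G J ⊆ I ∪ nb G I := by
  rintro v ⟨-, u, hu, huv⟩
  exact mem_or_mem_nb (h hu) huv

theorem nb_union_subset (J K : Set V) : nb G (J ∪ K) ⊆ (nb G J \ K) ∪ (nb G K \ J) := by
  rintro v ⟨hv, u, hu, huv⟩
  rw [mem_union, not_or] at hv
  rcases hu with hu | hu
  exacts [Or.inl ⟨⟨hv.1, u, hu, huv⟩, hv.2⟩, Or.inr ⟨⟨hv.2, u, hu, huv⟩, hv.1⟩]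

theorem nb_compl_subset (J : Set V) : nb G (J ∪ nb G J)ᶜ ⊆ nb G J := by
  rintro v ⟨hv, u, hu, huv⟩
  rcases not_not.1 hv with h | h
  · exact (hu (mem_or_mem_nb h huv.symm)).elim
  · exact h

variable {𝓙 : Set (Set V)}

/-- A set of vertices of the torso together with the parts attached at it. -/
def expand (G : SimpleGraph V) (𝓙 : Set (Set V)) (S : Set (core 𝓙)) : Set V :=
  Subtype.val '' S ∪ {v | ∃ J ∈ 𝓙, (∃ s ∈ S, (s : V) ∈ nb G J) ∧ v ∈ J}

theorem mem_expand_iff {S : Set (core 𝓙)} {w : core 𝓙} : (w : V) ∈ expand G 𝓙 S ↔ w ∈ S := by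
  refine ⟨?_, fun h => Or.inl ⟨w, h, rfl⟩⟩
  rintro (⟨s, hs, h⟩ | ⟨J, hJ, -, h⟩)
  · rwa [← Subtype.ext h]
  · exact (w.2 ⟨J, hJ, h⟩).elim

theorem IsTorso.nb_subset_core (h : IsTorso G 𝓙) {J : Set V} (hJ : J ∈ 𝓙) : nb G J ⊆ core 𝓙 := by
  rintro v hv ⟨K, hK, hvK⟩
  exact disjoint_left.1 (h.nb_disjoint J hJ K hK) hv hvK

/-- Separations of the torso thereby lift to separations of `G` of no larger order: an attachment of
a part at `S` that lies outside `S` is adjacent in the torso to the other attachment, which is in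
`S`. -/
theorem IsTorso.nb_expand_subset (h : IsTorso G 𝓙) (S : Set (core 𝓙)) :
    nb G (expand G 𝓙 S) ⊆ Subtype.val '' nb (torso G 𝓙) S := by
  rintro v ⟨hv, u, hu | ⟨J, hJ, ⟨s, hs, hsJ⟩, huJ⟩, huv⟩
  · obtain ⟨u, hu, rfl⟩ := hu
    by_cases hvc : v ∈ core 𝓙
    · refine ⟨⟨v, hvc⟩, ⟨fun h => hv (Or.inl ⟨_, h, rfl⟩), u, hu, fun h => ?_, Or.inl huv⟩, rfl⟩
      exact huv.ne (congrArg Subtype.val h)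
    · obtain ⟨J, hJ, hvJ⟩ := not_not.1 hvc
      refine (hv (Or.inr ⟨J, hJ, ⟨u, hu, ?_⟩, hvJ⟩)).elim
      exact ⟨fun h => u.2 ⟨J, hJ, h⟩, v, hvJ, huv.symm⟩
  · have hvJ : v ∈ nb G J := (mem_or_mem_nb huJ huv).resolve_left fun h =>
      hv (Or.inr ⟨J, hJ, ⟨s, hs, hsJ⟩, h⟩)
    have hvS : (⟨v, h.nb_subset_core hJ hvJ⟩ : core 𝓙) ∉ S := fun h => hv (Or.inl ⟨_, h, rfl⟩)
    have hne : s ≠ ⟨v, h.nb_subset_core hJ hvJ⟩ := fun h => hvS (h ▸ hs)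
    refine ⟨⟨v, h.nb_subset_core hJ hvJ⟩, ⟨hvS, s, hs, hne, Or.inr ⟨J, hJ, ?_⟩⟩, rfl⟩
    have hne' : (s : V) ≠ v := fun h => hne (Subtype.ext h)
    have hcard := h.ncard_nb J hJ
    refine (eq_of_subset_of_ncard_le ?_ ?_ (finite_of_ncard_ne_zero (by omega))).symm
    · rintro w (rfl | rfl)
      exacts [hsJ, hvJ]
    · rw [hcard, ncard_pair hne']

theorem IsTorso.ncard_nb_expand_le [Finite V] (h : IsTorso G 𝓙) (S : Set (core 𝓙)) :
    (nb G (expand G 𝓙 S)).ncard ≤ (nb (torso G 𝓙) S).ncard :=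
  (ncard_le_ncard (h.nb_expand_subset S)).trans (ncard_image_le (toFinite _))

/-- One side of a separation with two large sides is feasible. -/
theorem KConnected.feasible_of_ncard_nb_le [Finite V] (h2 : KConnected 2 G) (hO : ObstructionFree G)
    {I : Set V} (hI : (nb G I).ncard ≤ 2) (hR : (I ∪ nb G I)ᶜ.Nontrivial) : Feasible G I := by
  induction hn : I.ncard using Nat.strong_induction_on generalizing I with | _ n ih => ?_
  subst hn
  -- In a minimal counterexample all properly smaller sets with at most two neighbours are feasible.
  -- The maximal ones among them, together with the outside `R`, give a 3-connected torso, and its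
  -- tripartition makes `I` feasible after all.
  by_contra hF
  have hIne : I.Nonempty := by
    by_contra hne
    exact hF (Or.inl (not_nonempty_iff_eq_empty.1 hne))
  set R : Set V := (I ∪ nb G I)ᶜ with hRdef
  obtain ⟨o, ho⟩ := hR.nonempty
  have : Nonempty V := ⟨o⟩
  have hnbsub : ∀ J ⊆ I, J ∪ nb G J ⊆ I ∪ nb G I := fun J hJ =>
    union_subset (hJ.trans subset_union_left) (nb_subset_union hJ)
  have hIH : ∀ J, J ⊂ I → (nb G J).ncard ≤ 2 → Feasible G J := fun J hJ hJ2 =>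
    ih _ (ncard_lt_ncard hJ) hJ2 (hR.mono (compl_subset_compl.2 (hnbsub J hJ.1))) rfl
  have htwo : ∀ J ⊆ I, J.Nonempty → 2 ≤ (nb G J).ncard := fun J hJ hne =>
    h2 J hne ⟨o, fun h => ho (hnbsub J hJ (Or.inl h)), fun h => ho (hnbsub J hJ (Or.inr h))⟩
  have hcovI : Cov2 G I := by
    obtain ⟨a, b, hab⟩ := exists_subset_pair hI
    exact cov2_of_nb hab
  -- no proper part has its neighbours among those of `I`
  have hproper : ∀ J, J ⊂ I → J.Nonempty → ¬ nb G J ⊆ nb G I := by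
    intro J hJ hne hsub
    have hdiff : nb G (I \ J) ⊆ nb G I := by
      rintro v ⟨hv, u, hu, huv⟩
      refine (mem_or_mem_nb hu.1 huv).resolve_left fun hvI => ?_
      have hvJ : v ∈ J := by
        by_contra h
        exact hv ⟨hvI, h⟩
      exact (hsub ((mem_or_mem_nb hvJ huv.symm).resolve_left hu.2)).1 hu.1
    have hss : I \ J ⊂ I := ⟨sdiff_subset, fun h => by
      obtain ⟨v, hv⟩ := hne
      exact (h (hJ.1 hv)).2 hv⟩
    refine hF ?_
    rw [← union_sdiff_cancel hJ.1] at hcovI ⊢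
    exact (hIH J hJ ((ncard_le_ncard hsub).trans hI)).union
      (hIH _ hss ((ncard_le_ncard hdiff).trans hI)) disjoint_sdiff_right hcovI
  -- A lump is a set to which the induction hypothesis applies. Each has a neighbour inside `I`,
  -- since otherwise its neighbours would all be among those of `I`.
  let Lump : Set V → Prop := fun J => J ⊂ I ∧ J.Nonempty ∧ (nb G J).ncard ≤ 2
  have hinter : ∀ J, Lump J → 1 ≤ (nb G J ∩ I).ncard := by
    intro J hJ
    rw [Nat.one_le_iff_ne_zero, Ne, ncard_eq_zero]
    intro hemp
    refine hproper J hJ.1 hJ.2.1 fun v hv => (nb_subset_union hJ.1.1 hv).resolve_left fun hvI => ?_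
    exact notMem_empty v (hemp ▸ ⟨hv, hvI⟩)
  -- The point is that two lumps cannot exhaust `I`; if they did, `I` would be feasible.
  have hunion : ∀ J K, Lump J → Lump K → (nb G (J ∪ K)).ncard ≤ 2 → Lump (J ∪ K) := by
    intro J K hJ hK hJK
    refine ⟨⟨union_subset hJ.1.1 hK.1.1, fun hsub => hF ?_⟩, hJ.2.1.inl, hJK⟩
    have hIJK : I ⊆ J ∪ K := hsub
    -- Suppose `J ∪ K = I`. Take `J` with its neighbours inside `I` as one branch and the rest `L`
    -- as the other; the neighbours of `L` are neighbours of `J` inside `I` or of `K` outside.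
    set L := I \ (J ∪ nb G J) with hL
    have hLsub : nb G L ⊆ (nb G J ∩ I) ∪ (nb G K \ I) := by
      rintro v ⟨hv, u, hu, huv⟩
      by_cases hvI : v ∈ I
      · refine Or.inl ⟨?_, hvI⟩
        by_contra hvJ
        have hvJ' : v ∈ J := by
          by_contra h
          exact hv ⟨hvI, fun h' => h'.elim h hvJ⟩
        exact hu.2 (mem_or_mem_nb hvJ' huv.symm)
      · have huK : u ∈ K := (hIJK hu.1).resolve_left fun h => hu.2 (Or.inl h)
        exact Or.inr ⟨⟨fun h => hvI (hK.1.1 h), u, huK, huv⟩, hvI⟩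
    have hLcard : (nb G L).ncard ≤ 2 := by
      have h3 := (ncard_le_ncard hLsub).trans (ncard_union_le _ _)
      have h4 := ncard_inter_add_ncard_sdiff_eq_ncard (nb G J) I
      have h5 := ncard_inter_add_ncard_sdiff_eq_ncard (nb G K) I
      have h6 := hinter K hK
      have h7 := hJ.2.2
      have h8 := hK.2.2
      by_contra hcon
      -- More than two neighbours would force all neighbours of `J` into `I`. Then `I` has only
      -- neighbours of `K` outside `I`, of which there is at most one, contrary to 2-connectivity.
      have h9 : (nb G J \ I).ncard = 0 := by omega
      rw [ncard_eq_zero, sdiff_eq_empty] at h9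
      have h10 : nb G I ⊆ nb G K \ I := by
        rintro v ⟨hv, u, hu, huv⟩
        rcases hIJK hu with hu | hu
        · exact (hv (h9 ⟨fun h => hv (hJ.1.1 h), u, hu, huv⟩)).elim
        · exact ⟨⟨fun h => hv (hK.1.1 h), u, hu, huv⟩, hv⟩
      have h11 := ncard_le_ncard h10
      have h12 := htwo I Subset.rfl hIne
      omega
    have hLss : L ⊂ I := ⟨sdiff_subset, fun h => by
      obtain ⟨v, hv⟩ := hJ.2.1
      exact (h (hJ.1.1 hv)).2 (Or.inl hv)⟩
    obtain ⟨a, b, hab⟩ := exists_subset_pair hJ.2.2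
    have hFJ : Feasible G (I ∩ (J ∪ nb G J)) := (hIH J hJ.1 hJ.2.2).of_subset hab
      (fun v hv => ⟨hJ.1.1 hv, Or.inl hv⟩) fun v hv => hv.2.imp_right fun h => hab h
    have heq : I ∩ (J ∪ nb G J) ∪ L = I := inter_union_sdiff I _
    rw [← heq]
    exact hFJ.union (hIH L hLss hLcard) (disjoint_left.2 fun v h h' => h'.2 h.2) (by rwa [heq])
  let MaxLump : Set V → Prop := Maximal Lump
  have hmax : ∀ J, Lump J → ∃ M, J ⊆ M ∧ MaxLump M := fun J hJ => by
    obtain ⟨M, h, hM⟩ := Finite.exists_le_maximal hJ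
    exact ⟨M, h, hM⟩
  have hmaxunion : ∀ J K, MaxLump J → MaxLump K → J ≠ K → 2 < (nb G (J ∪ K)).ncard := by
    intro J K hJ hK hne
    by_contra hle
    have hl := hunion J K hJ.1 hK.1 (by omega)
    have h3 : J ∪ K ⊆ J := hJ.2 hl subset_union_left
    have h4 : J ∪ K ⊆ K := hK.2 hl subset_union_right
    exact hne ((subset_union_left.trans h4).antisymm (subset_union_right.trans h3))
  -- If two maximal lumps meet, their intersection has at least two neighbours, so by submodularity
  -- their union has at most two and is a larger lump.
  have hmaxdisj : ∀ J K, MaxLump J → MaxLump K → J ≠ K → Disjoint J K := by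
    intro J K hJ hK hne
    by_contra hd
    rw [not_disjoint_iff_nonempty_inter] at hd
    have h3 := hmaxunion J K hJ hK hne
    have h4 := ncard_nb_inter_add_ncard_nb_union (G := G) J K
    have h5 := htwo (J ∩ K) (inter_subset_left.trans hJ.1.1.1) hd
    have h6 := hJ.1.2.2
    have h7 := hK.1.2.2
    omega
  have hnbR : nb G R ⊆ nb G I := nb_compl_subset I
  have hnbRI : nb G R = nb G I := by
    obtain ⟨i, hi⟩ := hIne
    refine eq_of_subset_of_ncard_le hnbR (hI.trans (h2 R ⟨o, ho⟩ ⟨i, fun h => h (Or.inl hi), ?_⟩))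
    exact fun h => (hnbR h).1 hi
  have hnbI2 : (nb G I).ncard = 2 := le_antisymm hI (htwo I Subset.rfl hIne)
  -- The outside `R` is itself one of the parts, so the torso sees it as an edge between the two
  -- neighbours of `I`.
  let 𝓙 : Set (Set V) := insert R {J | MaxLump J}
  have hRI : ∀ v ∈ R, v ∉ I := fun v hv h => hv (Or.inl h)
  have hT : IsTorso G 𝓙 := by
    refine ⟨?_, ?_, ?_, ?_, ?_⟩
    · rintro J (rfl | hJ)
      exacts [⟨o, ho⟩, hJ.1.2.1]
    · rintro J (rfl | hJ) K (rfl | hK) hne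
      · exact (hne rfl).elim
      · exact disjoint_left.2 fun v hv hvK => hRI v hv (hK.1.1.1 hvK)
      · exact disjoint_right.2 fun v hv hvJ => hRI v hv (hJ.1.1.1 hvJ)
      · exact hmaxdisj J K hJ hK hne
    · rintro J (rfl | hJ)
      · rw [hnbRI, hnbI2]
      · exact le_antisymm hJ.1.2.2 (htwo J hJ.1.1.1 hJ.1.2.1)
    · rintro J (rfl | hJ) K (rfl | hK) heq
      · rfl
      · exact (hproper K hK.1.1 hK.1.2.1 (heq ▸ hnbR)).elim
      · exact (hproper J hJ.1.1 hJ.1.2.1 (heq ▸ hnbR)).elim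
      · by_contra hne
        have h3 := hmaxunion J K hJ hK hne
        have h4 : nb G (J ∪ K) ⊆ nb G J := (nb_union_subset J K).trans
          (union_subset sdiff_subset (sdiff_subset.trans heq.symm.subset))
        have h5 := ncard_le_ncard h4
        have h6 := hJ.1.2.2
        omega
    · rintro J hJ K hK
      refine disjoint_left.2 fun v hvJ hvK => ?_
      by_cases hne : J = K
      · exact hvJ.1 (hne ▸ hvK)
      rcases hJ with rfl | hJ <;> rcases hK with rfl | hK
      · exact hne rfl
      · exact (hnbR hvJ).1 (hK.1.1.1 hvK)
      · exact hvK (nb_subset_union hJ.1.1.1 hvJ)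
      -- An edge between two maximal lumps uses up one neighbour of each, so their union would have
      -- at most two neighbours.
      · have hvJ' := hvJ
        obtain ⟨-, u, hu, huv⟩ := hvJ'
        have huK : u ∈ nb G K := (mem_or_mem_nb hvK huv.symm).resolve_left fun h =>
          disjoint_left.1 (hmaxdisj J K hJ hK hne) hu h
        have h3 := hmaxunion J K hJ hK hne
        have h4 := (ncard_le_ncard (nb_union_subset (G := G) J K)).trans (ncard_union_le _ _)
        have h5 : (nb G J \ K).ncard < (nb G J).ncard :=
          ncard_lt_ncard ⟨sdiff_subset, fun h => (h hvJ).2 hvK⟩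
        have h6 : (nb G K \ J).ncard < (nb G K).ncard :=
          ncard_lt_ncard ⟨sdiff_subset, fun h => (h huK).2 hu⟩
        have h7 := hJ.1.2.2
        have h8 := hK.1.2.2
        omega
  have hR𝓙 : R ∈ 𝓙 := Or.inl rfl
  have hnbcore : nb G I ⊆ core 𝓙 := hnbRI ▸ hT.nb_subset_core hR𝓙
  have hW : 3 ≤ Nat.card (core 𝓙) := by
    change 3 ≤ (core 𝓙).ncard
    by_contra hlt
    -- A smaller core would consist of the two neighbours of `I`, so a maximal lump inside `I` would
    -- be attached there, against `hproper`.
    have heq : nb G I = core 𝓙 := eq_of_subset_of_ncard_le hnbcore (by omega)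
    obtain ⟨i, hi⟩ := hIne
    have hic : i ∉ core 𝓙 := fun h => (heq ▸ h : i ∈ nb G I).1 hi
    obtain ⟨J, hJ, hiJ⟩ := not_not.1 hic
    rcases hJ with rfl | hJ
    · exact hRI i hiJ hi
    · exact hproper J hJ.1.1 hJ.1.2.1 (heq ▸ hT.nb_subset_core (Or.inr hJ))
  -- A separated set of the torso that avoids the neighbours of `I` expands to a lump, which lies in
  -- a maximal lump and so cannot contain core vertices.
  have hmeet : ∀ S : Set (core 𝓙), S.Nonempty → (∃ w, w ∉ S ∧ w ∉ nb (torso G 𝓙) S) →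
      (nb (torso G 𝓙) S).ncard ≤ 2 → ∃ s ∈ S, (s : V) ∈ nb G I := by
    rintro S ⟨s, hs⟩ ⟨w, hwS, hwn⟩ hcard
    by_contra! hcon
    have hsub : expand G 𝓙 S ⊆ I := by
      rintro v (⟨t, ht, rfl⟩ | ⟨J, hJ, ⟨t, ht, htJ⟩, hv⟩)
      · by_contra htI
        exact t.2 ⟨R, hR𝓙, fun h => h.elim htI (hcon t ht)⟩
      · rcases hJ with rfl | hJ
        · exact (hcon t ht (hnbR htJ)).elim
        · exact hJ.1.1.1 hv
    have hlump : Lump (expand G 𝓙 S) := by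
      refine ⟨⟨hsub, fun hIsub => ?_⟩, ⟨s, mem_expand_iff.2 hs⟩,
        (hT.ncard_nb_expand_le S).trans hcard⟩
      have heq : expand G 𝓙 S = I := hsub.antisymm hIsub
      have hw : (w : V) ∈ nb G I := by
        by_contra hwn'
        refine w.2 ⟨R, hR𝓙, fun h => h.elim (fun h => hwS ?_) hwn'⟩
        rw [← heq] at h
        exact mem_expand_iff.1 h
      rw [← heq] at hw
      obtain ⟨w', hw', hww'⟩ := hT.nb_expand_subset S hw
      rw [Subtype.ext hww'] at hw'
      exact hwn hw'
    obtain ⟨M, hSM, hM⟩ := hmax _ hlump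
    exact s.2 ⟨M, Or.inr hM, hSM (mem_expand_iff.2 hs)⟩
  -- Both sides of a separation of order at most two would contain a neighbour of `I`. The two
  -- neighbours are adjacent in the torso because of the part `R`, a contradiction.
  have h3 : KConnected 3 (torso G 𝓙) := by
    intro S hS hw
    by_contra hlt
    obtain ⟨s, hs, hsI⟩ := hmeet S hS hw (by omega)
    obtain ⟨w, hwS, hwn⟩ := hw
    obtain ⟨t, ht, htI⟩ := hmeet (S ∪ nb (torso G 𝓙) S)ᶜ ⟨w, fun h => h.elim hwS hwn⟩
      ⟨s, fun h => h (Or.inl hs), fun h => (nb_compl_subset S h).1 hs⟩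
      ((ncard_le_ncard (nb_compl_subset S)).trans (by omega))
    have hst : s ≠ t := fun h => ht (Or.inl (h ▸ hs))
    have hnb : nb G R = {(s : V), (t : V)} := by
      rw [hnbRI]
      refine (eq_of_subset_of_ncard_le ?_ ?_).symm
      · rintro v (rfl | rfl)
        exacts [hsI, htI]
      · rw [hnbI2, ncard_pair fun h => hst (Subtype.ext h)]
    have hadj : (torso G 𝓙).Adj s t := ⟨hst, Or.inr ⟨R, hR𝓙, hnb⟩⟩
    exact ht (mem_or_mem_nb hs hadj)
  obtain ⟨a, b, K, hK, hcov, hd, hbig⟩ := hT.isTripartite h2 hO hW h3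
  -- Here it matters that `R` has at least two vertices: only such parts are guaranteed to be one of
  -- the three pieces. The complement of that piece is `I`.
  obtain ⟨i, hi⟩ := hbig R hR𝓙 hR
  have hfeas := feasible_compl_of_tripartite (i := i) hK hcov hd fun j hj => by
    rcases hK j with h | ⟨h, -⟩
    · exact Or.inl h
    · rcases h with h | h
      · have := hd j i hj
        rw [h, hi] at this
        exact (disjoint_left.1 this ho (Or.inl ho)).elim
      · exact hIH _ h.1.1 h.1.2.2
  have hKi : nb G (K i) = {a i, b i} := by
    rcases hK i with h | h
    · rw [hi] at h
      exact (notMem_empty o (h ▸ ho)).elim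
    · exact h.2
  rw [← hKi, hi, hnbRI] at hfeas
  refine hF ?_
  convert hfeas using 1
  ext v
  simp only [hRdef, mem_compl_iff, mem_union]
  have : v ∈ nb G I → v ∉ I := fun h => h.1
  tauto

/-- A separation of order two with two nontrivial sides is handled by
`KConnected.feasible_of_ncard_nb_le` on both sides. If there is none, only single vertices are cut
off by two vertices, and they are the parts of a 3-connected torso. -/
theorem KConnected.feasible_univ [Finite V] (h2 : KConnected 2 G) (hO : ObstructionFree G) :
    Feasible G univ := by
  rcases Nat.lt_or_ge 6 (Nat.card V) with hV | hV
  swap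
  · exact feasible_univ_of_card_le hV
  have hne : Nonempty V := (Nat.card_pos_iff.1 (by omega)).1
  by_cases hsep : ∃ J : Set V, (nb G J).ncard ≤ 2 ∧ J.Nontrivial ∧ (J ∪ nb G J)ᶜ.Nontrivial
  · obtain ⟨J, hJ, hJ1, hJ2⟩ := hsep
    obtain ⟨a, b, hab⟩ := exists_subset_pair hJ
    have hFJ : Feasible G (J ∪ nb G J) := (h2.feasible_of_ncard_nb_le hO hJ hJ2).of_subset hab
      subset_union_left (union_subset_union_right _ hab)
    have hFR : Feasible G (J ∪ nb G J)ᶜ := by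
      refine h2.feasible_of_ncard_nb_le hO ((ncard_le_ncard (nb_compl_subset J)).trans hJ)
        (hJ1.mono fun v hv h => ?_)
      rcases h with h | h
      exacts [h (Or.inl hv), (nb_compl_subset J h).1 hv]
    rw [← union_compl_self (J ∪ nb G J)]
    refine hFJ.union hFR disjoint_compl_right ?_
    rw [union_compl_self]
    exact ⟨a, a, fun _ _ y hy => (hy (mem_univ y)).elim⟩
  push Not at hsep
  -- The far side would have at most one vertex, giving at most `2 + 2 + 1` vertices in all, but
  -- there are at least seven.
  have hsmall : ∀ J : Set V, (nb G J).ncard ≤ 2 → J.ncard = 2 → False := by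
    intro J hJ hJ2
    have h3 := hsep J hJ (by
      obtain ⟨x, y, hxy, rfl⟩ := ncard_eq_two.1 hJ2
      exact ⟨x, Or.inl rfl, y, Or.inr rfl, hxy⟩)
    have h4 : (J ∪ nb G J)ᶜ.ncard ≤ 1 := ncard_le_one_iff_subsingleton.2 h3
    have h5 := ncard_add_ncard_compl (J ∪ nb G J)
    have h6 := ncard_union_le J (nb G J)
    omega
  let 𝓙 : Set (Set V) := {J | ∃ v, J = {v} ∧ (nb G {v}).ncard ≤ 2}
  have hnb2 : ∀ v, (nb G {v}).ncard ≤ 2 → (nb G {v}).ncard = 2 := by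
    intro v hv
    refine le_antisymm hv (h2 {v} ⟨v, rfl⟩ ?_)
    by_contra! hcon
    have : (univ : Set V) ⊆ {v} ∪ nb G {v} := fun w _ => by
      by_cases hw : w ∈ ({v} : Set V)
      exacts [Or.inl hw, Or.inr (hcon w hw)]
    have h3 := (ncard_le_ncard this).trans (ncard_union_le _ _)
    rw [ncard_univ, ncard_singleton] at h3
    omega
  have hT : IsTorso G 𝓙 := by
    refine ⟨?_, ?_, ?_, ?_, ?_⟩
    · rintro _ ⟨v, rfl, -⟩
      exact ⟨v, rfl⟩
    · rintro _ ⟨v, rfl, -⟩ _ ⟨w, rfl, -⟩ hvw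
      exact disjoint_singleton.2 fun h => hvw (by rw [h])
    · rintro _ ⟨v, rfl, hv⟩
      exact hnb2 v hv
    · rintro _ ⟨v, rfl, hv⟩ _ ⟨w, rfl, hw⟩ heq
      by_contra hvw
      have hvw' : v ≠ w := fun h => hvw (by rw [h])
      refine hsmall ({v} ∪ {w}) ?_ (by rw [singleton_union]; exact ncard_pair hvw')
      have h4 : nb G ({v} ∪ {w}) ⊆ nb G {v} := (nb_union_subset _ _).trans
        (union_subset sdiff_subset (sdiff_subset.trans heq.symm.subset))
      exact (ncard_le_ncard h4).trans hv
    · rintro _ ⟨v, rfl, hv⟩ _ ⟨w, rfl, hw⟩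
      refine disjoint_singleton_right.2 fun hwv => ?_
      have hvw : v ∈ nb G {w} := by
        obtain ⟨hne, u, rfl, huw⟩ := hwv
        exact ⟨huw.ne, w, rfl, huw.symm⟩
      have hne : v ≠ w := fun h => hwv.1 h.symm
      refine hsmall ({v} ∪ {w}) ?_ (by rw [singleton_union]; exact ncard_pair hne)
      have h4 := (ncard_le_ncard (nb_union_subset (G := G) {v} {w})).trans (ncard_union_le _ _)
      have h5 : (nb G {v} \ {w}).ncard < (nb G {v}).ncard :=
        ncard_lt_ncard ⟨sdiff_subset, fun h => (h hwv).2 rfl⟩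
      have h6 : (nb G {w} \ {v}).ncard < (nb G {w}).ncard :=
        ncard_lt_ncard ⟨sdiff_subset, fun h => (h hvw).2 rfl⟩
      omega
  -- With a core of at most two vertices all parts would be attached at the same pair, so there
  -- would be at most one part, a single vertex.
  have hW : 3 ≤ Nat.card (core 𝓙) := by
    change 3 ≤ (core 𝓙).ncard
    by_contra hlt
    have heq : ∀ J ∈ 𝓙, nb G J = core 𝓙 := fun J hJ =>
      eq_of_subset_of_ncard_le (hT.nb_subset_core hJ) (by rw [hT.ncard_nb J hJ]; omega)
    have hsub : (core 𝓙)ᶜ.Subsingleton := by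
      intro v hv w hw
      obtain ⟨J, hJ, hvJ⟩ := not_not.1 hv
      obtain ⟨K, hK, hwK⟩ := not_not.1 hw
      obtain rfl := hT.nb_inj J hJ K hK ((heq J hJ).trans (heq K hK).symm)
      obtain ⟨u, rfl, -⟩ := hJ
      rw [mem_singleton_iff.1 hvJ, mem_singleton_iff.1 hwK]
    have h3 := ncard_le_one_iff_subsingleton.2 hsub
    have h4 := ncard_add_ncard_compl (core 𝓙)
    omega
  -- A small separation of the torso lifts to `G`, where one side is a single vertex. That vertex
  -- would be a part, yet it belongs to the core.
  have h3 : KConnected 3 (torso G 𝓙) := by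
    rintro S ⟨s, hs⟩ ⟨w, hwS, hwn⟩
    by_contra hlt
    have hcard := (hT.ncard_nb_expand_le S).trans (show _ ≤ 2 by omega)
    have hw : (w : V) ∈ (expand G 𝓙 S ∪ nb G (expand G 𝓙 S))ᶜ := by
      rintro (h | h)
      · exact hwS (mem_expand_iff.1 h)
      · obtain ⟨w', hw', hww'⟩ := hT.nb_expand_subset S h
        rw [Subtype.ext hww'] at hw'
        exact hwn hw'
    have hnot : ∀ (u : core 𝓙) (X : Set V), (nb G X).ncard ≤ 2 → (u : V) ∈ X →
        X.Subsingleton → False := by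
      intro u X hX hu hXs
      obtain rfl := (hXs.eq_singleton_of_mem hu)
      exact u.2 ⟨_, ⟨u, rfl, hX⟩, rfl⟩
    rcases (expand G 𝓙 S).subsingleton_or_nontrivial with hsub | hnt
    · exact hnot s _ hcard (mem_expand_iff.2 hs) hsub
    · exact hnot w _ ((ncard_le_ncard (nb_compl_subset _)).trans hcard) hw (hsep _ hcard hnt)
  obtain ⟨a, b, K, hK, hcov, hd, -⟩ := hT.isTripartite h2 hO hW h3
  have hF : ∀ i, Feasible G (K i) := by
    intro i
    rcases hK i with h | ⟨⟨v, h, -⟩, -⟩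
    · exact Or.inl h
    · rw [h]; exact feasible_singleton v
  refine feasible_univ_of_compl (a := a 0) (b := b 0) ?_ (hF 0)
    (feasible_compl_of_tripartite hK hcov hd fun j _ => hF j)
  rcases hK 0 with h | h
  · rw [h, nb_empty]; exact empty_subset _
  · exact h.2.subset

end Separations

/-! ### Reduction to 2-connected graphs -/

section Reduction

theorem isMinor_induce {V : Type*} (G : SimpleGraph V) (S : Set V) : IsMinor (G.induce S) G :=
  ⟨fun v => {(v : V)}, fun _ => (connSet_singleton _).induce_connected,
    fun _ _ hvw => disjoint_singleton.2 fun h => hvw (Subtype.ext h),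
    fun _ _ hvw => ⟨_, rfl, _, rfl, hvw⟩⟩

theorem ObstructionFree.induce {V : Type*} {G : SimpleGraph V} (hO : ObstructionFree G)
    (S : Set V) : ObstructionFree (G.induce S) :=
  fun H hH hm => hO H hH (hm.trans (isMinor_induce G S))

theorem Feas.eq_single_or_union {X : Type*} {P : Set X → Prop} {C : Set X} (h : Feas P C) :
    (∃ v, C = {v}) ∨ ∃ A B, Feas P A ∧ Feas P B ∧ Disjoint A B ∧ C = A ∪ B := by
  cases h with
  | single v => exact Or.inl ⟨v, rfl⟩
  | join hA hB hd => exact Or.inr ⟨_, _, hA, hB, hd, rfl⟩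

theorem Feas.exists_compl {X : Type*} [Nontrivial X] {P : Set X → Prop} (h : Feas P univ) :
    ∃ A, Feas P A ∧ Feas P Aᶜ := by
  rcases h.eq_single_or_union with ⟨v, hv⟩ | ⟨A, B, hA, hB, hd, hAB⟩
  · obtain ⟨w, hw⟩ := exists_ne v
    exact (hw (mem_singleton_iff.1 (hv ▸ mem_univ w))).elim
  · have : B = Aᶜ := by
      ext x
      refine ⟨fun hx h => disjoint_left.1 hd h hx, fun hx => ?_⟩
      exact (hAB ▸ mem_univ x : x ∈ A ∪ B).resolve_left hx
    exact ⟨A, hA, this ▸ hB⟩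

theorem Feas.compl_singleton {X : Type*} [Nontrivial X] {P : Set X → Prop}
    (hPc : ∀ A, P A → P Aᶜ) (h : Feas P univ) (v : X) : Feas P {v}ᶜ := by
  obtain ⟨A, hA, hA'⟩ := h.exists_compl
  by_cases hv : v ∈ A
  · exact hA.reroot hPc hA' v hv
  · exact hA'.reroot hPc (by rwa [compl_compl]) v hv

variable {V : Type*} {G : SimpleGraph V}

/-- If `X` has no neighbours outside `S`, its cut in `G` has the same edges as in the induced
subgraph, so covers carry over. -/
theorem Feas.image_val {S : Set V} {X : Set S} (h : Feas (Cov2 (G.induce S)) X)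
    (hX : ∀ x ∈ X, ∀ y, G.Adj x y → y ∈ S) : Feas (Cov2 G) (Subtype.val '' X) := by
  have hcov : ∀ X : Set S, Cov2 (G.induce S) X → (∀ x ∈ X, ∀ y, G.Adj x y → y ∈ S) →
      Cov2 G (Subtype.val '' X) := by
    rintro X ⟨a, b, hab⟩ hX
    refine ⟨a, b, ?_⟩
    rintro _ ⟨x, hx, rfl⟩ y hy hxy
    have hyS := hX x hx y hxy
    have := hab x hx ⟨y, hyS⟩ (fun h => hy ⟨_, h, rfl⟩) hxy
    simpa only [Subtype.ext_iff] using this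
  induction h with
  | single v hv =>
    have := hcov _ hv hX
    rw [image_singleton] at this ⊢
    exact .single _ this
  | join hA hB hd hP ihA ihB =>
    have := hcov _ hP hX
    rw [image_union] at this ⊢
    exact .join (ihA fun x hx => hX x (Or.inl hx)) (ihB fun x hx => hX x (Or.inr hx))
      ((disjoint_image_iff Subtype.val_injective).2 hd) this

/-- Induction on the order. Components are decomposed separately. At a cut vertex `c`, both sides
are decomposed with `c` included, the root is moved to the leaf `c` and this leaf is dropped; `c` is
put back once. -/
theorem ObstructionFree.feas_univ [Finite V] [Nonempty V] (hO : ObstructionFree G) :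
    Feas (Cov2 G) univ := by
  induction hn : Nat.card V using Nat.strong_induction_on generalizing V with | _ n ih => ?_
  subst hn
  have hcov : ∀ A, Cov2 G A → Cov2 G Aᶜ := fun _ => Cov2.compl
  have huniv : Cov2 G univ := ⟨Classical.arbitrary V, Classical.arbitrary V,
    fun _ _ y hy => (hy (mem_univ y)).elim⟩
  have hsub : ∀ S : Set V, S.Nonempty → (∃ v, v ∉ S) → Feas (Cov2 (G.induce S)) univ := by
    rintro S ⟨s, hs⟩ ⟨v, hv⟩
    have : Nonempty S := ⟨⟨s, hs⟩⟩
    refine ih _ ?_ (hO.induce S) rfl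
    change S.ncard < _
    rw [← ncard_univ]
    exact ncard_lt_ncard ⟨subset_univ S, fun h => hv (h (mem_univ v))⟩
  by_cases h2 : KConnected 2 G
  · exact (h2.feasible_univ hO).resolve_left univ_nonempty.ne_empty
  unfold KConnected at h2
  push Not at h2
  obtain ⟨J, ⟨j, hj⟩, ⟨o, hoJ, hon⟩, hlt⟩ := h2
  rcases (ncard_le_one_iff_eq).1 (Nat.lt_succ_iff.1 hlt) with hnb | ⟨c, hnb⟩
  · have h1 := (hsub J ⟨j, hj⟩ ⟨o, hoJ⟩).image_val fun x _ y hxy =>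
      (mem_or_mem_nb x.2 hxy).resolve_right fun h => notMem_empty y (hnb ▸ h)
    have h2 := (hsub Jᶜ ⟨o, hoJ⟩ ⟨j, fun h => h hj⟩).image_val fun x _ y hxy hy =>
      (mem_or_mem_nb hy hxy.symm).elim x.2 fun h => notMem_empty (x : V) (hnb ▸ h)
    simp only [image_univ, Subtype.range_coe] at h1 h2
    rw [← union_compl_self J] at huniv ⊢
    exact h1.join h2 disjoint_compl_right huniv
  · have hcJ : c ∉ J := (hnb ▸ rfl : c ∈ nb G J).1
    have hoc : o ≠ c := fun h => hon (hnb ▸ h)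
    have hjc : j ≠ c := fun h => hcJ (h ▸ hj)
    -- removing the cut vertex from a decomposition of the part `S`
    have key : ∀ S : Set V, c ∈ S → (∃ v ∈ S, v ≠ c) → (∃ v, v ∉ S) →
        (∀ x ∈ S, x ≠ c → ∀ y, G.Adj x y → y ∈ S) → Feas (Cov2 G) (S \ {c}) := by
      rintro S hcS ⟨v, hv, hvc⟩ hS hcl
      have : Nontrivial S := ⟨⟨⟨v, hv⟩, ⟨c, hcS⟩, fun h => hvc (congrArg Subtype.val h)⟩⟩
      have h1 := (Feas.compl_singleton (P := Cov2 (G.induce S)) (fun _ => Cov2.compl)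
        (hsub S ⟨c, hcS⟩ hS) ⟨c, hcS⟩).image_val fun x hx => hcl x x.2 fun h => hx (Subtype.ext h)
      convert h1 using 1
      ext w
      constructor
      · exact fun hw => ⟨⟨w, hw.1⟩, fun h => hw.2 (congrArg Subtype.val h), rfl⟩
      · rintro ⟨w, hw, rfl⟩
        exact ⟨w.2, fun h => hw (Subtype.ext h)⟩
    have h1 := key (insert c J) (mem_insert c J) ⟨j, Or.inr hj, hjc⟩ ⟨o, fun h => h.elim hoc hoJ⟩
      fun x hx hxc y hxy => by
        rcases mem_or_mem_nb (hx.resolve_left hxc) hxy with h | h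
        exacts [Or.inr h, Or.inl (mem_singleton_iff.1 (hnb ▸ h))]
    have h2 := key Jᶜ hcJ ⟨o, hoJ, hoc⟩ ⟨j, fun h => h hj⟩ fun x hx hxc y hxy hy =>
      (mem_or_mem_nb hy hxy.symm).elim hx fun h => hxc (mem_singleton_iff.1 (hnb ▸ h))
    rw [insert_sdiff_self_of_notMem hcJ] at h1
    -- Only edges at `c` cross between `J` and its complement, so joining the leaf `c` to the far
    -- side yields a cut covered by `c` alone.
    have h3 : Feas (Cov2 G) ({c} ∪ Jᶜ \ {c}) := by
      refine .join (.single c (cov2_singleton c)) h2 disjoint_sdiff_right ?_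
      rw [union_sdiff_cancel (singleton_subset_iff.2 hcJ)]
      exact (cov2_of_nb (a := c) (b := c) (by rw [hnb]; simp)).compl
    rw [union_sdiff_cancel (singleton_subset_iff.2 hcJ)] at h3
    rw [← union_compl_self J] at huniv ⊢
    exact h1.join h3 disjoint_compl_right huniv

theorem mmw_le_width (D : BranchDecomposition V) : mmw G ≤ D.width (mm G) :=
  Nat.sInf_le ⟨D, rfl⟩

theorem mmw_le_two_of_sides {D : BranchDecomposition V}
    (hD : ∀ a b, D.tree.Adj a b → Cov2 G (D.side a b)) : mmw G ≤ 2 := by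
  refine (mmw_le_width D).trans (csSup_le' ?_)
  rintro _ ⟨a, b, hab, rfl⟩
  exact (hD a b hab).mm_le

/-- On at most one vertex the bound holds for any decomposition, and by the convention for the empty
infimum also without one. -/
theorem ObstructionFree.mmw_le_two [Finite V] (hO : ObstructionFree G) : mmw G ≤ 2 := by
  rcases subsingleton_or_nontrivial V with hV | hV
  · by_cases hD : Nonempty (BranchDecomposition V)
    · obtain ⟨D⟩ := hD
      rcases isEmpty_or_nonempty V with hE | ⟨⟨z⟩⟩
      · refine (mmw_le_width D).trans (csSup_le' ?_)
        rintro _ ⟨a, b, -, rfl⟩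
        refine csSup_le' ?_
        rintro _ ⟨M, -, rfl⟩
        have : IsEmpty (Sym2 V) := ⟨fun e => by induction e with | h u v => exact hE.elim u⟩
        rw [eq_empty_of_isEmpty M.edgeSet, ncard_empty]
        exact Nat.zero_le _
      · exact mmw_le_two_of_sides (D := D) fun _ _ _ => ⟨z, z, fun x _ _ _ _ =>
          Or.inl (Subsingleton.elim x z)⟩
    · have : {w | ∃ D : BranchDecomposition V, D.width (mm G) = w} = ∅ :=
        eq_empty_of_forall_notMem fun _ ⟨D, _⟩ => hD ⟨D⟩
      rw [mmw, this, Nat.sInf_empty]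
      exact Nat.zero_le _
  · obtain ⟨A, hA, hA'⟩ := hO.feas_univ.exists_compl
    obtain ⟨D, hD⟩ := Feas.exists_branchDecomposition (P := Cov2 G) (fun _ => Cov2.compl) hA hA'
    exact mmw_le_two_of_sides hD

end Reduction

theorem theorem3 :
    (EdgeList.obstructions.length = 45 ∧
      EdgeList.obstructions.Pairwise fun H K => IsEmpty (H.graph ≃g K.graph)) ∧
    ∀ (V : Type*) [Finite V] (G : SimpleGraph V),
      mmw G ≤ 2 ↔ ∀ H ∈ EdgeList.obstructions, ¬ IsMinor H.graph G := by
  refine ⟨⟨rfl, EdgeList.pairwise_obstructions⟩, fun V _ G => ⟨fun h H hH hm => ?_, fun h => ?_⟩⟩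
  · exact absurd (EdgeList.two_lt_mmw_of_isMinor hH hm) (not_lt.2 h)
  · exact ObstructionFree.mmw_le_two h
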